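/- Let $n\ge 0$ and $k\ge 1$ be integers and let $\mathbf{k}$ be a commutative ring. Let $$H=\Big(\bigoplus_{i=1}^{n+1}\mathbb{Z}x_i\oplus\bigoplus_{j=1}^{k}\mathbb{Z}v_j\Big)\Big/\big(x_1+\dots+x_{n+1}-v_1-\dots-v_k\big),\qquad c_{i,j}=v_k+\dots+v_{j+1}-x_1-\dots-x_i\in H .$$ For a nonincreasing map $\phi:[1,n]\to[1,k]$ put $$S_\phi=\{v_j : j\notin\operatorname{im}\phi\}\cup\{x_{i+1} : \phi(i)=\phi(i+1)\}\cup\{-c_{i,\phi(i)} : i=1\text{ or }\phi(i-1)>\phi(i)\}\cup\{c_{i,\phi(i)-1} : i=n\text{ or }\phi(i+1)<\phi(i)\},$$ and let $\sigma_\phi\subset\operatorname{Hom}(H,\mathbb{R})$ be the cone dual to the cone generated by $S_\phi$. Let $\mathcal{Y}_{n,k}$ be the toric scheme over $\mathbf{k}$ obtained by gluing the affine schemes $\operatorname{Spec}\mathbf{k}[\tau^\vee\cap H]$, where $\tau$ runs over the cones $\sigma_\phi$ and their faces, and let $\pi:\mathcal{Y}_{n,k}\to\{X_1\cdots X_{n+1}=V_1\cdots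 V_k\}\subset\mathbb{A}^{n+1+k}_{\mathbf{k}}$ be the toric morphism which pulls back $X_i$ and $V_j$ to the characters $x_i$ and $v_j$. Identify $\operatorname{Hom}(H,\mathbb{R})$ with the hyperplane $\alpha_1+\dots+\alpha_{n+1}=\beta_1+\dots+\beta_k$ of $\mathbb{R}^{n+1}\times\mathbb{R}^k$ by $f\mapsto((f(x_i))_i,(f(v_j))_j)$; it contains the polytope $\Delta_n\times\Delta_{k-1}$ with vertices $(e_i,f_j)$, where $(e_i)$ and $(f_j)$ are the standard bases of $\mathbb{R}^{n+1}$ and $\mathbb{R}^k$. Let $\mathcal{T}$ be the standard (staircase) triangulation of $\Delta_n\times\Delta_{k-1}$ for the usual ordering of the vertices of $\Delta_n$ and the reversed ordering of the vertices of $\Delta_{k-1}$: its simplices are spanned by the nonempty sets of vertices $(e_i,f_j)$ whose indices $(i,j)$ form a chain for the order $(i,j)\preceq(i',j')\iff i\le i'$ and $j\ge j'$, so that its maximal simplices correspond to the lattice paths from $(1,k)$ to $(n+1,1)$. Then $\pi$ is the small resolution associated with $\mathcal{T}$. That is: (a) $\mathcal{T}$ is a triangulation of $\Delta_n\times\Delta_{k-1}$;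 (b) the cones $\sigma_\phi$ are exactly the cones over the maximal simplices of $\mathcal{T}$, each occurring once: there is a bijection $\phi\mapsto L_\phi$ from nonincreasing maps $[1,n]\to[1,k]$ to lattice paths such that $\sigma_\phi$ is the cone over the simplex of $L_\phi$, and $(i,\phi(i)),(i+1,\phi(i))\in L_\phi$ for $i=1,\dots,n$; (c) the cones $\sigma_\phi$ and their faces form a smooth fan, and this fan consists of the zero cone and the cones over the simplices of $\mathcal{T}$; (d) $\mathcal{Y}_{n,k}$ is isomorphic, compatibly with the affine toric charts and with the toric morphisms to $\{X_1\cdots X_{n+1}=V_1\cdots V_k\}$, to the toric scheme of the fan of cones over the simplices of $\mathcal{T}$; (e) $\pi$ is a small resolution: $\mathcal{Y}_{n,k}$ is smooth over $\mathbf{k}$, $\pi$ is proper, $\pi$ is an isomorphism over a dense open subset of the target whose preimage in $\mathcal{Y}_{n,k}$ is dense, and the set of points of $\mathcal{Y}_{n,k}$ at which $\pi$ is not a local isomorphism has codimension at least $2$. -/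

import Mathlib

open CategoryTheory CategoryTheory.Limits AlgebraicGeometry

universe u

noncomputable section

namespace SmallRes

section ToricSchemes

variable {M : Type} [AddCommGroup M]

/-- The monoid `σ^∨ ∩ M` of lattice points of the dual of a cone `σ` in `N_ℝ = Hom(M, ℝ)`. -/
def dualMonoid (σ : PointedCone ℝ (M →+ ℝ)) : AddSubmonoid M where
  carrier := {m | ∀ f ∈ σ, 0 ≤ f m}
  zero_mem' := by intro f _; simp
  add_mem' := by
    intro a b ha hb f hf
    simpa using add_nonneg (ha f hf) (hb f hf)

/-- `Q` is the localization `P - ℕ u` of the monoid `P` at an element `u` of `P`. -/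
def IsLocOf (Q P : AddSubmonoid M) : Prop :=
  ∃ u ∈ P, Q = P ⊔ AddSubmonoid.multiples (-u)

theorem IsLocOf.le {Q P : AddSubmonoid M} (h : IsLocOf Q P) : P ≤ Q := by
  obtain ⟨u, -, rfl⟩ := h
  exact le_sup_left

theorem IsLocOf.refl (P : AddSubmonoid M) : IsLocOf P P :=
  ⟨0, P.zero_mem, by simp⟩

theorem mem_loc {P : AddSubmonoid M} {u m : M} :
    m ∈ P ⊔ AddSubmonoid.multiples (-u) ↔ ∃ N : ℕ, m + N • u ∈ P := by
  constructor
  · intro h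
    obtain ⟨p, hp, z, ⟨N, rfl⟩, rfl⟩ := AddSubmonoid.mem_sup.1 h
    exact ⟨N, by simpa using hp⟩
  · rintro ⟨N, h⟩
    exact AddSubmonoid.mem_sup.2 ⟨_, h, N • (-u), ⟨N, rfl⟩, by simp⟩

theorem neg_mem_loc (P : AddSubmonoid M) (u : M) :
    -u ∈ P ⊔ AddSubmonoid.multiples (-u) :=
  (le_sup_right : _ ≤ P ⊔ AddSubmonoid.multiples (-u)) ⟨1, by simp⟩

/-- Localizing at `u` and then at `w` is localizing at a single element. -/
theorem loc_loc {P : AddSubmonoid M} {u w : M} (hu : u ∈ P)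
    (hw : w ∈ P ⊔ AddSubmonoid.multiples (-u)) :
    ∃ t ∈ P, (P ⊔ AddSubmonoid.multiples (-u)) ⊔ AddSubmonoid.multiples (-w) =
      P ⊔ AddSubmonoid.multiples (-t) := by
  obtain ⟨N, hN⟩ := mem_loc.1 hw
  have ht : (w + N • u) + u ∈ P := P.add_mem hN hu
  refine ⟨_, ht, le_antisymm ?_ ?_⟩
  · have hneg := neg_mem_loc P ((w + N • u) + u)
    have hP : P ≤ P ⊔ AddSubmonoid.multiples (-((w + N • u) + u)) := le_sup_left
    refine sup_le (sup_le hP ?_) ?_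
    · rw [AddSubmonoid.multiples_le]
      have := add_mem hneg (hP hN)
      convert this using 1
      abel
    · rw [AddSubmonoid.multiples_le]
      have := add_mem hneg (hP (P.nsmul_mem hu (N + 1)))
      convert this using 1
      rw [succ_nsmul]; abel
  · refine sup_le (le_sup_left.trans le_sup_left) ?_
    rw [AddSubmonoid.multiples_le]
    set L := (P ⊔ AddSubmonoid.multiples (-u)) ⊔ AddSubmonoid.multiples (-w)
    have h1 : -u ∈ L := (le_sup_left : _ ≤ L) (neg_mem_loc P u)
    have h2 : -w ∈ L := neg_mem_loc _ w
    have := add_mem h2 (L.nsmul_mem h1 (N + 1))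
    convert this using 1
    simp only [succ_nsmul, smul_neg]; abel

theorem loc_add {P : AddSubmonoid M} {u w : M} (hu : u ∈ P) (hw : w ∈ P) :
    (P ⊔ AddSubmonoid.multiples (-u)) ⊔ AddSubmonoid.multiples (-w) =
      P ⊔ AddSubmonoid.multiples (-(u + w)) := by
  refine le_antisymm ?_ ?_
  · have hneg := neg_mem_loc P (u + w)
    have hP : P ≤ P ⊔ AddSubmonoid.multiples (-(u + w)) := le_sup_left
    refine sup_le (sup_le hP ?_) ?_
    · rw [AddSubmonoid.multiples_le]
      have := add_mem hneg (hP hw)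
      convert this using 1
      abel
    · rw [AddSubmonoid.multiples_le]
      have := add_mem hneg (hP hu)
      convert this using 1
      abel
  · refine sup_le (le_sup_left.trans le_sup_left) ?_
    rw [AddSubmonoid.multiples_le]
    have h1 : -u ∈ (P ⊔ AddSubmonoid.multiples (-u)) ⊔ AddSubmonoid.multiples (-w) :=
      (le_sup_left : P ⊔ AddSubmonoid.multiples (-u) ≤ _) (neg_mem_loc P u)
    have := add_mem h1 (neg_mem_loc (P ⊔ AddSubmonoid.multiples (-u)) w)
    convert this using 1
    abel

theorem IsLocOf.trans {R Q P : AddSubmonoid M} (h₁ : IsLocOf R Q) (h₂ : IsLocOf Q P) :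
    IsLocOf R P := by
  obtain ⟨u, hu, rfl⟩ := h₂
  obtain ⟨w, hw, rfl⟩ := h₁
  exact loc_loc hu hw

/-- The affine charts of the toric scheme of `Σ`, given by their coordinate monoids: all
localizations `(σ^∨ ∩ M) - ℕ u` with `σ ∈ Σ` and `u ∈ σ^∨ ∩ M`. When `Σ` is a fan this is the set of
the monoids `τ^∨ ∩ M` with `τ ∈ Σ`, since for a rational polyhedral cone
`(σ^∨ ∩ M) - ℕ u = (σ ∩ u^⊥)^∨ ∩ M` and the cones `σ ∩ u^⊥` are the faces of `σ`. -/
structure Chart (C : Set (PointedCone ℝ (M →+ ℝ))) where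
  monoid : AddSubmonoid M
  exists_cone : ∃ σ ∈ C, IsLocOf monoid (dualMonoid σ)

variable (C : Set (PointedCone ℝ (M →+ ℝ)))

/-- Charts are ordered by being a (principal) open toric subscheme. -/
instance : Preorder (Chart C) where
  le Q P := IsLocOf Q.monoid P.monoid
  le_refl P := IsLocOf.refl P.monoid
  le_trans _ _ _ h₁ h₂ := h₁.trans h₂

instance : Small.{u} (Chart C) :=
  small_of_injective (β := AddSubmonoid M) (f := Chart.monoid) (by
    rintro ⟨P, _⟩ ⟨Q, _⟩ h
    cases h
    rfl)

variable (𝕜 : Type u) [CommRing 𝕜]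

/-- The inclusion `𝕜[P] → 𝕜[Q]` of monoid algebras. -/
def inclHom {P Q : AddSubmonoid M} (h : P ≤ Q) : AddMonoidAlgebra 𝕜 P →+* AddMonoidAlgebra 𝕜 Q :=
  AddMonoidAlgebra.mapDomainRingHom 𝕜 (AddSubmonoid.inclusion h)

theorem inclHom_single {P Q : AddSubmonoid M} (h : P ≤ Q) (p : P) (r : 𝕜) :
    inclHom 𝕜 h (AddMonoidAlgebra.single p r) =
      AddMonoidAlgebra.single (AddSubmonoid.inclusion h p) r := by
  simp [inclHom]

theorem inclHom_refl (P : AddSubmonoid M) : inclHom 𝕜 (le_refl P) = RingHom.id _ := by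
  refine RingHom.ext fun x => ?_
  induction x using AddMonoidAlgebra.induction_linear with
  | zero => simp
  | add x y hx hy => rw [map_add, hx, hy]; rfl
  | single m r => rw [inclHom_single]; rfl

theorem inclHom_comp {P Q R : AddSubmonoid M} (h : P ≤ Q) (h' : Q ≤ R) :
    (inclHom 𝕜 h').comp (inclHom 𝕜 h) = inclHom 𝕜 (h.trans h') := by
  refine RingHom.ext fun x => ?_
  induction x using AddMonoidAlgebra.induction_linear with
  | zero => simp
  | add x y hx hy => rw [map_add, hx, hy, map_add]
  | single m r => rw [RingHom.comp_apply, inclHom_single, inclHom_single, inclHom_single]; rfl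

theorem isLocalization_inclHom {P Q : AddSubmonoid M} {u : M} (hu : u ∈ P)
    (hQ : Q = P ⊔ AddSubmonoid.multiples (-u)) (h : P ≤ Q) :
    letI := (inclHom 𝕜 h).toAlgebra
    IsLocalization.Away (AddMonoidAlgebra.single (⟨u, hu⟩ : P) (1 : 𝕜)) (AddMonoidAlgebra 𝕜 Q) := by
  let _ := (inclHom 𝕜 h).toAlgebra
  have key : ∀ N : ℕ, (AddMonoidAlgebra.single (⟨u, hu⟩ : P) (1 : 𝕜)) ^ N =
      AddMonoidAlgebra.single (N • (⟨u, hu⟩ : P)) (1 : 𝕜) := by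
    intro N; simp [AddMonoidAlgebra.single_pow]
  have halg : ∀ x, algebraMap (AddMonoidAlgebra 𝕜 P) (AddMonoidAlgebra 𝕜 Q) x = inclHom 𝕜 h x :=
    fun _ => rfl
  have hnu : -u ∈ Q := hQ ▸ neg_mem_loc P u
  refine ⟨?_, ?_, ?_⟩
  · rintro ⟨_, N, rfl⟩
    simp only [map_pow]
    refine IsUnit.pow _ (IsUnit.of_mul_eq_one (AddMonoidAlgebra.single (⟨-u, hnu⟩ : Q) (1 : 𝕜)) ?_)
    rw [halg, inclHom_single, AddMonoidAlgebra.single_mul_single, AddMonoidAlgebra.one_def]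
    congr 1
    · ext; simp
    · simp
  · intro z
    suffices H : ∃ N : ℕ, ∃ a, z * inclHom 𝕜 h ((AddMonoidAlgebra.single (⟨u, hu⟩ : P) (1 : 𝕜)) ^ N)
        = inclHom 𝕜 h a by
      obtain ⟨N, a, H⟩ := H
      exact ⟨(a, ⟨_, N, rfl⟩), H⟩
    induction z using AddMonoidAlgebra.induction_linear with
    | zero => exact ⟨0, 0, by simp⟩
    | add x y hx hy =>
      obtain ⟨N, a, ha⟩ := hx
      obtain ⟨K, b, hb⟩ := hy
      refine ⟨N + K, a * (AddMonoidAlgebra.single (⟨u, hu⟩ : P) (1 : 𝕜)) ^ K +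
        b * (AddMonoidAlgebra.single (⟨u, hu⟩ : P) (1 : 𝕜)) ^ N, ?_⟩
      rw [map_add, map_mul, map_mul, ← ha, ← hb, pow_add, map_mul]
      ring
    | single m r =>
      have hm : (m : M) ∈ P ⊔ AddSubmonoid.multiples (-u) := hQ ▸ m.2
      obtain ⟨N, hN⟩ := mem_loc.1 hm
      refine ⟨N, AddMonoidAlgebra.single ⟨_, hN⟩ r, ?_⟩
      rw [key, inclHom_single, inclHom_single, AddMonoidAlgebra.single_mul_single]
      congr 1
      simp
  · intro x y hxy
    refine ⟨1, ?_⟩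
    have : Function.Injective (inclHom 𝕜 h) :=
      AddMonoidAlgebra.mapDomain_injective (AddSubmonoid.inclusion_injective h)
    rw [this hxy]

theorem isOpenImmersion_inclHom {P Q : AddSubmonoid M} (hQ : IsLocOf Q P) :
    IsOpenImmersion (Spec.map (CommRingCat.ofHom (inclHom 𝕜 hQ.le))) := by
  obtain ⟨u, hu, h⟩ := id hQ
  let _ := (inclHom 𝕜 hQ.le).toAlgebra
  have := isLocalization_inclHom 𝕜 hu h hQ.le
  exact IsOpenImmersion.of_isLocalization (AddMonoidAlgebra.single (⟨u, hu⟩ : P) (1 : 𝕜))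

theorem range_inclHom {P Q : AddSubmonoid M} {u : M} (hu : u ∈ P)
    (hQ : Q = P ⊔ AddSubmonoid.multiples (-u)) (h : P ≤ Q) :
    Set.range (Spec.map (CommRingCat.ofHom (inclHom 𝕜 h))) =
      {p | AddMonoidAlgebra.single (⟨u, hu⟩ : P) (1 : 𝕜) ∉ p.asIdeal} := by
  let _ := (inclHom 𝕜 h).toAlgebra
  have := isLocalization_inclHom 𝕜 hu hQ h
  exact PrimeSpectrum.localization_away_comap_range (AddMonoidAlgebra 𝕜 Q)
    (AddMonoidAlgebra.single (⟨u, hu⟩ : P) (1 : 𝕜))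

/-- The diagram of the affine charts `Spec 𝕜[P]`. -/
def chartFunctor : Chart C ⥤ Scheme.{u} where
  obj P := Spec (.of (AddMonoidAlgebra 𝕜 P.monoid))
  map {Q P} f := Spec.map (CommRingCat.ofHom (inclHom 𝕜 (leOfHom f).le))
  map_id P := by
    rw [inclHom_refl]
    exact Spec.map_id _
  map_comp {R Q P} f g := by
    rw [← Spec.map_comp, ← CommRingCat.ofHom_comp, inclHom_comp]

instance {Q P : Chart C} (f : Q ⟶ P) : IsOpenImmersion ((chartFunctor C 𝕜).map f) :=
  isOpenImmersion_inclHom 𝕜 (leOfHom f)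

instance : (chartFunctor C 𝕜 ⋙ Scheme.forget).IsLocallyDirected where
  cond {i j k} fi fj xi xj hx := by
    obtain ⟨u, hu, hi⟩ := leOfHom fi
    obtain ⟨w, hw, hj⟩ := leOfHom fj
    set P := k.monoid with hPdef
    have hadd := loc_add hu hw
    have hadd' := loc_add hw hu
    have hli : IsLocOf (P ⊔ AddSubmonoid.multiples (-(u + w))) i.monoid :=
      ⟨w, (leOfHom fi).le hw, by rw [hi, hadd]⟩
    have hlj : IsLocOf (P ⊔ AddSubmonoid.multiples (-(u + w))) j.monoid :=
      ⟨u, (leOfHom fj).le hu, by rw [hj, hadd', add_comm]⟩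
    have hlk : IsLocOf (P ⊔ AddSubmonoid.multiples (-(u + w))) k.monoid := hli.trans (leOfHom fi)
    let l : Chart C := ⟨P ⊔ AddSubmonoid.multiples (-(u + w)),
      let ⟨σ, hσ, h⟩ := k.exists_cone
      ⟨σ, hσ, hlk.trans h⟩⟩
    let gi : l ⟶ i := homOfLE hli
    let gj : l ⟶ j := homOfLE hlj
    let p : Spec (.of (AddMonoidAlgebra 𝕜 k.monoid)) := (chartFunctor C 𝕜).map fi xi
    have hpj : p = (chartFunctor C 𝕜).map fj xj := hx
    have h1 : AddMonoidAlgebra.single (⟨u, hu⟩ : k.monoid) (1 : 𝕜) ∉ p.asIdeal := by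
      have := range_inclHom 𝕜 hu hi (leOfHom fi).le
      have h : p ∈ Set.range (Spec.map (CommRingCat.ofHom (inclHom 𝕜 (leOfHom fi).le))) := ⟨xi, rfl⟩
      rw [this] at h
      exact h
    have h2 : AddMonoidAlgebra.single (⟨w, hw⟩ : k.monoid) (1 : 𝕜) ∉ p.asIdeal := by
      have := range_inclHom 𝕜 hw hj (leOfHom fj).le
      have h : p ∈ Set.range (Spec.map (CommRingCat.ofHom (inclHom 𝕜 (leOfHom fj).le))) :=
        ⟨xj, hpj.symm⟩
      rw [this] at h
      exact h
    have h3 : AddMonoidAlgebra.single (⟨u + w, add_mem hu hw⟩ : k.monoid) (1 : 𝕜) ∉ p.asIdeal := by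
      have h := p.isPrime.mul_notMem h1 h2
      rw [AddMonoidAlgebra.single_mul_single, one_mul] at h
      exact h
    obtain ⟨z, hz⟩ : p ∈ Set.range (Spec.map (CommRingCat.ofHom (inclHom 𝕜 hlk.le))) := by
      rw [range_inclHom 𝕜 (add_mem hu hw) rfl hlk.le]
      exact h3
    let z' : (chartFunctor C 𝕜).obj l := z
    have e1 : (chartFunctor C 𝕜).map fi ((chartFunctor C 𝕜).map gi z') = p := by
      rw [← Scheme.Hom.comp_apply, ← Functor.map_comp]
      exact hz
    have e2 : (chartFunctor C 𝕜).map fj ((chartFunctor C 𝕜).map gj z') = p := by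
      rw [← Scheme.Hom.comp_apply, ← Functor.map_comp]
      exact hz
    refine ⟨l, gi, gj, z', ?_, ?_⟩
    · exact ((chartFunctor C 𝕜).map fi).isOpenEmbedding.injective e1
    · exact ((chartFunctor C 𝕜).map fj).isOpenEmbedding.injective (e2.trans hpj)

/-- The toric scheme over `𝕜` of a fan: the affine charts `Spec 𝕜[σ^∨ ∩ M]` glued along their common
open toric subschemes. -/
def toricScheme : Scheme.{u} := colimit (chartFunctor C 𝕜)

/-- The inclusion of an affine chart. -/
def chartι (P : Chart C) : Spec (.of (AddMonoidAlgebra 𝕜 P.monoid)) ⟶ toricScheme C 𝕜 :=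
  colimit.ι (chartFunctor C 𝕜) P

end ToricSchemes

section Fans

variable {M : Type} [AddCommGroup M]

/-- A point of the lattice `N = Hom(M, ℤ)`, seen in `N_ℝ = Hom(M, ℝ)`. -/
def latticePoint (g : M →+ ℤ) : M →+ ℝ := (Int.castAddHom ℝ).comp g

/-- Fans of strongly convex rational polyhedral cones in `N_ℝ`. -/
structure IsFan (C : Set (PointedCone ℝ (M →+ ℝ))) : Prop where
  finite : C.Finite
  rational_polyhedral : ∀ σ ∈ C, ∃ s : Finset (M →+ ℤ),
    σ = PointedCone.hull ℝ (latticePoint '' (s : Set (M →+ ℤ)))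
  strongly_convex : ∀ σ ∈ C, ∀ f ∈ σ, -f ∈ σ → f = 0
  face_mem : ∀ σ ∈ C, ∀ τ : PointedCone ℝ (M →+ ℝ), τ.IsFaceOf σ → τ ∈ C
  inter_isFaceOf : ∀ σ ∈ C, ∀ τ ∈ C, (σ ⊓ τ).IsFaceOf σ

/-- A fan is smooth if each of its cones is generated by a part of a basis of the lattice `N`. -/
structure IsSmoothFan (C : Set (PointedCone ℝ (M →+ ℝ))) : Prop extends IsFan C where
  smooth : ∀ σ ∈ C, ∃ (r : ℕ) (b : Module.Basis (Fin r) ℤ (M →+ ℤ)) (I : Set (Fin r)),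
    σ = PointedCone.hull ℝ (latticePoint '' (b '' I))

end Fans

/-- Small resolutions of a scheme `X` over a base `B`: proper birational morphisms `π : Y ⟶ X` with
`Y` smooth over `B`, such that the exceptional locus (the set of points at which `π` is not a local
isomorphism) has codimension at least two in `Y`. -/
structure IsSmallResolution {Y X B : Scheme.{u}} (π : Y ⟶ X) (s : X ⟶ B) : Prop where
  smooth : Smooth (π ≫ s)
  proper : IsProper π
  birational : ∃ V : X.Opens, Dense (V : Set X) ∧ Dense ((π ⁻¹ᵁ V : Y.Opens) : Set Y) ∧
    IsIso (π ∣_ V)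
  small : ∀ y : Y, (¬ ∃ U : Y.Opens, y ∈ U ∧ IsOpenImmersion (U.ι ≫ π)) → 2 ≤ Order.coheight y

section Lattice

variable (n k : ℕ)

/-- The lattice `H = (ℤ x₁ ⊕ ⋯ ⊕ ℤ xₙ₊₁ ⊕ ℤ v₁ ⊕ ⋯ ⊕ ℤ vₖ) / (x₁ + ⋯ + xₙ₊₁ - v₁ - ⋯ - vₖ)`. -/
abbrev H : Type :=
  ((Fin (n + 1) → ℤ) × (Fin k → ℤ)) ⧸
    AddSubgroup.zmultiples ((1, -1) : (Fin (n + 1) → ℤ) × (Fin k → ℤ))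

variable {n k}

/-- The classes `x₁, …, xₙ₊₁` (indexed from `0`). -/
def x (i : Fin (n + 1)) : H n k := QuotientAddGroup.mk (Pi.single i 1, 0)

/-- The classes `v₁, …, vₖ` (indexed from `0`). -/
def v (j : Fin k) : H n k := QuotientAddGroup.mk (0, Pi.single j 1)

theorem sum_x_eq_sum_v : ∑ i, x i = (∑ j, v j : H n k) := by
  have h1 : (∑ i, x i : H n k) = QuotientAddGroup.mk (1, 0) := by
    unfold x
    rw [← QuotientAddGroup.mk_sum]
    congr 1
    ext i <;> simp [Prod.fst_sum, Prod.snd_sum, Finset.sum_apply]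
  have h2 : (∑ j, v j : H n k) = QuotientAddGroup.mk (0, 1) := by
    unfold v
    rw [← QuotientAddGroup.mk_sum]
    congr 1
    ext i <;> simp [Prod.fst_sum, Prod.snd_sum, Finset.sum_apply]
  rw [h1, h2, QuotientAddGroup.eq]
  exact ⟨-1, by ext <;> simp⟩

/-- `c_{i,j} = v_k + ⋯ + v_{j+1} - x_1 - ⋯ - x_i` for `0 ≤ i ≤ n + 1` and `0 ≤ j ≤ k`. -/
def c (i j : ℕ) : H n k :=
  (∑ b ∈ Finset.univ.filter (fun b : Fin k => j ≤ b.val), v b) -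
    ∑ a ∈ Finset.univ.filter (fun a : Fin (n + 1) => a.val < i), x a

/-- The set `S_φ`. The map `φ`, the `x`'s and the `v`'s are indexed from `0`, so that
`p : Fin n` stands for `i = p + 1`, and `φ(i)` is `φ p + 1`. -/
def S (φ : Fin n → Fin k) : Set (H n k) :=
  {h | ∃ j, j ∉ Set.range φ ∧ h = v j} ∪
  {h | ∃ p q : Fin n, q.val = p.val + 1 ∧ φ p = φ q ∧ h = x q.castSucc} ∪
  {h | ∃ p : Fin n, (∀ q : Fin n, p.val = q.val + 1 → φ p < φ q) ∧
    h = -c (p.val + 1) ((φ p).val + 1)} ∪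
  {h | ∃ p : Fin n, (∀ q : Fin n, q.val = p.val + 1 → φ q < φ p) ∧
    h = c (p.val + 1) (φ p).val}

/-- The cone `σ_φ` in `H^∨ ⊗ ℝ = Hom(H, ℝ)`, dual to the cone generated by `S_φ`. -/
def cone (φ : Fin n → Fin k) : PointedCone ℝ (H n k →+ ℝ) where
  carrier := {f | ∀ s ∈ S φ, 0 ≤ f s}
  zero_mem' := by intro s _; simp
  add_mem' := by
    intro f g hf hg s hs
    simpa using add_nonneg (hf s hs) (hg s hs)
  smul_mem' := by
    intro r f hf s hs
    exact mul_nonneg r.2 (hf s hs)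

variable (n k)

/-- The fan of `𝒴_{n,k}`: the cones `σ_φ`, for `φ` nonincreasing, and their faces. -/
def fan : Set (PointedCone ℝ (H n k →+ ℝ)) :=
  {τ | ∃ φ : Fin n → Fin k, Antitone φ ∧ τ.IsFaceOf (cone φ)}

variable {n k}

/-- All `x_i` and `v_j` are nonnegative on the cones, so that they are regular functions on the
toric scheme. -/
def XVNonneg (C : Set (PointedCone ℝ (H n k →+ ℝ))) : Prop :=
  ∀ σ ∈ C, (∀ i, x i ∈ dualMonoid σ) ∧ (∀ j, v j ∈ dualMonoid σ)

theorem apply_c (f : H n k →+ ℝ) (i j : ℕ) :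
    f (c i j) = (∑ b ∈ Finset.univ.filter (fun b : Fin k => j ≤ b.val), f (v b)) -
      ∑ a ∈ Finset.univ.filter (fun a : Fin (n + 1) => a.val < i), f (x a) := by
  simp [c]

theorem sum_v_succ (g : Fin k → ℝ) (j : Fin k) :
    ∑ b ∈ Finset.univ.filter (fun b : Fin k => j.val ≤ b.val), g b =
      g j + ∑ b ∈ Finset.univ.filter (fun b : Fin k => j.val + 1 ≤ b.val), g b := by
  rw [← Finset.sum_insert (f := g) (by simp)]
  congr 1
  ext b
  simp [Fin.ext_iff]
  omega

theorem sum_x_succ (g : Fin n → ℝ) (i : Fin n) :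
    ∑ a ∈ Finset.univ.filter (fun a : Fin n => a.val < i.val + 1), g a =
      g i + ∑ a ∈ Finset.univ.filter (fun a : Fin n => a.val < i.val), g a := by
  rw [← Finset.sum_insert (f := g) (by simp)]
  congr 1
  ext b
  simp [Fin.ext_iff]
  omega

theorem nonneg_of_mem_cone {φ : Fin n → Fin k} (hφ : Antitone φ) {f : H n k →+ ℝ}
    (hf : f ∈ cone φ) : (∀ i, 0 ≤ f (x i)) ∧ ∀ j, 0 ≤ f (v j) := by
  have hf' : ∀ s ∈ S φ, 0 ≤ f s := hf
  obtain ⟨B, hB⟩ : ∃ B : ℕ → ℝ, ∀ j, B j =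
    ∑ b ∈ Finset.univ.filter (fun b : Fin k => j ≤ b.val), f (v b) := ⟨_, fun _ => rfl⟩
  obtain ⟨A, hA⟩ : ∃ A : ℕ → ℝ, ∀ i, A i =
    ∑ a ∈ Finset.univ.filter (fun a : Fin (n + 1) => a.val < i), f (x a) := ⟨_, fun _ => rfl⟩
  have hc : ∀ i j, f (c i j) = B j - A i := fun i j => by rw [apply_c, hA, hB]
  have hBs : ∀ j : Fin k, B j.val = f (v j) + B (j.val + 1) := fun j => by
    rw [hB, hB]; exact sum_v_succ (fun b => f (v b)) j
  have hAs : ∀ i : Fin (n + 1), A (i.val + 1) = f (x i) + A i.val := fun i => by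
    rw [hA, hA]; exact sum_x_succ (fun b => f (x b)) i
  have hx : ∀ p q : Fin n, q.val = p.val + 1 → φ p = φ q → 0 ≤ f (x q.castSucc) :=
    fun p q h h' => hf' _ (Or.inl (Or.inl (Or.inr ⟨p, q, h, h', rfl⟩)))
  have hfirst : ∀ p : Fin n, (∀ q : Fin n, p.val = q.val + 1 → φ p < φ q) →
      B ((φ p).val + 1) ≤ A (p.val + 1) := fun p h => by
    have := hf' _ (Or.inl (Or.inr ⟨p, h, rfl⟩))
    rw [map_neg, hc] at this
    linarith
  have hlast : ∀ p : Fin n, (∀ q : Fin n, q.val = p.val + 1 → φ q < φ p) →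
      A (p.val + 1) ≤ B (φ p).val := fun p h => by
    have := hf' _ (Or.inr ⟨p, h, rfl⟩)
    rw [hc] at this
    linarith
  have hstep : ∀ p q : Fin n, q.val = p.val + 1 → φ p = φ q → A (p.val + 1) ≤ A (q.val + 1) := by
    intro p q h h'
    have h1 := hx p q h h'
    have h2 := hAs q.castSucc
    simp only [Fin.val_castSucc] at h2
    rw [h2, ← h]
    linarith
  have hup : ∀ d : ℕ, ∀ p : Fin n, p.val + d + 1 = n → A (p.val + 1) ≤ B (φ p).val := by
    intro d
    induction d with
    | zero => exact fun p hp => hlast p (fun q hq => by omega)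
    | succ d ih =>
      intro p hp
      by_cases h : ∃ q : Fin n, q.val = p.val + 1 ∧ φ p = φ q
      · obtain ⟨q, hq, hpq⟩ := h
        have h1 := ih q (by omega)
        rw [← hpq] at h1
        exact (hstep p q hq hpq).trans h1
      · refine hlast p (fun q hq => lt_of_le_of_ne (hφ (Fin.le_def.2 (by omega))) ?_)
        exact fun h' => h ⟨q, hq, h'.symm⟩
  have hup' : ∀ p : Fin n, A (p.val + 1) ≤ B (φ p).val :=
    fun p => hup (n - p.val - 1) p (by omega)
  have hlow : ∀ d : ℕ, ∀ p : Fin n, p.val = d → B ((φ p).val + 1) ≤ A (p.val + 1) := by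
    intro d
    induction d with
    | zero => exact fun p hp => hfirst p (fun q hq => by omega)
    | succ d ih =>
      intro p hp
      by_cases h : ∃ q : Fin n, p.val = q.val + 1 ∧ φ p = φ q
      · obtain ⟨q, hq, hpq⟩ := h
        have h1 := ih q (by omega)
        rw [← hpq] at h1
        exact h1.trans (hstep q p hq hpq.symm)
      · refine hfirst p (fun q hq => lt_of_le_of_ne (hφ (Fin.le_def.2 (by omega))) ?_)
        exact fun h' => h ⟨q, hq, h'⟩
  have hlow' : ∀ p : Fin n, B ((φ p).val + 1) ≤ A (p.val + 1) := fun p => hlow _ p rfl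
  have hv : ∀ j, 0 ≤ f (v j) := by
    intro j
    by_cases hj : j ∈ Set.range φ
    · obtain ⟨p, rfl⟩ := hj
      have h1 := hup' p
      have h2 := hlow' p
      have h3 := hBs (φ p)
      linarith
    · exact hf' _ (Or.inl (Or.inl (Or.inl ⟨j, hj, rfl⟩)))
  have hBanti : ∀ j j' : ℕ, j ≤ j' → B j' ≤ B j := by
    intro j j' h
    rw [hB, hB]
    refine Finset.sum_le_sum_of_subset_of_nonneg ?_ (fun b _ _ => hv b)
    intro b hb
    simp only [Finset.mem_filter, Finset.mem_univ, true_and] at hb ⊢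
    omega
  have hB0 : ∀ j, 0 ≤ B j := fun j => by
    rw [hB]; exact Finset.sum_nonneg (fun b _ => hv b)
  have hA0 : A 0 = 0 := by rw [hA]; simp
  have hAn : A (n + 1) = B 0 := by
    have h1 : A (n + 1) = f (∑ i, x i) := by
      rw [hA, map_sum, Finset.filter_true_of_mem (fun a _ => a.2)]
    have h2 : B 0 = f (∑ j, v j) := by
      rw [hB, map_sum, Finset.filter_true_of_mem (fun b _ => Nat.zero_le _)]
    rw [h1, h2, sum_x_eq_sum_v]
  refine ⟨fun i => ?_, hv⟩
  have hi := hAs i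
  rcases Nat.eq_zero_or_pos i.val with h0 | h0
  · rw [h0, hA0] at hi
    rcases Nat.eq_zero_or_pos n with hn | hn
    · have h1 := hB0 0
      rw [hn] at hAn
      linarith
    · have h1 := hlow' ⟨0, hn⟩
      have h2 := hB0 ((φ ⟨0, hn⟩).val + 1)
      simp only at h1
      linarith
  · have hlt : i.val - 1 < n := by omega
    have h1 := hup' ⟨i.val - 1, hlt⟩
    simp only [Nat.sub_add_cancel h0] at h1
    rcases Nat.lt_or_ge i.val n with hn | hn
    · have h2 := hlow' ⟨i.val, hn⟩
      simp only at h2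
      have hle : φ ⟨i.val, hn⟩ ≤ φ ⟨i.val - 1, hlt⟩ := hφ (Fin.le_def.2 (Nat.sub_le _ _))
      rcases hle.lt_or_eq with h | h
      · have h3 := hBanti _ _ (Nat.succ_le_of_lt (Fin.lt_def.1 h))
        simp only [Nat.succ_eq_add_one] at h3
        linarith
      · exact hx ⟨i.val - 1, hlt⟩ ⟨i.val, hn⟩ (by simp only; omega) h.symm
    · have hin : i.val = n := by omega
      have h2 := hBanti 0 _ (Nat.zero_le (φ ⟨i.val - 1, hlt⟩).val)
      have h3 : A (i.val + 1) = A (n + 1) := by rw [hin]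
      linarith

theorem fan_nonneg : XVNonneg (fan n k) := by
  rintro τ ⟨φ, hφ, hτ⟩
  exact ⟨fun i f hf => (nonneg_of_mem_cone hφ (hτ.le hf)).1 i,
    fun j f hf => (nonneg_of_mem_cone hφ (hτ.le hf)).2 j⟩

end Lattice

section Schemes

variable (n k : ℕ) (𝕜 : Type u) [CommRing 𝕜]

/-- The coordinate ring `𝕜[X₁, …, Xₙ₊₁, V₁, …, Vₖ] / (X₁ ⋯ Xₙ₊₁ - V₁ ⋯ Vₖ)`. -/
abbrev HypersurfaceRing : Type u :=
  MvPolynomial (Fin (n + 1) ⊕ Fin k) 𝕜 ⧸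
    Ideal.span {(∏ i : Fin (n + 1), MvPolynomial.X (Sum.inl i) -
      ∏ j : Fin k, MvPolynomial.X (Sum.inr j) : MvPolynomial (Fin (n + 1) ⊕ Fin k) 𝕜)}

/-- The hypersurface `X₁ ⋯ Xₙ₊₁ = V₁ ⋯ Vₖ` in the affine space over `𝕜`. -/
def hypersurface : Scheme.{u} := Spec (.of (HypersurfaceRing n k 𝕜))

/-- The structure morphism of the hypersurface. -/
def hypersurfaceToBase : hypersurface n k 𝕜 ⟶ Spec (.of 𝕜) :=
  Spec.map (CommRingCat.ofHom (algebraMap 𝕜 (HypersurfaceRing n k 𝕜)))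

variable {n k}

theorem prod_single {ι : Type} [Fintype ι] {P : AddSubmonoid (H n k)} (g : ι → P) :
    ∏ i, AddMonoidAlgebra.single (g i) (1 : 𝕜) = AddMonoidAlgebra.single (∑ i, g i) 1 := by
  simp

/-- The ring homomorphism `X_i ↦ χ^{x_i}`, `V_j ↦ χ^{v_j}`. -/
def chartHom (P : AddSubmonoid (H n k)) (hP : (∀ i, x i ∈ P) ∧ ∀ j, v j ∈ P) :
    HypersurfaceRing n k 𝕜 →+* AddMonoidAlgebra 𝕜 P :=
  Ideal.Quotient.lift _
    (MvPolynomial.aeval (R := 𝕜) (Sum.elim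
      (fun i => AddMonoidAlgebra.single (⟨x i, hP.1 i⟩ : P) (1 : 𝕜))
      (fun j => AddMonoidAlgebra.single (⟨v j, hP.2 j⟩ : P) (1 : 𝕜)))).toRingHom (by
    suffices h : Ideal.span {(∏ i : Fin (n + 1), MvPolynomial.X (Sum.inl i) -
        ∏ j : Fin k, MvPolynomial.X (Sum.inr j) : MvPolynomial (Fin (n + 1) ⊕ Fin k) 𝕜)} ≤
        RingHom.ker (MvPolynomial.aeval (R := 𝕜) (Sum.elim
          (fun i => AddMonoidAlgebra.single (⟨x i, hP.1 i⟩ : P) (1 : 𝕜))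
          (fun j => AddMonoidAlgebra.single (⟨v j, hP.2 j⟩ : P) (1 : 𝕜)))).toRingHom from
      fun a ha => RingHom.mem_ker.1 (h ha)
    rw [Ideal.span_singleton_le_iff_mem, RingHom.mem_ker]
    simp only [AlgHom.toRingHom_eq_coe, RingHom.coe_coe, map_sub, map_prod, MvPolynomial.aeval_X,
      Sum.elim_inl, Sum.elim_inr]
    rw [prod_single, prod_single, sub_eq_zero]
    congr 1
    ext
    simp [sum_x_eq_sum_v])

theorem inclHom_comp_chartHom {P Q : AddSubmonoid (H n k)} (h : P ≤ Q)
    (hP : (∀ i, x i ∈ P) ∧ ∀ j, v j ∈ P) (hQ : (∀ i, x i ∈ Q) ∧ ∀ j, v j ∈ Q) :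
    (inclHom 𝕜 h).comp (chartHom 𝕜 P hP) = chartHom 𝕜 Q hQ := by
  refine Ideal.Quotient.ringHom_ext (MvPolynomial.ringHom_ext (fun r => ?_) ?_)
  · simp [chartHom, inclHom]
  · rintro (i | j) <;> simp [chartHom, inclHom] <;> rfl

theorem Chart.nonneg {C : Set (PointedCone ℝ (H n k →+ ℝ))} (hC : XVNonneg C) (P : Chart C) :
    (∀ i, x i ∈ P.monoid) ∧ ∀ j, v j ∈ P.monoid := by
  obtain ⟨σ, hσ, h⟩ := P.exists_cone
  exact ⟨fun i => h.le ((hC σ hσ).1 i), fun j => h.le ((hC σ hσ).2 j)⟩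

/-- The toric morphism from the toric scheme of a fan to the hypersurface, given on each chart by
`X_i ↦ χ^{x_i}`, `V_j ↦ χ^{v_j}`. -/
def toHypersurface {C : Set (PointedCone ℝ (H n k →+ ℝ))} (hC : XVNonneg C) :
    toricScheme C 𝕜 ⟶ hypersurface n k 𝕜 :=
  colimit.desc (chartFunctor C 𝕜)
    { pt := hypersurface n k 𝕜
      ι :=
        { app := fun P => Spec.map (CommRingCat.ofHom (chartHom 𝕜 P.monoid (P.nonneg hC)))
          naturality := by
            intro Q P f
            refine Eq.trans ?_ (Category.comp_id _).symm
            change Spec.map _ ≫ Spec.map _ = Spec.map _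
            rw [← Spec.map_comp, ← CommRingCat.ofHom_comp,
              inclHom_comp_chartHom 𝕜 (leOfHom f).le (P.nonneg hC) (Q.nonneg hC)] } }

variable (n k)

/-- The toric scheme `𝒴_{n,k}`. -/
def Y : Scheme.{u} := toricScheme (fan n k) 𝕜

/-- The toric morphism `π` from `𝒴_{n,k}` to the hypersurface `X₁ ⋯ Xₙ₊₁ = V₁ ⋯ Vₖ`. -/
def π : Y n k 𝕜 ⟶ hypersurface n k 𝕜 := toHypersurface 𝕜 fan_nonneg

end Schemes

section Triangulation

/-- The vertex `(e_i, f_j)` of a product of two standard simplices. -/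
def vertex {ι κ : Type} [DecidableEq ι] [DecidableEq κ] (p : ι × κ) : (ι → ℝ) × (κ → ℝ) :=
  (Pi.single p.1 1, Pi.single p.2 1)

/-- The product of two order relations. -/
def prodRel {ι κ : Type} (r : ι → ι → Prop) (s : κ → κ → Prop) (p q : ι × κ) : Prop :=
  r p.1 q.1 ∧ s p.2 q.2

/-- The standard (staircase) triangulation of the product of two standard simplices whose vertices
are ordered by `r` and `s`: its simplices are spanned by the nonempty chains of vertices. Simplices
are given by their sets of vertices. -/
def staircase {ι κ : Type} [DecidableEq ι] [DecidableEq κ] (r : ι → ι → Prop) (s : κ → κ → Prop) :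
    Set (Finset ((ι → ℝ) × (κ → ℝ))) :=
  {t | ∃ L : Finset (ι × κ), L.Nonempty ∧ IsChain (prodRel r s) (L : Set (ι × κ)) ∧
    (t : Set ((ι → ℝ) × (κ → ℝ))) = vertex '' (L : Set (ι × κ))}

variable (n k : ℕ)

/-- The polytope `Π = Δ_n × Δ_{k-1}`. -/
def polytope : Set ((Fin (n + 1) → ℝ) × (Fin k → ℝ)) :=
  stdSimplex ℝ (Fin (n + 1)) ×ˢ stdSimplex ℝ (Fin k)

/-- The standard triangulation of `Δ_n × Δ_{k-1}` for the usual ordering of the vertices of `Δ_n`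
and the reversed ordering of the vertices of `Δ_{k-1}`. -/
def triangulation : Set (Finset ((Fin (n + 1) → ℝ) × (Fin k → ℝ))) :=
  staircase (· ≤ ·) (· ≥ ·)

variable {n k}

/-- The embedding of `Hom(H, ℝ)` in `ℝ^{n+1} × ℝ^k` as the hyperplane
`α₁ + ⋯ + αₙ₊₁ = β₁ + ⋯ + βₖ`. -/
def coords : (H n k →+ ℝ) →ₗ[ℝ] (Fin (n + 1) → ℝ) × (Fin k → ℝ) where
  toFun f := (fun i => f (x i), fun j => f (v j))
  map_add' _ _ := rfl
  map_smul' _ _ := rfl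

/-- The cone in `Hom(H, ℝ)` over the simplex with a given set of vertices. -/
def coneOver (A : Set ((Fin (n + 1) → ℝ) × (Fin k → ℝ))) : PointedCone ℝ (H n k →+ ℝ) :=
  (PointedCone.hull ℝ (convexHull ℝ A)).comap coords

variable (n k)

/-- The fan of the cones over the simplices of the triangulation (including the zero cone, over the
empty simplex). -/
def triangulationFan : Set (PointedCone ℝ (H n k →+ ℝ)) :=
  {τ | τ = coneOver ∅ ∨ ∃ t ∈ triangulation n k, τ = coneOver (t : Set _)}

variable {n k}

theorem nonneg_of_mem_coneOver {A : Set ((Fin (n + 1) → ℝ) × (Fin k → ℝ))}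
    (hA : ∀ a ∈ A, 0 ≤ a) {f : H n k →+ ℝ} (hf : f ∈ coneOver A) :
    (∀ i, 0 ≤ f (x i)) ∧ ∀ j, 0 ≤ f (v j) := by
  have h1 : PointedCone.hull ℝ (convexHull ℝ A) ≤ PointedCone.positive ℝ _ :=
    Submodule.span_le.2 (convexHull_min (fun a ha => hA a ha)
      (PointedCone.positive ℝ _).convex)
  have h2 : (0 : (Fin (n + 1) → ℝ) × (Fin k → ℝ)) ≤ coords f := h1 hf
  exact ⟨fun i => h2.1 i, fun j => h2.2 j⟩

theorem triangulationFan_nonneg : XVNonneg (triangulationFan n k) := by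
  have key : ∀ A : Set ((Fin (n + 1) → ℝ) × (Fin k → ℝ)), (∀ a ∈ A, 0 ≤ a) →
      (∀ i, x i ∈ dualMonoid (coneOver A : PointedCone ℝ (H n k →+ ℝ))) ∧
        ∀ j, v j ∈ dualMonoid (coneOver A : PointedCone ℝ (H n k →+ ℝ)) := fun A hA =>
    ⟨fun i f hf => (nonneg_of_mem_coneOver hA hf).1 i,
      fun j f hf => (nonneg_of_mem_coneOver hA hf).2 j⟩
  rintro τ (rfl | ⟨t, ⟨L, -, -, hL⟩, rfl⟩)
  · exact key ∅ (fun a ha => ha.elim)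
  · refine key _ (fun a ha => ?_)
    rw [hL] at ha
    obtain ⟨p, -, rfl⟩ := ha
    exact Prod.mk_le_mk.2 ⟨Pi.single_nonneg.2 zero_le_one, Pi.single_nonneg.2 zero_le_one⟩

variable (n k) (𝕜 : Type u) [CommRing 𝕜]

/-- The toric scheme of the fan of the cones over the simplices of the triangulation. -/
def triangulationScheme : Scheme.{u} := toricScheme (triangulationFan n k) 𝕜

/-- The toric morphism to the hypersurface which is attached to the triangulation. -/
def triangulationResolution : triangulationScheme n k 𝕜 ⟶ hypersurface n k 𝕜 :=
  toHypersurface 𝕜 triangulationFan_nonneg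

end Triangulation

end SmallRes

end

/-! A linear form f that is nonnegative on the x's and v's cuts one interval in two ways: at the
partial sums A_i = f(x_1 + ... + x_i), and at B_j = f(v_k + ... + v_{j+1}), where A_{n+1} = B_0. The
sign of f(c_{i,j}) = B_j - A_i compares two cut points, so a nonincreasing φ records an order in
which the two sets of cut points interleave. The lengths of the overlaps of the pieces [A_i,
A_{i+1}] and [B_{j+1}, B_j] write f as a nonnegative combination of the vertices (e_i, f_j),
supported on a staircase.

Once φ is fixed, each overlap length is the value of f at an element `dualVec φ q` of H. These
elements are dual to the vertices of the lattice path (`ray_dualVec`), vanish off the path, and have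
the x's and v's as row and column sums. Hence they generate H (`eq_sum_dualVec`), and the vertices
of the path form a basis of the dual lattice. Since the dual basis lies in S_φ (`dualVec_mem_S`),
σ_φ is the cone on the vertices of the path (`cone_eq_rayCone`). Overlap lengths do not depend on φ
(`map_dualVec_eq`), so the cones meet along common faces (`rayCone_inf`). Any two sets of cut points
can be interleaved (`exists_nonnegOn_path_le`), so the cones cover. Slicing by ∑ f(x_i) = 1 turns
these facts into the triangulation.

For the schemes, the chart of a lattice path is an affine space whose coordinates are the characters
`dualVec φ q`, which gives smoothness. Separatedness comes from `separator`, a character whose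
inversion produces the intersection of two charts. For the valuative criterion,
`exists_nonnegOn_path_le` is applied again, now to the monoid of characters that are integral at a
K-point; it is total because R is a valuation ring.

Finally, the hypersurface ring is the monoid algebra on the monoid generated by the x's and v's
(`chartHom_hypersurfaceMonoid_bijective`). The torus and the charts of single rays are principal
localizations of that monoid, so π is an open immersion on them. At a point outside all ray charts
at least two coordinates of an affine space vanish, so its codimension is at least 2. -/

noncomputable section

namespace SmallRes

/-! ### Lattice paths and the dual basis of a path -/

section Combinatorics

variable {n k : ℕ}

/-- The partial sum `x₁ + ⋯ + x_i`. -/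
def partialX (i : ℕ) : H n k :=
  ∑ a ∈ Finset.univ.filter (fun a : Fin (n + 1) => a.val < i), x a

/-- The partial sum `v_k + ⋯ + v_{j+1}`. -/
def partialV (j : ℕ) : H n k :=
  ∑ b ∈ Finset.univ.filter (fun b : Fin k => j ≤ b.val), v b

theorem c_eq (i j : ℕ) : (c i j : H n k) = partialV j - partialX i := rfl

theorem partialX_zero : (partialX 0 : H n k) = 0 := by simp [partialX]

theorem partialV_last : (partialV k : H n k) = 0 := by
  refine Finset.sum_eq_zero fun b hb => ?_
  simp only [Finset.mem_filter] at hb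
  omega

theorem partialX_last : (partialX (n + 1) : H n k) = partialV 0 := by
  simp only [partialX, partialV, Fin.is_lt, Finset.filter_true, Nat.zero_le]
  exact sum_x_eq_sum_v

theorem partialX_succ (i : Fin (n + 1)) :
    (partialX (i.val + 1) : H n k) = partialX i.val + x i := by
  have : Finset.univ.filter (fun a : Fin (n + 1) => a.val < i.val + 1) =
      insert i (Finset.univ.filter (fun a : Fin (n + 1) => a.val < i.val)) := by
    ext b; simp [Fin.ext_iff]; omega
  rw [partialX, this, Finset.sum_insert (by simp), add_comm, partialX]

theorem partialV_eq (j : Fin k) :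
    (partialV j.val : H n k) = partialV (j.val + 1) + v j := by
  have : Finset.univ.filter (fun b : Fin k => j.val ≤ b.val) =
      insert j (Finset.univ.filter (fun b : Fin k => j.val + 1 ≤ b.val)) := by
    ext b; simp [Fin.ext_iff]; omega
  rw [partialV, this, Finset.sum_insert (by simp), add_comm, partialV]

/-- The lattice path with horizontal steps from `(i, φ(i))` to `(i + 1, φ(i))`. -/
def path (φ : Fin n → Fin k) : Finset (Fin (n + 1) × Fin k) :=
  Finset.univ.filter fun q =>
    ∀ p : Fin n, (q.1.val ≤ p.val → φ p ≤ q.2) ∧ (p.val < q.1.val → q.2 ≤ φ p)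

theorem mem_path {φ : Fin n → Fin k} {q : Fin (n + 1) × Fin k} :
    q ∈ path φ ↔ ∀ p : Fin n, (q.1.val ≤ p.val → φ p ≤ q.2) ∧ (p.val < q.1.val → q.2 ≤ φ p) := by
  simp [path]

theorem hom_ext_H {G : Type*} [AddCommGroup G] {f g : H n k →+ G}
    (hx : ∀ i, f (x i) = g (x i)) (hv : ∀ j, f (v j) = g (v j)) : f = g := by
  refine QuotientAddGroup.addMonoidHom_ext _ (AddMonoidHom.ext fun m => ?_)
  have hm : (QuotientAddGroup.mk m : H n k) = (∑ i, m.1 i • x i) + ∑ j, m.2 j • v j := by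
    simp only [x, v, ← QuotientAddGroup.mk_zsmul, ← QuotientAddGroup.mk_sum,
      ← QuotientAddGroup.mk_add]
    congr 1
    ext a <;> simp [Prod.fst_sum, Prod.snd_sum, Finset.sum_apply, Pi.single_apply]
  change f (QuotientAddGroup.mk m) = g (QuotientAddGroup.mk m)
  simp only [hm, map_add, map_sum, map_zsmul, hx, hv]

theorem exists_rep (h : H n k) : ∃ (α : Fin (n + 1) → ℤ) (β : Fin k → ℤ),
    h = (∑ i, α i • x i) + ∑ j, β j • v j := by
  obtain ⟨m, rfl⟩ := QuotientAddGroup.mk_surjective h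
  refine ⟨m.1, m.2, ?_⟩
  simp only [x, v, ← QuotientAddGroup.mk_zsmul, ← QuotientAddGroup.mk_sum,
    ← QuotientAddGroup.mk_add]
  congr 1
  ext a <;> simp [Prod.fst_sum, Prod.snd_sum, Finset.sum_apply, Pi.single_apply]

/-- The linear form on `H` with given values on the generators. -/
def homOfSumEq {G : Type*} [AddCommGroup G] (α : Fin (n + 1) → G) (β : Fin k → G)
    (h : ∑ i, α i = ∑ j, β j) : H n k →+ G :=
  QuotientAddGroup.lift _
    { toFun := fun m => (∑ i, m.1 i • α i) + ∑ j, m.2 j • β j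
      map_zero' := by simp
      map_add' := fun a b => by
        simp only [Prod.fst_add, Prod.snd_add, Pi.add_apply, add_smul, Finset.sum_add_distrib]
        abel } (by
    intro m hm
    obtain ⟨z, rfl⟩ := AddSubgroup.mem_zmultiples_iff.1 hm
    simp [← Finset.smul_sum, h])

theorem homOfSumEq_x {G : Type*} [AddCommGroup G] (α : Fin (n + 1) → G) (β : Fin k → G)
    (h : ∑ i, α i = ∑ j, β j) (i) : homOfSumEq α β h (x i) = α i := by
  change (∑ a, (Pi.single i 1 : Fin (n + 1) → ℤ) a • α a) + ∑ j : Fin k, (0 : ℤ) • β j = α i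
  simp [Pi.single_apply]

theorem homOfSumEq_v {G : Type*} [AddCommGroup G] (α : Fin (n + 1) → G) (β : Fin k → G)
    (h : ∑ i, α i = ∑ j, β j) (j) : homOfSumEq α β h (v j) = β j := by
  change (∑ a : Fin (n + 1), (0 : ℤ) • α a) + ∑ b, (Pi.single j 1 : Fin k → ℤ) b • β b = β j
  simp [Pi.single_apply]

/-- The lattice point `(e_i, f_j)` of `Hom(H, ℤ)`. -/
def ray (q : Fin (n + 1) × Fin k) : H n k →+ ℤ :=
  homOfSumEq (Pi.single q.1 1) (Pi.single q.2 1) (by simp)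

theorem ray_x (q : Fin (n + 1) × Fin k) (a) : ray q (x a) = if a = q.1 then 1 else 0 := by
  simp [ray, homOfSumEq_x, Pi.single_apply]

theorem ray_v (q : Fin (n + 1) × Fin k) (b) : ray q (v b) = if b = q.2 then 1 else 0 := by
  simp [ray, homOfSumEq_v, Pi.single_apply]

theorem ray_partialX (q : Fin (n + 1) × Fin k) (i : ℕ) :
    ray q (partialX i) = if q.1.val < i then 1 else 0 := by
  simp [partialX, ray_x, Finset.sum_ite_eq']

theorem ray_partialV (q : Fin (n + 1) × Fin k) (j : ℕ) :
    ray q (partialV j) = if j ≤ q.2.val then 1 else 0 := by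
  simp [partialV, ray_v, Finset.sum_ite_eq']

open Classical in
/-- The partial sum `v_k + ⋯ + v_{j+1}`, clipped to the interval between `x₁ + ⋯ + x_i` and
`x₁ + ⋯ + x_{i+1}` according to the comparisons prescribed by `φ`. -/
def clip (φ : Fin n → Fin k) (i : Fin (n + 1)) (j : ℕ) : H n k :=
  if ∃ p : Fin n, p.val = i.val ∧ j ≤ (φ p).val then partialX (i.val + 1)
  else if ∃ p : Fin n, p.val + 1 = i.val ∧ (φ p).val < j then partialX i.val
  else partialV j

/-- The element of `H` which is dual to the vertex `q` of the lattice path of `φ`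
(and zero for the other vertices). -/
def dualVec (φ : Fin n → Fin k) (q : Fin (n + 1) × Fin k) : H n k :=
  clip φ q.1 q.2.val - clip φ q.1 (q.2.val + 1)

/-- On vertices of the path, clipping makes the value a step function in the lexicographic position
of the vertex relative to (i, j). Differences in j therefore single out one vertex, which is what
makes `dualVec` dual to the path. -/
theorem ray_clip {φ : Fin n → Fin k} {q : Fin (n + 1) × Fin k} (hq : q ∈ path φ)
    (i : Fin (n + 1)) (j : ℕ) :
    ray q (clip φ i j) = if q.1 < i ∨ (q.1 = i ∧ j ≤ q.2.val) then 1 else 0 := by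
  rw [mem_path] at hq
  simp only [Fin.lt_def, Fin.ext_iff, Fin.le_def] at hq ⊢
  by_cases h1 : ∃ p : Fin n, p.val = i.val ∧ j ≤ (φ p).val
  · rw [clip, if_pos h1, ray_partialX]
    obtain ⟨p, hp, hj⟩ := h1
    have := hq p
    exact if_congr (by omega) rfl rfl
  by_cases h2 : ∃ p : Fin n, p.val + 1 = i.val ∧ (φ p).val < j
  · rw [clip, if_neg h1, if_pos h2, ray_partialX]
    obtain ⟨p, hp, hj⟩ := h2
    have := hq p
    exact if_congr (by omega) rfl rfl
  · rw [clip, if_neg h1, if_neg h2, ray_partialV]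
    push Not at h1 h2
    refine if_congr ⟨fun h => ?_, fun h => ?_⟩ rfl rfl
    · by_contra hc
      have hlt : i.val < n := by omega
      have := hq ⟨i.val, hlt⟩
      have := h1 ⟨i.val, hlt⟩ rfl
      simp only at *
      omega
    · rcases h with h | h
      · have hlt : i.val - 1 < n := by omega
        have := hq ⟨i.val - 1, hlt⟩
        have := h2 ⟨i.val - 1, hlt⟩ (by simp only; omega)
        simp only at *
        omega
      · exact h.2

theorem ray_dualVec {φ : Fin n → Fin k} {q : Fin (n + 1) × Fin k} (hq : q ∈ path φ)
    (p : Fin (n + 1) × Fin k) : ray q (dualVec φ p) = if p = q then 1 else 0 := by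
  rw [dualVec, map_sub, ray_clip hq, ray_clip hq]
  simp only [Prod.ext_iff, Fin.ext_iff, Fin.lt_def]
  split_ifs <;> omega

/-- Off the path, both cut points j and j + 1 lie on the same side of the interval attached to the
row, so they are clipped to the same end and their difference vanishes. -/
theorem dualVec_eq_zero {φ : Fin n → Fin k} (hφ : Antitone φ) {q : Fin (n + 1) × Fin k}
    (hq : q ∉ path φ) : dualVec φ q = 0 := by
  rw [mem_path] at hq
  push Not at hq
  obtain ⟨p, hp⟩ := hq
  rw [dualVec, sub_eq_zero]
  by_cases h : q.1.val ≤ p.val ∧ q.2 < φ p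
  · have hlt : q.1.val < n := by omega
    have h1 : φ p ≤ φ ⟨q.1.val, hlt⟩ := hφ (Fin.le_def.2 h.1)
    have h2 := h.2
    rw [Fin.le_def] at h1
    rw [Fin.lt_def] at h2
    rw [clip, clip, if_pos ⟨⟨q.1.val, hlt⟩, rfl, by omega⟩, if_pos ⟨⟨q.1.val, hlt⟩, rfl, by omega⟩]
  · obtain ⟨h1, h2⟩ : p.val < q.1.val ∧ φ p < q.2 := by
      by_contra hc
      exact hc (hp (fun hle => not_lt.1 fun hlt => h ⟨hle, hlt⟩))
    have hlt : q.1.val - 1 < n := by omega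
    have h3 : φ ⟨q.1.val - 1, hlt⟩ ≤ φ p := hφ (Fin.le_def.2 (by simp only; omega))
    rw [Fin.lt_def] at h2
    rw [Fin.le_def] at h3
    have hno : ∀ j, q.2.val ≤ j → ¬ ∃ r : Fin n, r.val = q.1.val ∧ j ≤ (φ r).val := by
      rintro j hj ⟨r, hr, hjr⟩
      have h4 : φ r ≤ φ p := hφ (Fin.le_def.2 (by omega))
      rw [Fin.le_def] at h4
      omega
    rw [clip, clip, if_neg (hno _ le_rfl), if_neg (hno _ (Nat.le_succ _)),
      if_pos ⟨⟨q.1.val - 1, hlt⟩, by simp only; omega, by omega⟩,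
      if_pos ⟨⟨q.1.val - 1, hlt⟩, by simp only; omega, by omega⟩]

theorem clip_zero (φ : Fin n → Fin k) (i : Fin (n + 1)) :
    clip φ i 0 = partialX (i.val + 1) := by
  rw [clip]
  split_ifs with h1 h2
  · rfl
  · obtain ⟨p, -, h⟩ := h2
    omega
  · have : i.val = n := by
      by_contra hc
      exact h1 ⟨⟨i.val, by omega⟩, rfl, Nat.zero_le _⟩
    rw [this, partialX_last]

theorem clip_last (φ : Fin n → Fin k) (i : Fin (n + 1)) : clip φ i k = partialX i.val := by
  rw [clip]
  split_ifs with h1 h2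
  · obtain ⟨p, -, h⟩ := h1
    omega
  · rfl
  · have : i.val = 0 := by
      by_contra hc
      exact h2 ⟨⟨i.val - 1, by omega⟩, by simp only; omega, Fin.is_lt _⟩
    rw [this, partialX_zero, partialV_last]

/-- The overlaps of the i-th x-piece with all the v-pieces fill that x-piece: the sum telescopes
between the two ends of the interval. -/
theorem sum_dualVec_row (φ : Fin n → Fin k) (i : Fin (n + 1)) :
    ∑ j, dualVec φ (i, j) = x i := by
  have h : ∑ j : Fin k, dualVec φ (i, j) =
      ∑ j ∈ Finset.range k, (clip φ i j - clip φ i (j + 1)) :=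
    (Finset.sum_range fun j => clip φ i j - clip φ i (j + 1)).symm
  rw [h, Finset.sum_range_sub', clip_zero, clip_last, partialX_succ, add_sub_cancel_left]

open Classical in
/-- The partial sum `x₁ + ⋯ + x_i`, clipped to the interval between `v_k + ⋯ + v_{j+2}` and
`v_k + ⋯ + v_{j+1}` according to the comparisons prescribed by `φ`. -/
def clipCol (φ : Fin n → Fin k) (i : ℕ) (j : Fin k) : H n k :=
  if i = 0 ∨ ∃ p : Fin n, p.val + 1 = i ∧ j < φ p then partialV (j.val + 1)
  else if ∃ p : Fin n, p.val + 1 = i ∧ φ p = j then partialX i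
  else partialV j.val

/-- The overlap of two intervals can be computed by clipping either one to the other. The transposed
form is needed because `dualVec` telescopes only along rows, and `clipCol` telescopes along columns.
-/
theorem dualVec_eq_clipCol {φ : Fin n → Fin k} (hφ : Antitone φ) (i : Fin (n + 1)) (j : Fin k) :
    dualVec φ (i, j) = clipCol φ (i.val + 1) j - clipCol φ i.val j := by
  -- The steps of the path leaving and entering the i-th row are absent only in the last and in the
  -- first row. Resolving the existentials once leaves finitely many arithmetic comparisons.
  have hnext : (∀ Q : Fin n → Prop, ¬ ∃ r : Fin n, r.val = i.val ∧ Q r) ∨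
      ∃ p : Fin n, p.val = i.val ∧ ∀ Q : Fin n → Prop, (∃ r : Fin n, r.val = i.val ∧ Q r) ↔ Q p := by
    by_cases h : i.val < n
    · refine Or.inr ⟨⟨i.val, h⟩, rfl, fun Q => ⟨?_, fun hQ => ⟨_, rfl, hQ⟩⟩⟩
      rintro ⟨r, hr, hQ⟩
      rwa [show r = ⟨i.val, h⟩ from Fin.ext hr] at hQ
    · exact Or.inl (by rintro Q ⟨r, hr, -⟩; omega)
  have hprev : (i.val = 0 ∧ ∀ Q : Fin n → Prop, ¬ ∃ r : Fin n, r.val + 1 = i.val ∧ Q r) ∨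
      i.val ≠ 0 ∧ ∃ p : Fin n, p.val + 1 = i.val ∧
        ∀ Q : Fin n → Prop, (∃ r : Fin n, r.val + 1 = i.val ∧ Q r) ↔ Q p := by
    by_cases h : i.val = 0
    · exact Or.inl ⟨h, by rintro Q ⟨r, hr, -⟩; omega⟩
    · have hlt : i.val - 1 < n := by omega
      have hp : i.val - 1 + 1 = i.val := by omega
      refine Or.inr ⟨h, ⟨i.val - 1, hlt⟩, hp, fun Q => ⟨?_, fun hQ => ⟨_, hp, hQ⟩⟩⟩
      rintro ⟨r, hr, hQ⟩
      rwa [show r = ⟨i.val - 1, hlt⟩ from Fin.ext (by simp only; omega)] at hQ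
  have hanti : ∀ p q : Fin n, p.val + 1 = i.val → q.val = i.val → (φ q).val ≤ (φ p).val :=
    fun p q hp hq => hφ (Fin.le_def.2 (by omega))
  simp only [dualVec, clip, clipCol, Nat.add_right_cancel_iff, Nat.add_eq_zero_iff, one_ne_zero,
    and_false, false_or]
  rcases hnext with hn | ⟨q, hq, hn⟩ <;> rcases hprev with ⟨h0, hp⟩ | ⟨h0, p, hp', hp⟩ <;>
    simp only [hn, hp, if_false, Fin.lt_def, Fin.ext_iff] <;>
    simp only [h0, false_or, or_false, if_true]
  · split_ifs <;> first | omega | abel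
  · split_ifs <;> first | omega | abel
  · have := hanti p q hp' hq
    split_ifs <;> first | omega | abel

theorem sum_dualVec_col {φ : Fin n → Fin k} (hφ : Antitone φ) (j : Fin k) :
    ∑ i, dualVec φ (i, j) = v j := by
  simp only [dualVec_eq_clipCol hφ]
  rw [← Finset.sum_range (fun i => clipCol φ (i + 1) j - clipCol φ i j),
    Finset.sum_range_sub (fun i => clipCol φ i j)]
  have h0 : clipCol φ 0 j = partialV (j.val + 1) := by simp [clipCol]
  have h1 : clipCol φ (n + 1) j = partialV j.val := by
    rw [clipCol, if_neg, if_neg]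
    · rintro ⟨p, hp, -⟩
      omega
    · rintro (h | ⟨p, hp, -⟩) <;> omega
  rw [h0, h1, partialV_eq, add_sub_cancel_left]

/-- Since `dualVec` vanishes off the path, the sum may run over the whole grid. The identity is then
checked on generators, where it reduces to the row sums for x_i and the column sums for v_j. No
count of ranks is needed. -/
theorem eq_sum_dualVec {φ : Fin n → Fin k} (hφ : Antitone φ) (h : H n k) :
    h = ∑ q ∈ path φ, ray q h • dualVec φ q := by
  have h1 : ∑ q ∈ path φ, ray q h • dualVec φ q = ∑ q, ray q h • dualVec φ q := by
    refine Finset.sum_subset (Finset.subset_univ _) fun q _ hq => ?_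
    rw [dualVec_eq_zero hφ hq, smul_zero]
  rw [h1]
  suffices AddMonoidHom.id (H n k) =
      ∑ q, (AddMonoidHom.flip (smulAddHom ℤ (H n k)) (dualVec φ q)).comp (ray q) by
    simpa using DFunLike.congr_fun this h
  refine hom_ext_H (fun i => ?_) (fun j => ?_)
  · simp only [AddMonoidHom.finsetSum_apply, AddMonoidHom.comp_apply, AddMonoidHom.flip_apply,
      smulAddHom_apply, ray_x, AddMonoidHom.id_apply]
    rw [Fintype.sum_prod_type]
    simp [sum_dualVec_row]
  · simp only [AddMonoidHom.finsetSum_apply, AddMonoidHom.comp_apply, AddMonoidHom.flip_apply,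
      smulAddHom_apply, ray_v, AddMonoidHom.id_apply]
    rw [Fintype.sum_prod_type_right]
    simp [sum_dualVec_col hφ]

theorem map_eq_sum {G : Type*} [AddCommGroup G] {φ : Fin n → Fin k} (hφ : Antitone φ)
    (f : H n k →+ G) (h : H n k) : f h = ∑ q ∈ path φ, ray q h • f (dualVec φ q) := by
  conv_lhs => rw [eq_sum_dualVec hφ h]
  simp

end Combinatorics

/-! ### The cones σ_φ, their faces and the smooth fan -/

section Cones

variable {n k : ℕ}

/-- The four families in S_φ correspond to the four shapes of a path at a vertex. If horizontal
steps both enter and leave, the dual vector is an x; if one only leaves, it is some -c; if one only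
enters, it is some c; if neither occurs, it is a v whose index is not in the image of φ. -/
theorem dualVec_mem_S {φ : Fin n → Fin k} (hφ : Antitone φ) {q : Fin (n + 1) × Fin k}
    (hq : q ∈ path φ) : dualVec φ q ∈ S φ := by
  obtain ⟨i, j⟩ := q
  rw [mem_path] at hq
  simp only at hq
  have hup : clip φ i j.val =
      open Classical in if ∃ p : Fin n, p.val = i.val ∧ φ p = j then partialX (i.val + 1)
        else partialV j.val := by
    have h1 : (∃ p : Fin n, p.val = i.val ∧ j.val ≤ (φ p).val) ↔
        ∃ p : Fin n, p.val = i.val ∧ φ p = j := by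
      refine exists_congr fun p => and_congr_right fun hp => ?_
      have := (hq p).1 hp.ge
      exact ⟨fun h => le_antisymm this h, fun h => h ▸ le_rfl⟩
    have h2 : ¬ ∃ p : Fin n, p.val + 1 = i.val ∧ (φ p).val < j.val := by
      rintro ⟨p, hp, hlt⟩
      have := (hq p).2 (by omega)
      exact absurd hlt (not_lt.2 this)
    rw [clip, if_neg h2]
    simp only [h1]
  have hlow : clip φ i (j.val + 1) =
      open Classical in if ∃ p : Fin n, p.val + 1 = i.val ∧ φ p = j then partialX i.val
        else partialV (j.val + 1) := by
    have h1 : ¬ ∃ p : Fin n, p.val = i.val ∧ j.val + 1 ≤ (φ p).val := by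
      rintro ⟨p, hp, hlt⟩
      have := (hq p).1 hp.ge
      exact absurd (Nat.lt_of_succ_le hlt) (not_lt.2 this)
    have h2 : (∃ p : Fin n, p.val + 1 = i.val ∧ (φ p).val < j.val + 1) ↔
        ∃ p : Fin n, p.val + 1 = i.val ∧ φ p = j := by
      refine exists_congr fun p => and_congr_right fun hp => ?_
      have := (hq p).2 (by omega)
      exact ⟨fun h => le_antisymm (Nat.le_of_lt_succ h) this, fun h => h ▸ Nat.lt_succ_self _⟩
    rw [clip, if_neg h1]
    simp only [h2]
  rw [dualVec]
  simp only [hup, hlow]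
  by_cases h1 : ∃ p : Fin n, p.val = i.val ∧ φ p = j <;>
    by_cases h2 : ∃ p : Fin n, p.val + 1 = i.val ∧ φ p = j
  · rw [if_pos h1, if_pos h2, partialX_succ, add_sub_cancel_left]
    obtain ⟨p, hp, hpj⟩ := h1
    obtain ⟨p', hp', hpj'⟩ := h2
    exact Or.inl (Or.inl (Or.inr ⟨p', p, by omega, hpj'.trans hpj.symm,
      congrArg x (Fin.ext hp.symm)⟩))
  · rw [if_pos h1, if_neg h2]
    obtain ⟨p, hp, rfl⟩ := h1
    refine Or.inl (Or.inr ⟨p, fun q hpq => ?_, by rw [c_eq, neg_sub, hp]⟩)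
    refine lt_of_le_of_ne ((hq q).2 (by omega)) fun h => h2 ⟨q, by omega, h.symm⟩
  · rw [if_neg h1, if_pos h2]
    obtain ⟨p, hp, rfl⟩ := h2
    refine Or.inr ⟨p, fun q hpq => ?_, by rw [c_eq, hp]⟩
    refine lt_of_le_of_ne ((hq q).1 (by omega)) fun h => h1 ⟨q, by omega, h⟩
  · rw [if_neg h1, if_neg h2, partialV_eq, add_sub_cancel_left]
    refine Or.inl (Or.inl (Or.inl ⟨j, ?_, rfl⟩))
    rintro ⟨r, rfl⟩
    rcases lt_or_ge r.val i.val with h | h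
    · have hlt : i.val - 1 < n := by omega
      refine h2 ⟨⟨i.val - 1, hlt⟩, by simp only; omega, le_antisymm (hφ (Fin.le_def.2 ?_)) ?_⟩
      · simp only; omega
      · exact (hq _).2 (by simp only; omega)
    · refine h1 ⟨⟨i.val, by omega⟩, rfl, le_antisymm ?_ (hφ (Fin.le_def.2 h))⟩
      exact (hq _).1 le_rfl

/-- The monoid of the elements of `H` which are nonnegative on given rays. -/
def nonnegOn (I : Finset (Fin (n + 1) × Fin k)) : AddSubmonoid (H n k) where
  carrier := {m | ∀ q ∈ I, 0 ≤ ray q m}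
  zero_mem' := by simp
  add_mem' ha hb q hq := by
    rw [map_add]
    exact add_nonneg (ha q hq) (hb q hq)

theorem nonnegOn_anti {I J : Finset (Fin (n + 1) × Fin k)} (h : I ⊆ J) :
    nonnegOn J ≤ nonnegOn I := fun _ hm q hq => hm q (h hq)

theorem x_mem_nonnegOn (I : Finset (Fin (n + 1) × Fin k)) (i) : x i ∈ nonnegOn I := by
  intro q _
  rw [ray_x]
  split_ifs <;> simp

theorem v_mem_nonnegOn (I : Finset (Fin (n + 1) × Fin k)) (j) : v j ∈ nonnegOn I := by
  intro q _
  rw [ray_v]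
  split_ifs <;> simp

theorem dualVec_mem_nonnegOn {φ : Fin n → Fin k} {I : Finset (Fin (n + 1) × Fin k)}
    (hI : I ⊆ path φ) (p) : dualVec φ p ∈ nonnegOn I := by
  intro q hq
  rw [ray_dualVec (hI hq)]
  split_ifs <;> simp

theorem nonnegOn_path_le_iff {φ : Fin n → Fin k} (hφ : Antitone φ) {Q : AddSubmonoid (H n k)} :
    nonnegOn (path φ) ≤ Q ↔ ∀ q ∈ path φ, dualVec φ q ∈ Q := by
  refine ⟨fun h q _ => h (dualVec_mem_nonnegOn subset_rfl q), fun h m hm => ?_⟩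
  rw [eq_sum_dualVec hφ m]
  refine Q.sum_mem fun q hq => ?_
  obtain ⟨N, hN⟩ := Int.eq_ofNat_of_zero_le (hm q hq)
  rw [hN, natCast_zsmul]
  exact Q.nsmul_mem (h q hq) N

theorem c_mem_nonnegOn_path {φ : Fin n → Fin k} (p : Fin n) {j : ℕ} (hj : j ≤ (φ p).val) :
    c (p.val + 1) j ∈ nonnegOn (path φ) := by
  intro q hq
  have := mem_path.1 hq p
  simp only [Fin.le_def] at this
  rw [c_eq, map_sub, ray_partialX, ray_partialV]
  split_ifs <;> omega

theorem neg_c_mem_nonnegOn_path {φ : Fin n → Fin k} (p : Fin n) {j : ℕ} (hj : (φ p).val < j) :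
    -c (p.val + 1) j ∈ nonnegOn (path φ) := by
  intro q hq
  have := mem_path.1 hq p
  simp only [Fin.le_def] at this
  rw [c_eq, neg_sub, map_sub, ray_partialX, ray_partialV]
  split_ifs <;> omega

/-- This generating set is redundant compared with S_φ, but it is free of conditions on neighbouring
values of φ. That makes it convenient when φ is to be constructed from Q. -/
theorem nonnegOn_path_le_iff_c {φ : Fin n → Fin k} (hφ : Antitone φ) {Q : AddSubmonoid (H n k)} :
    nonnegOn (path φ) ≤ Q ↔ (∀ i, x i ∈ Q) ∧ (∀ j, v j ∈ Q) ∧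
      ∀ p : Fin n, c (p.val + 1) (φ p).val ∈ Q ∧ -c (p.val + 1) ((φ p).val + 1) ∈ Q := by
  refine ⟨fun h => ⟨fun i => h (x_mem_nonnegOn _ i), fun j => h (v_mem_nonnegOn _ j), fun p =>
    ⟨h (c_mem_nonnegOn_path p le_rfl), h (neg_c_mem_nonnegOn_path p (Nat.lt_succ_self _))⟩⟩, ?_⟩
  rintro ⟨hx, hv, hc⟩
  rw [nonnegOn_path_le_iff hφ]
  intro q hq
  rcases dualVec_mem_S hφ hq with ((⟨j, -, h⟩ | ⟨-, p, -, -, h⟩) | ⟨p, -, h⟩) | ⟨p, -, h⟩ <;> rw [h]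
  exacts [hv j, hx _, (hc p).2, (hc p).1]

/-- S_φ contains the dual basis and is itself contained in the monoid spanned by it, so both
generate the same monoid. -/
theorem S_subset_iff {φ : Fin n → Fin k} (hφ : Antitone φ) {Q : AddSubmonoid (H n k)} :
    S φ ⊆ Q ↔ nonnegOn (path φ) ≤ Q := by
  refine ⟨fun h => (nonnegOn_path_le_iff hφ).2 fun q hq => h (dualVec_mem_S hφ hq), fun h s hs => ?_⟩
  obtain ⟨hx, hv, hc⟩ := (nonnegOn_path_le_iff_c hφ).1 h
  rcases hs with ((⟨j, -, rfl⟩ | ⟨-, p, -, -, rfl⟩) | ⟨p, -, rfl⟩) | ⟨p, -, rfl⟩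
  exacts [hv j, hx _, (hc p).2, (hc p).1]

/-- The elements of `H` on which a linear form is nonnegative. -/
def nonnegSubmonoid (f : H n k →+ ℝ) : AddSubmonoid (H n k) :=
  (AddSubmonoid.nonneg ℝ).comap f

theorem mem_nonnegSubmonoid {f : H n k →+ ℝ} {m : H n k} : m ∈ nonnegSubmonoid f ↔ 0 ≤ f m :=
  Iff.rfl

theorem mem_cone_iff_le {φ : Fin n → Fin k} (hφ : Antitone φ) {f : H n k →+ ℝ} :
    f ∈ cone φ ↔ nonnegOn (path φ) ≤ nonnegSubmonoid f :=
  S_subset_iff hφ (Q := nonnegSubmonoid f)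

theorem mem_cone_iff {φ : Fin n → Fin k} (hφ : Antitone φ) {f : H n k →+ ℝ} :
    f ∈ cone φ ↔ ∀ q ∈ path φ, 0 ≤ f (dualVec φ q) := by
  rw [mem_cone_iff_le hφ, nonnegOn_path_le_iff hφ]
  rfl

/-- The cone generated by given rays. -/
def rayCone (I : Finset (Fin (n + 1) × Fin k)) : PointedCone ℝ (H n k →+ ℝ) :=
  PointedCone.hull ℝ ((fun q => latticePoint (ray q)) '' (I : Set (Fin (n + 1) × Fin k)))

theorem latticePoint_apply {M : Type} [AddCommGroup M] (g : M →+ ℤ) (m : M) :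
    latticePoint g m = (g m : ℝ) := rfl

theorem ray_mem_rayCone {I : Finset (Fin (n + 1) × Fin k)} {q : Fin (n + 1) × Fin k} (hq : q ∈ I) :
    latticePoint (ray q) ∈ rayCone I :=
  Submodule.subset_span ⟨q, hq, rfl⟩

theorem sum_ray_mem_rayCone {I : Finset (Fin (n + 1) × Fin k)} {l : Fin (n + 1) × Fin k → ℝ}
    (hl : ∀ q ∈ I, 0 ≤ l q) : ∑ q ∈ I, l q • latticePoint (ray q) ∈ rayCone I :=
  (rayCone I).sum_mem fun q hq => PointedCone.smul_mem _ (hl q hq) (ray_mem_rayCone hq)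

theorem nonneg_of_mem_rayCone {I : Finset (Fin (n + 1) × Fin k)} {f : H n k →+ ℝ}
    (hf : f ∈ rayCone I) {m : H n k} (hm : m ∈ nonnegOn I) : 0 ≤ f m := by
  induction hf using Submodule.span_induction with
  | mem f h =>
    obtain ⟨q, hq, rfl⟩ := h
    exact Int.cast_nonneg (hm q hq)
  | zero => simp
  | add f g _ _ hf hg => exact add_nonneg hf hg
  | smul r f _ hf => exact mul_nonneg r.2 hf

theorem hom_eq_sum {φ : Fin n → Fin k} (hφ : Antitone φ) (f : H n k →+ ℝ) :
    f = ∑ q ∈ path φ, f (dualVec φ q) • latticePoint (ray q) := by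
  refine AddMonoidHom.ext fun m => ?_
  rw [map_eq_sum hφ f m]
  simp [AddMonoidHom.finsetSum_apply, latticePoint_apply, mul_comm]

/-- In the basis of the path, the cone on a subset I is a coordinate orthant, and the values on
`dualVec φ` are the coordinates. All statements about faces and intersections are read off from this
description. -/
theorem mem_rayCone_iff {φ : Fin n → Fin k} (hφ : Antitone φ) {I : Finset (Fin (n + 1) × Fin k)}
    (hI : I ⊆ path φ) {f : H n k →+ ℝ} :
    f ∈ rayCone I ↔ (∀ q, 0 ≤ f (dualVec φ q)) ∧ ∀ q, q ∉ I → f (dualVec φ q) = 0 := by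
  constructor
  · intro hf
    refine ⟨fun q => nonneg_of_mem_rayCone hf (dualVec_mem_nonnegOn hI q), fun q hq => ?_⟩
    refine le_antisymm ?_ (nonneg_of_mem_rayCone hf (dualVec_mem_nonnegOn hI q))
    rw [← neg_nonneg, ← map_neg]
    refine nonneg_of_mem_rayCone hf fun p hp => ?_
    rw [map_neg, ray_dualVec (hI hp), if_neg (fun h : q = p => hq (h ▸ hp)), neg_zero]
  · rintro ⟨h0, h1⟩
    rw [hom_eq_sum hφ f, ← Finset.sum_subset hI fun q _ hq => by rw [h1 q hq, zero_smul]]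
    exact sum_ray_mem_rayCone fun q _ => h0 q

theorem cone_eq_rayCone {φ : Fin n → Fin k} (hφ : Antitone φ) : cone φ = rayCone (path φ) := by
  ext f
  rw [mem_cone_iff hφ, mem_rayCone_iff hφ subset_rfl]
  refine ⟨fun h => ?_, fun h q _ => h.1 q⟩
  have h0 : ∀ q, q ∉ path φ → f (dualVec φ q) = 0 := fun q hq => by
    rw [dualVec_eq_zero hφ hq, map_zero]
  refine ⟨fun q => ?_, h0⟩
  by_cases hq : q ∈ path φ
  exacts [h q hq, (h0 q hq).ge]

theorem rayCone_mono {I J : Finset (Fin (n + 1) × Fin k)} (h : I ⊆ J) : rayCone I ≤ rayCone J :=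
  Submodule.span_mono (Set.image_mono h)

/-- On the cone of φ the comparisons prescribed by φ really hold, so the formal clipping becomes a
numerical clamp. The right-hand side no longer mentions φ, which is why different cones fit
together. -/
theorem map_clip {φ : Fin n → Fin k} (hφ : Antitone φ) {f : H n k →+ ℝ} (hf : f ∈ cone φ)
    (i : Fin (n + 1)) (j : ℕ) : f (clip φ i j) =
      max (f (partialX i.val)) (min (f (partialX (i.val + 1))) (f (partialV j))) := by
  have hc := (mem_cone_iff_le hφ).1 hf
  have hx : f (partialX i.val) ≤ f (partialX (i.val + 1)) := by
    have := (mem_nonnegSubmonoid).1 (hc (x_mem_nonnegOn _ i))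
    rw [partialX_succ, map_add]
    linarith
  have hle : ∀ (p : Fin n) (j : ℕ), j ≤ (φ p).val → f (partialX (p.val + 1)) ≤ f (partialV j) := by
    intro p j h
    have := (mem_nonnegSubmonoid).1 (hc (c_mem_nonnegOn_path p h))
    rw [c_eq, map_sub] at this
    linarith
  have hge : ∀ (p : Fin n) (j : ℕ), (φ p).val < j → f (partialV j) ≤ f (partialX (p.val + 1)) := by
    intro p j h
    have := (mem_nonnegSubmonoid).1 (hc (neg_c_mem_nonnegOn_path p h))
    rw [c_eq, neg_sub, map_sub] at this
    linarith
  have hVmono : ∀ j j', j ≤ j' → f (partialV j' : H n k) ≤ f (partialV j) := by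
    intro j j' h
    simp only [partialV, map_sum]
    refine Finset.sum_le_sum_of_subset_of_nonneg ?_
      (fun b _ _ => hc (v_mem_nonnegOn _ b))
    intro b hb
    simp only [Finset.mem_filter, Finset.mem_univ, true_and] at hb ⊢
    omega
  rw [clip]
  split_ifs with h1 h2
  · obtain ⟨p, hp, hj⟩ := h1
    have := hle p j hj
    rw [hp] at this
    rw [min_eq_left this, max_eq_right hx]
  · obtain ⟨p, hp, hj⟩ := h2
    have := hge p j hj
    rw [hp] at this
    rw [min_eq_right (this.trans hx), max_eq_left this]
  · have h3 : f (partialV j) ≤ f (partialX (i.val + 1)) := by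
      by_cases hn : i.val < n
      · refine hge ⟨i.val, hn⟩ j (not_le.1 fun h => h1 ⟨_, rfl, h⟩)
      · have : i.val = n := by omega
        rw [this, partialX_last]
        exact hVmono _ _ (Nat.zero_le _)
    have h4 : f (partialX i.val) ≤ f (partialV j) := by
      by_cases h0 : i.val = 0
      · rw [h0, partialX_zero, map_zero, partialV, map_sum]
        exact Finset.sum_nonneg fun b _ => hc (v_mem_nonnegOn _ b)
      · have hlt : i.val - 1 < n := by omega
        have := hle ⟨i.val - 1, hlt⟩ j (not_lt.1 fun h => h2 ⟨_, by simp only; omega, h⟩)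
        rwa [show i.val - 1 + 1 = i.val by omega] at this
    rw [min_eq_right h3, max_eq_right h4]

theorem map_dualVec_eq {φ ψ : Fin n → Fin k} (hφ : Antitone φ) (hψ : Antitone ψ)
    {f : H n k →+ ℝ} (hf : f ∈ cone φ) (hf' : f ∈ cone ψ) (q : Fin (n + 1) × Fin k) :
    f (dualVec φ q) = f (dualVec ψ q) := by
  simp only [dualVec, map_sub, map_clip hφ hf, map_clip hψ hf']

/-- A point of both cones has the same coordinates with respect to both paths, by `map_dualVec_eq`.
These coordinates vanish off I and off J. -/
theorem rayCone_inf {φ ψ : Fin n → Fin k} (hφ : Antitone φ) (hψ : Antitone ψ)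
    {I J : Finset (Fin (n + 1) × Fin k)} (hI : I ⊆ path φ) (hJ : J ⊆ path ψ) :
    rayCone I ⊓ rayCone J = rayCone (I ∩ J) := by
  refine le_antisymm ?_ (le_inf (rayCone_mono Finset.inter_subset_left)
    (rayCone_mono Finset.inter_subset_right))
  rintro f ⟨hfI, hfJ⟩
  have heq := map_dualVec_eq hφ hψ (cone_eq_rayCone hφ ▸ rayCone_mono hI hfI)
    (cone_eq_rayCone hψ ▸ rayCone_mono hJ hfJ)
  obtain ⟨h1, h2⟩ := (mem_rayCone_iff hφ hI).1 hfI
  obtain ⟨-, h4⟩ := (mem_rayCone_iff hψ hJ).1 hfJ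
  refine (mem_rayCone_iff hφ (Finset.inter_subset_left.trans hI)).2 ⟨h1, fun q hq => ?_⟩
  by_cases hqI : q ∈ I
  · rw [heq]
    exact h4 q fun hqJ => hq (Finset.mem_inter.2 ⟨hqI, hqJ⟩)
  · exact h2 q hqI

theorem rayCone_isFaceOf {φ : Fin n → Fin k} (hφ : Antitone φ)
    {I J : Finset (Fin (n + 1) × Fin k)} (hIJ : I ⊆ J) (hJ : J ⊆ path φ) :
    (rayCone I).IsFaceOf (rayCone J) where
  le := rayCone_mono hIJ
  mem_of_smul_add_mem := by
    intro f g a hf hg ha hfg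
    obtain ⟨h1, h2⟩ := (mem_rayCone_iff hφ (hIJ.trans hJ)).1 hfg
    obtain ⟨hf1, hf2⟩ := (mem_rayCone_iff hφ hJ).1 hf
    obtain ⟨hg1, hg2⟩ := (mem_rayCone_iff hφ hJ).1 hg
    refine (mem_rayCone_iff hφ (hIJ.trans hJ)).2 ⟨hf1, fun q hq => ?_⟩
    have h3 : a * f (dualVec φ q) + g (dualVec φ q) = 0 := h2 q hq
    have h4 := hg1 q
    have h5 := hf1 q
    have h6 := mul_nonneg ha.le h5
    have h7 : a * f (dualVec φ q) = 0 := by linarith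
    exact (mul_eq_zero.1 h7).resolve_left ha.ne'

/-- A face is spanned by the rays that it contains: if a point of τ has a positive coordinate at q,
splitting off this multiple of the ray leaves a remainder in the cone, and the face property puts
the ray in τ. -/
theorem exists_eq_rayCone_of_isFaceOf {φ : Fin n → Fin k} (hφ : Antitone φ)
    {J : Finset (Fin (n + 1) × Fin k)} (hJ : J ⊆ path φ) {τ : PointedCone ℝ (H n k →+ ℝ)}
    (hτ : τ.IsFaceOf (rayCone J)) : ∃ I ⊆ J, τ = rayCone I := by
  classical
  refine ⟨J.filter fun q => latticePoint (ray q) ∈ τ, Finset.filter_subset _ _,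
    le_antisymm (fun f hf => ?_) (Submodule.span_le.2 ?_)⟩
  · obtain ⟨h1, h2⟩ := (mem_rayCone_iff hφ hJ).1 (hτ.le hf)
    refine (mem_rayCone_iff hφ ((Finset.filter_subset _ _).trans hJ)).2 ⟨h1, fun q hq => ?_⟩
    by_cases hqJ : q ∈ J
    · by_contra hne
      refine hq (Finset.mem_filter.2 ⟨hqJ, ?_⟩)
      refine hτ.mem_of_smul_add_mem (ray_mem_rayCone hqJ) ?_ (lt_of_le_of_ne (h1 q) (Ne.symm hne))
        (y := ∑ p ∈ J.erase q, f (dualVec φ p) • latticePoint (ray p)) ?_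
      · exact rayCone_mono (Finset.erase_subset _ _) (sum_ray_mem_rayCone fun p _ => h1 p)
      · rw [Finset.add_sum_erase J (fun p => f (dualVec φ p) • latticePoint (ray p)) hqJ,
          Finset.sum_subset hJ fun p _ hp => by rw [h2 p hp, zero_smul], ← hom_eq_sum hφ f]
        exact hf
    · exact h2 q hqJ
  · rintro _ ⟨q, hq, rfl⟩
    exact (Finset.mem_filter.1 hq).2

theorem mem_fan_iff {τ : PointedCone ℝ (H n k →+ ℝ)} :
    τ ∈ fan n k ↔ ∃ φ : Fin n → Fin k, Antitone φ ∧ ∃ I ⊆ path φ, τ = rayCone I := by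
  refine exists_congr fun φ => and_congr_right fun hφ => ?_
  rw [cone_eq_rayCone hφ]
  refine ⟨exists_eq_rayCone_of_isFaceOf hφ subset_rfl, ?_⟩
  rintro ⟨I, hI, rfl⟩
  exact rayCone_isFaceOf hφ hI subset_rfl

/-- The basis of `Hom(H, ℤ)` which consists of the vertices of a lattice path. -/
def rayBasis {φ : Fin n → Fin k} (hφ : Antitone φ) : Module.Basis (path φ) ℤ (H n k →+ ℤ) :=
  Module.Basis.ofEquivFun
    { toFun := fun f q => f (dualVec φ q)
      map_add' := fun _ _ => rfl
      map_smul' := fun _ _ => rfl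
      invFun := fun l => ∑ q : path φ, l q • ray q.1
      left_inv := fun f => by
        refine AddMonoidHom.ext fun m => ?_
        rw [map_eq_sum hφ f m, ← Finset.sum_coe_sort]
        simp [AddMonoidHom.finsetSum_apply, mul_comm]
      right_inv := fun l => by
        funext p
        simp only [AddMonoidHom.finsetSum_apply, AddMonoidHom.smul_apply]
        rw [Finset.sum_eq_single p]
        · rw [ray_dualVec p.2, if_pos rfl, smul_eq_mul, mul_one]
        · intro q _ hq
          rw [ray_dualVec q.2, if_neg (fun h => hq (Subtype.ext h.symm)), smul_zero]
        · simp }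

theorem rayBasis_apply {φ : Fin n → Fin k} (hφ : Antitone φ) (q : path φ) :
    rayBasis hφ q = ray q.1 := by
  simp only [rayBasis, Module.Basis.coe_ofEquivFun]
  change ∑ p : path φ, (Pi.single q 1 : path φ → ℤ) p • ray p.1 = _
  rw [Finset.sum_eq_single q] <;> simp +contextual

theorem isSmoothFan_fan : IsSmoothFan (fan n k) where
  finite := by
    refine (Set.finite_range (rayCone (n := n) (k := k))).subset ?_
    intro τ hτ
    obtain ⟨φ, -, I, -, rfl⟩ := mem_fan_iff.1 hτ
    exact ⟨I, rfl⟩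
  rational_polyhedral := by
    intro τ hτ
    classical
    obtain ⟨φ, -, I, -, rfl⟩ := mem_fan_iff.1 hτ
    exact ⟨I.image ray, by rw [rayCone, Finset.coe_image, Set.image_image]⟩
  strongly_convex := by
    intro τ hτ f hf hf'
    obtain ⟨φ, hφ, I, hI, rfl⟩ := mem_fan_iff.1 hτ
    rw [hom_eq_sum hφ f]
    refine Finset.sum_eq_zero fun q _ => ?_
    have h1 := ((mem_rayCone_iff hφ hI).1 hf).1 q
    have h2 : 0 ≤ -f (dualVec φ q) := ((mem_rayCone_iff hφ hI).1 hf').1 q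
    rw [le_antisymm (neg_nonneg.1 h2) h1, zero_smul]
  face_mem := by
    rintro σ ⟨φ, hφ, hσ⟩ τ hτ
    exact ⟨φ, hφ, hτ.trans hσ⟩
  inter_isFaceOf := by
    intro σ hσ τ hτ
    obtain ⟨φ, hφ, I, hI, rfl⟩ := mem_fan_iff.1 hσ
    obtain ⟨ψ, hψ, J, hJ, rfl⟩ := mem_fan_iff.1 hτ
    rw [rayCone_inf hφ hψ hI hJ]
    exact rayCone_isFaceOf hφ Finset.inter_subset_left hI
  smooth := by
    intro τ hτ
    obtain ⟨φ, hφ, I, hI, rfl⟩ := mem_fan_iff.1 hτ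
    let e := Fintype.equivFin (path φ)
    refine ⟨_, (rayBasis hφ).reindex e, {r | (e.symm r).1 ∈ I}, ?_⟩
    rw [rayCone, Set.image_image]
    congr 1
    ext f
    constructor
    · rintro ⟨q, hq, rfl⟩
      refine ⟨e ⟨q, hI hq⟩, ?_, ?_⟩
      · simpa using hq
      · simp [rayBasis_apply]
    · rintro ⟨r, hr, rfl⟩
      exact ⟨(e.symm r).1, hr, by simp [rayBasis_apply]⟩

end Cones

/-! ### Every interleaving of cut points is given by some φ -/

section Cover

variable {n k : ℕ}

theorem partialX_sub_mem {Q : AddSubmonoid (H n k)} (hx : ∀ i, x i ∈ Q) {i i' : ℕ} (h : i ≤ i') :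
    partialX i' - partialX i ∈ Q := by
  classical
  have hsub : Finset.univ.filter (fun a : Fin (n + 1) => a.val < i) ⊆
      Finset.univ.filter (fun a : Fin (n + 1) => a.val < i') := by
    intro a
    simp only [Finset.mem_filter, Finset.mem_univ, true_and]
    omega
  rw [partialX, partialX, ← Finset.sum_sdiff hsub, add_sub_cancel_right]
  exact Q.sum_mem fun a _ => hx a

/-- A total submonoid of `H` which contains the `x_i` and the `v_j` contains the dual monoid of one
of the maximal cones. -/
theorem exists_nonnegOn_path_le (hk : 1 ≤ k) {Q : AddSubmonoid (H n k)} (hx : ∀ i, x i ∈ Q)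
    (hv : ∀ j, v j ∈ Q) (htot : ∀ m, m ∈ Q ∨ -m ∈ Q) :
    ∃ φ : Fin n → Fin k, Antitone φ ∧ nonnegOn (path φ) ≤ Q := by
  classical
  have h0 : ∀ p : Fin n, (c (p.val + 1) 0 : H n k) ∈ Q := fun p => by
    rw [c_eq, ← partialX_last]
    exact partialX_sub_mem hx (by omega)
  -- The value of φ is the last v-cut point that is still at least the x-cut point p + 1, where
  -- comparison means membership of c in Q. The bound k - 1 keeps the value a valid index, and `h0`
  -- guarantees that 0 qualifies.
  let N : Fin n → ℕ := fun p => Nat.findGreatest (fun j => (c (p.val + 1) j : H n k) ∈ Q) (k - 1)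
  have hN : ∀ p, N p < k := fun p =>
    lt_of_le_of_lt (Nat.findGreatest_le (k - 1)) (by omega)
  have hφ : Antitone (fun p => (⟨N p, hN p⟩ : Fin k)) := by
    intro p p' hp
    refine Fin.le_def.2 (Nat.findGreatest_mono_left (fun j hj => ?_) _)
    -- Lowering the x-index adds a sum of x's to c, so a cut point that qualifies for p' also
    -- qualifies for the smaller p.
    have := Q.add_mem hj (partialX_sub_mem hx (Nat.succ_le_succ (Fin.le_def.1 hp)))
    rwa [c_eq, sub_add_sub_cancel, ← c_eq] at this
  refine ⟨_, hφ, (nonnegOn_path_le_iff_c hφ).2 ⟨hx, hv, fun p => ⟨?_, ?_⟩⟩⟩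
  · exact Nat.findGreatest_spec (P := fun j => (c (p.val + 1) j : H n k) ∈ Q) (Nat.zero_le _) (h0 p)
  · simp only
    -- Below k, maximality excludes the next c from Q and totality gives its negative. At k the sum
    -- of v's is empty, and the negative of c is a sum of x's.
    rcases (Nat.succ_le_of_lt (hN p)).lt_or_eq with h | h
    · refine (htot _).resolve_left ?_
      exact Nat.findGreatest_is_greatest (P := fun j => (c (p.val + 1) j : H n k) ∈ Q)
        (Nat.lt_succ_self _) (by omega)
    · have h1 : (c (p.val + 1) (N p + 1) : H n k) = -(partialX (p.val + 1) - partialX 0) := by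
        rw [c_eq, show N p + 1 = k from h, partialV_last, partialX_zero, zero_sub, sub_zero]
      rw [h1, neg_neg]
      exact partialX_sub_mem hx (Nat.zero_le _)

theorem exists_mem_cone (hk : 1 ≤ k) {f : H n k →+ ℝ} (hx : ∀ i, 0 ≤ f (x i))
    (hv : ∀ j, 0 ≤ f (v j)) : ∃ φ : Fin n → Fin k, Antitone φ ∧ f ∈ cone φ := by
  obtain ⟨φ, hφ, h⟩ := exists_nonnegOn_path_le hk (Q := nonnegSubmonoid f) hx hv fun m => by
    rw [mem_nonnegSubmonoid, mem_nonnegSubmonoid, map_neg, neg_nonneg]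
    exact le_total _ _
  exact ⟨φ, hφ, (mem_cone_iff_le hφ).2 h⟩

end Cover

/-! ### Nonincreasing maps and maximal chains -/

section Paths

variable {n k : ℕ}

theorem path_isChain (φ : Fin n → Fin k) :
    IsChain (prodRel (· ≤ ·) (· ≥ ·)) (path φ : Set (Fin (n + 1) × Fin k)) := by
  have key : ∀ q ∈ path φ, ∀ q' ∈ path φ, q.1 < q'.1 → prodRel (· ≤ ·) (· ≥ ·) q q' := by
    intro q hq q' hq' h
    rw [mem_path] at hq hq'
    rw [Fin.lt_def] at h
    have hlt : q.1.val < n := by omega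
    exact ⟨h.le, ((hq' ⟨q.1.val, hlt⟩).2 h).trans ((hq ⟨q.1.val, hlt⟩).1 le_rfl)⟩
  intro q hq q' hq' _
  rcases lt_trichotomy q.1 q'.1 with h | h | h
  · exact Or.inl (key q hq q' hq' h)
  · rcases le_total q.2 q'.2 with h' | h'
    · exact Or.inr ⟨h.ge, h'⟩
    · exact Or.inl ⟨h.le, h'⟩
  · exact Or.inr (key q' hq' q hq h)

theorem exists_subset_path (hk : 1 ≤ k) {L : Finset (Fin (n + 1) × Fin k)}
    (hL : IsChain (prodRel (· ≤ ·) (· ≥ ·)) (L : Set (Fin (n + 1) × Fin k))) :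
    ∃ φ : Fin n → Fin k, Antitone φ ∧ L ⊆ path φ := by
  -- Writing k as a successor gives `Fin k` a top element, so that the infimum over an empty set, to
  -- the left of the chain, is the largest index.
  obtain ⟨k, rfl⟩ : ∃ l, k = l + 1 := ⟨k - 1, by omega⟩
  refine ⟨fun p => (L.filter fun q => q.1.val ≤ p.val).inf Prod.snd, fun p p' hp => ?_,
    fun q hq => mem_path.2 fun p => ⟨fun h => ?_, fun h => ?_⟩⟩
  · refine Finset.inf_mono fun q hq => ?_
    rw [Finset.mem_filter] at hq ⊢
    exact ⟨hq.1, hq.2.trans (Fin.le_def.1 hp)⟩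
  · exact Finset.inf_le (f := Prod.snd) (Finset.mem_filter.2 ⟨hq, h⟩)
  · refine Finset.le_inf fun q' hq' => ?_
    obtain ⟨hq', hp⟩ := Finset.mem_filter.1 hq'
    have hne : q' ≠ q := by
      rintro rfl
      omega
    rcases hL hq' hq hne with h' | h'
    · exact h'.2
    · have := Fin.le_def.1 h'.1
      omega

theorem castSucc_mem_path {φ : Fin n → Fin k} (hφ : Antitone φ) (p : Fin n) :
    (p.castSucc, φ p) ∈ path φ :=
  mem_path.2 fun _ => ⟨fun h => hφ (Fin.le_def.2 h), fun h => hφ (Fin.le_def.2 (le_of_lt h))⟩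

theorem succ_mem_path {φ : Fin n → Fin k} (hφ : Antitone φ) (p : Fin n) :
    (p.succ, φ p) ∈ path φ := by
  refine mem_path.2 fun r => ⟨fun h => hφ (Fin.le_def.2 ?_), fun h => hφ (Fin.le_def.2 ?_)⟩ <;>
    simp only [Fin.val_succ] at h <;> omega

/-- The two ends of the p-th horizontal step of φ, viewed on the path of ψ, bound ψ p from below and
from above by φ p. -/
theorem eq_of_path_subset {φ ψ : Fin n → Fin k} (hφ : Antitone φ) (h : path φ ⊆ path ψ) :
    φ = ψ := by
  funext p
  refine le_antisymm ?_ ?_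
  · exact (mem_path.1 (h (succ_mem_path hφ p)) p).2 (by simp)
  · exact (mem_path.1 (h (castSucc_mem_path hφ p)) p).1 (by simp)

theorem path_isMaxChain (hk : 1 ≤ k) {φ : Fin n → Fin k} (hφ : Antitone φ) :
    IsMaxChain (prodRel (· ≤ ·) (· ≥ ·)) (path φ : Set (Fin (n + 1) × Fin k)) := by
  refine ⟨path_isChain φ, fun t ht hsub => ?_⟩
  classical
  have ht' : ((Set.toFinite t).toFinset : Set (Fin (n + 1) × Fin k)) = t :=
    (Set.toFinite t).coe_toFinset
  obtain ⟨ψ, -, h⟩ := exists_subset_path hk (L := (Set.toFinite t).toFinset) (by rwa [ht'])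
  have h' : t ⊆ path ψ := by
    rw [← ht']
    exact h
  have := eq_of_path_subset hφ (Finset.coe_subset.1 (hsub.trans h'))
  subst this
  exact hsub.antisymm h'

/-- Nonincreasing maps correspond to lattice paths. -/
def pathEquiv (hk : 1 ≤ k) : {φ : Fin n → Fin k // Antitone φ} ≃
    {L : Finset (Fin (n + 1) × Fin k) //
      IsMaxChain (prodRel (· ≤ ·) (· ≥ ·)) (L : Set (Fin (n + 1) × Fin k))} :=
  Equiv.ofBijective (fun φ => ⟨path φ.1, path_isMaxChain hk φ.2⟩) (by
    constructor
    · intro φ ψ h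
      exact Subtype.ext (eq_of_path_subset φ.2 (Subtype.ext_iff.1 h).le)
    · intro L
      obtain ⟨φ, hφ, h⟩ := exists_subset_path hk L.2.1
      exact ⟨⟨φ, hφ⟩, Subtype.ext (Finset.coe_injective
        (L.2.2 (path_isChain φ) (Finset.coe_subset.2 h)).symm)⟩)

end Paths

/-! ### The staircase triangulation as a slice of the fan -/

section Polytope

variable {n k : ℕ}

theorem coords_injective : Function.Injective (coords : (H n k →+ ℝ) → _) := by
  intro f g h
  rw [Prod.ext_iff] at h
  exact hom_ext_H (fun i => congrFun h.1 i) (fun j => congrFun h.2 j)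

theorem coords_ray (q : Fin (n + 1) × Fin k) : coords (latticePoint (ray q)) = vertex q := by
  refine Prod.ext (funext fun a => ?_) (funext fun b => ?_)
  · change ((ray q (x a) : ℤ) : ℝ) = (Pi.single q.1 1 : Fin (n + 1) → ℝ) a
    rw [ray_x, Pi.single_apply]
    split_ifs <;> simp
  · change ((ray q (v b) : ℤ) : ℝ) = (Pi.single q.2 1 : Fin k → ℝ) b
    rw [ray_v, Pi.single_apply]
    split_ifs <;> simp

theorem hull_convexHull {E : Type*} [AddCommGroup E] [Module ℝ E] (A : Set E) :
    PointedCone.hull ℝ (convexHull ℝ A) = PointedCone.hull ℝ A :=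
  le_antisymm
    (Submodule.span_le.2 (convexHull_min Submodule.subset_span (PointedCone.convex _)))
    (Submodule.span_mono (subset_convexHull ℝ A))

/-- The embedding `coords` is injective and takes rays to vertices, so pulling back the hull of the
vertices recovers the hull of the rays. -/
theorem coneOver_vertex (L : Finset (Fin (n + 1) × Fin k)) :
    coneOver (vertex '' (L : Set (Fin (n + 1) × Fin k))) = rayCone L := by
  have h : vertex '' (L : Set (Fin (n + 1) × Fin k)) =
      coords '' ((fun q => latticePoint (ray q)) '' (L : Set (Fin (n + 1) × Fin k))) := by
    rw [Set.image_image]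
    exact Set.image_congr fun q _ => (coords_ray q).symm
  rw [coneOver, hull_convexHull, h]
  ext f
  constructor
  · intro hf
    have hf' : coords f ∈ Submodule.span _ (coords '' _) := hf
    have hmap := Submodule.map_span (coords.restrictScalars {r : ℝ // 0 ≤ r} :
      (H n k →+ ℝ) →ₗ[{r : ℝ // 0 ≤ r}] _)
      ((fun q => latticePoint (ray q)) '' (L : Set (Fin (n + 1) × Fin k)))
    have hf'' : coords f ∈ Submodule.map _ _ := hmap.symm ▸ hf'
    obtain ⟨g, hg, hgf⟩ := hf''
    rw [← coords_injective hgf]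
    exact hg
  · intro hf
    change coords f ∈ PointedCone.hull ℝ (coords '' _)
    induction hf using Submodule.span_induction with
    | mem f h => exact Submodule.subset_span ⟨f, h, rfl⟩
    | zero => exact Submodule.zero_mem _
    | add f g _ _ hf hg =>
      rw [map_add]
      exact Submodule.add_mem _ hf hg
    | smul r f _ hf => exact PointedCone.smul_mem _ r.2 hf

theorem fan_eq_triangulationFan (hk : 1 ≤ k) : fan n k = triangulationFan n k := by
  classical
  ext τ
  rw [mem_fan_iff]
  constructor
  · rintro ⟨φ, -, I, hI, rfl⟩
    rcases I.eq_empty_or_nonempty with rfl | hne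
    · exact Or.inl (by rw [← coneOver_vertex]; simp)
    · exact Or.inr ⟨I.image vertex, ⟨I, hne, (path_isChain φ).mono (Finset.coe_subset.2 hI),
        Finset.coe_image⟩, by rw [Finset.coe_image, coneOver_vertex]⟩
  · rintro (rfl | ⟨t, ⟨L, -, hL, ht⟩, rfl⟩)
    · obtain ⟨φ, hφ, -⟩ := exists_subset_path (n := n) hk (L := ∅) (by simp)
      exact ⟨φ, hφ, ∅, Finset.empty_subset _, by rw [← coneOver_vertex]; simp⟩
    · obtain ⟨φ, hφ, h⟩ := exists_subset_path hk hL
      exact ⟨φ, hφ, L, h, by rw [ht, coneOver_vertex]⟩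

theorem sum_dualVec (φ : Fin n → Fin k) (f : H n k →+ ℝ) :
    ∑ q, f (dualVec φ q) = ∑ i, f (x i) := by
  rw [Fintype.sum_prod_type]
  simp only [← map_sum, sum_dualVec_row]

/-- The overlaps add up to ∑ f(x_i), so normalizing this sum to 1 makes the conical coordinates
barycentric. Covering and intersection of simplices thereby reduce to the same properties of cones.
-/
theorem mem_convexHull_vertex_iff {φ : Fin n → Fin k} (hφ : Antitone φ)
    {L : Finset (Fin (n + 1) × Fin k)} (hL : L ⊆ path φ) {y : (Fin (n + 1) → ℝ) × (Fin k → ℝ)} :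
    y ∈ convexHull ℝ (vertex '' (L : Set (Fin (n + 1) × Fin k))) ↔
      ∃ f ∈ rayCone L, ∑ i, f (x i) = 1 ∧ coords f = y := by
  constructor
  · intro hy
    have hconv : Convex ℝ (coords '' {f : H n k →+ ℝ | f ∈ rayCone L ∧ ∑ i, f (x i) = 1}) := by
      refine Convex.linear_image ?_ coords
      intro f hf g hg a b ha hb hab
      refine ⟨(rayCone L).convex hf.1 hg.1 ha hb hab, ?_⟩
      change ∑ i, (a * f (x i) + b * g (x i)) = 1
      rw [Finset.sum_add_distrib, ← Finset.mul_sum, ← Finset.mul_sum, hf.2, hg.2, mul_one, mul_one,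
        hab]
    obtain ⟨f, hf, rfl⟩ := convexHull_min (by
      rintro _ ⟨q, hq, rfl⟩
      refine ⟨latticePoint (ray q), ⟨ray_mem_rayCone hq, ?_⟩, coords_ray q⟩
      simp [latticePoint_apply, ray_x]) hconv hy
    exact ⟨f, hf.1, hf.2, rfl⟩
  · rintro ⟨f, hf, h1, rfl⟩
    obtain ⟨h2, h3⟩ := (mem_rayCone_iff hφ hL).1 hf
    have h4 : ∑ q ∈ L, f (dualVec φ q) = 1 := by
      rw [← h1, ← sum_dualVec φ f]
      exact Finset.sum_subset (Finset.subset_univ _) fun q _ hq => h3 q hq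
    have h5 : coords f = ∑ q ∈ L, f (dualVec φ q) • vertex q := by
      conv_lhs => rw [hom_eq_sum hφ f]
      rw [← Finset.sum_subset hL fun q _ hq => by rw [h3 q hq, zero_smul], map_sum]
      simp only [map_smul, coords_ray]
    rw [h5]
    exact (convex_convexHull ℝ _).sum_mem (fun q _ => h2 q) h4
      fun q hq => subset_convexHull ℝ _ ⟨q, hq, rfl⟩

theorem vertex_injective {ι κ : Type} [DecidableEq ι] [DecidableEq κ] :
    Function.Injective (vertex : ι × κ → _) := by
  intro p q h
  have h' := congrArg Prod.fst h
  have h'' := congrArg Prod.snd h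
  have h1 := congrFun h' p.1
  have h2 := congrFun h'' p.2
  simp only [vertex, Pi.single_apply, if_true] at h1 h2
  refine Prod.ext ?_ ?_
  · by_contra hne
    rw [if_neg hne] at h1
    exact one_ne_zero h1
  · by_contra hne
    rw [if_neg hne] at h2
    exact one_ne_zero h2

theorem linearIndependent_vertex (φ : Fin n → Fin k) :
    LinearIndependent ℝ (fun q : path φ => vertex q.1) := by
  rw [Fintype.linearIndependent_iff]
  intro g hg p
  have h : coords (∑ q : path φ, g q • latticePoint (ray q.1) : H n k →+ ℝ) = coords 0 := by
    rw [map_sum, map_zero, ← hg]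
    simp only [map_smul, coords_ray]
  have h' := DFunLike.congr_fun (coords_injective h) (dualVec φ p)
  rw [AddMonoidHom.finsetSum_apply, Finset.sum_eq_single p] at h'
  · change g p * ((ray p.1 (dualVec φ p.1) : ℤ) : ℝ) = 0 at h'
    simpa [ray_dualVec p.2] using h'
  · intro q _ hq
    change g q * ((ray q.1 (dualVec φ p.1) : ℤ) : ℝ) = 0
    rw [ray_dualVec q.2, if_neg (fun h => hq (Subtype.ext h.symm)), Int.cast_zero, mul_zero]
  · simp

theorem path_subset_of_mem_triangulation (hk : 1 ≤ k)
    {t : Finset ((Fin (n + 1) → ℝ) × (Fin k → ℝ))} (ht : t ∈ triangulation n k) :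
    ∃ φ : Fin n → Fin k, Antitone φ ∧ ∃ L : Finset (Fin (n + 1) × Fin k), L ⊆ path φ ∧
      L.Nonempty ∧ (t : Set ((Fin (n + 1) → ℝ) × (Fin k → ℝ))) =
        vertex '' (L : Set (Fin (n + 1) × Fin k)) := by
  obtain ⟨L, hne, hL, ht⟩ := ht
  obtain ⟨φ, hφ, h⟩ := exists_subset_path hk hL
  exact ⟨φ, hφ, L, h, hne, ht⟩

/-- The standard triangulation as a simplicial complex. -/
def triangulationComplex (hk : 1 ≤ k) :
    Geometry.SimplicialComplex ℝ ((Fin (n + 1) → ℝ) × (Fin k → ℝ)) where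
  faces := triangulation n k
  isRelLowerSet_faces := by
    classical
    rintro t ⟨L, hne, hL, ht⟩
    refine ⟨?_, fun s hst hs => ?_⟩
    · rw [← Finset.coe_nonempty, ht]
      exact (Finset.coe_nonempty.2 hne).image vertex
    · have hs' : (s : Set ((Fin (n + 1) → ℝ) × (Fin k → ℝ))) =
          vertex '' ((L.filter fun q => vertex q ∈ s : Finset (Fin (n + 1) × Fin k)) :
            Set (Fin (n + 1) × Fin k)) := by
        ext y
        constructor
        · intro hy
          have hyt : y ∈ (t : Set ((Fin (n + 1) → ℝ) × (Fin k → ℝ))) := hst hy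
          rw [ht] at hyt
          obtain ⟨q, hq, rfl⟩ := hyt
          exact ⟨q, Finset.mem_coe.2 (Finset.mem_filter.2 ⟨hq, hy⟩), rfl⟩
        · rintro ⟨q, hq, rfl⟩
          exact (Finset.mem_filter.1 hq).2
      refine ⟨_, ?_, hL.mono (Finset.coe_subset.2 (Finset.filter_subset _ _)), hs'⟩
      rw [← Finset.coe_nonempty, hs', Set.image_nonempty] at hs
      exact Finset.coe_nonempty.1 hs
  indep := by
    intro t ht
    obtain ⟨φ, -, L, hL, -, ht⟩ := path_subset_of_mem_triangulation hk ht
    refine (linearIndependent_vertex φ).affineIndependent.range.mono (s := (t : Set _)) ?_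
    rw [ht]
    rintro _ ⟨q, hq, rfl⟩
    exact ⟨⟨q, hL hq⟩, rfl⟩
  inter_subset_convexHull := by
    classical
    intro s t hs ht
    obtain ⟨φ, hφ, L, hL, -, hs⟩ := path_subset_of_mem_triangulation hk hs
    obtain ⟨ψ, hψ, M, hM, -, ht⟩ := path_subset_of_mem_triangulation hk ht
    rw [hs, ht]
    rintro y ⟨hy, hy'⟩
    obtain ⟨f, hf, h1, rfl⟩ := (mem_convexHull_vertex_iff hφ hL).1 hy
    obtain ⟨g, hg, -, h2⟩ := (mem_convexHull_vertex_iff hψ hM).1 hy'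
    rw [coords_injective h2] at hg
    rw [← Set.image_inter vertex_injective, ← Finset.coe_inter,
      mem_convexHull_vertex_iff hφ (Finset.inter_subset_left.trans hL)]
    exact ⟨f, rayCone_inf hφ hψ hL hM ▸ ⟨hf, hg⟩, h1, rfl⟩

theorem triangulationComplex_space (hk : 1 ≤ k) :
    (triangulationComplex (n := n) hk).space = polytope n k := by
  classical
  ext y
  rw [Geometry.SimplicialComplex.mem_space_iff]
  constructor
  · rintro ⟨t, ⟨L, -, -, ht⟩, hy⟩
    refine convexHull_min ?_ ((convex_stdSimplex ℝ _).prod (convex_stdSimplex ℝ _)) hy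
    rw [ht]
    rintro _ ⟨q, -, rfl⟩
    exact ⟨single_mem_stdSimplex ℝ q.1, single_mem_stdSimplex ℝ q.2⟩
  · rintro ⟨⟨h1, h2⟩, h3, h4⟩
    -- Both coordinate sums are 1, so a point of the polytope lies on the hyperplane and defines a
    -- linear form on H.
    let f : H n k →+ ℝ := homOfSumEq y.1 y.2 (h2.trans h4.symm)
    have hfx : ∀ i, f (x i) = y.1 i := homOfSumEq_x _ _ _
    have hfv : ∀ j, f (v j) = y.2 j := homOfSumEq_v _ _ _
    obtain ⟨φ, hφ, hf⟩ := exists_mem_cone hk (f := f) (fun i => (hfx i).symm ▸ h1 i)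
      (fun j => (hfv j).symm ▸ h3 j)
    have hy : y ∈ convexHull ℝ (vertex '' (path φ : Set (Fin (n + 1) × Fin k))) := by
      refine (mem_convexHull_vertex_iff hφ subset_rfl).2 ⟨f, cone_eq_rayCone hφ ▸ hf, ?_, ?_⟩
      · simp only [hfx, h2]
      · exact Prod.ext (funext hfx) (funext hfv)
    refine ⟨(path φ).image vertex, ⟨path φ, ?_, path_isChain φ, Finset.coe_image⟩, ?_⟩
    · have := convexHull_nonempty_iff.1 ⟨y, hy⟩
      exact Finset.coe_nonempty.1 ((Set.image_nonempty).1 this)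
    · rwa [Finset.coe_image]

end Polytope

/-! ### Dual monoids, localizations and separating characters -/

section Charts

variable {n k : ℕ}

theorem dualMonoid_rayCone (I : Finset (Fin (n + 1) × Fin k)) :
    dualMonoid (rayCone I) = nonnegOn I := by
  refine le_antisymm (fun m hm q hq => ?_) (fun m hm f hf => nonneg_of_mem_rayCone hf hm)
  have h := hm _ (ray_mem_rayCone hq)
  rw [latticePoint_apply] at h
  exact_mod_cast h

theorem nonnegOn_eq_loc {I J : Finset (Fin (n + 1) × Fin k)} (hIJ : I ⊆ J) {u : H n k}
    (h0 : ∀ q ∈ I, ray q u = 0) (h1 : ∀ q ∈ J, q ∉ I → 0 < ray q u) :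
    nonnegOn I = nonnegOn J ⊔ AddSubmonoid.multiples (-u) := by
  have hu : ∀ q ∈ J, 0 ≤ ray q u := fun q hq => by
    by_cases h : q ∈ I
    exacts [(h0 q h).ge, (h1 q hq h).le]
  ext m
  rw [mem_loc]
  constructor
  · intro hm
    -- This exponent bounds every negative value of m at once, and u is at least 1 on the rays of J
    -- outside I.
    refine ⟨∑ q ∈ J, (ray q m).natAbs, fun q hq => ?_⟩
    rw [map_add, map_nsmul, nsmul_eq_mul]
    by_cases h : q ∈ I
    · rw [h0 q h, mul_zero, add_zero]
      exact hm q h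
    · have h2 : (ray q m).natAbs ≤ ∑ q ∈ J, (ray q m).natAbs :=
        Finset.single_le_sum (f := fun q => (ray q m).natAbs) (fun _ _ => Nat.zero_le _) hq
      have h3 : ((ray q m).natAbs : ℤ) ≤ ((∑ q ∈ J, (ray q m).natAbs : ℕ) : ℤ) := by
        exact_mod_cast h2
      have h4 : (1 : ℤ) ≤ ray q u := h1 q hq h
      have h5 : -(ray q m) ≤ ((ray q m).natAbs : ℤ) := by omega
      nlinarith
  · rintro ⟨N, hN⟩ q hq
    have := hN q (hIJ hq)
    rwa [map_add, map_nsmul, h0 q hq, smul_zero, add_zero] at this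

theorem nonnegOn_eq_loc_sum_dualVec {φ : Fin n → Fin k} {I J : Finset (Fin (n + 1) × Fin k)}
    (hIJ : I ⊆ J) (hJ : J ⊆ path φ) :
    nonnegOn I = nonnegOn J ⊔ AddSubmonoid.multiples (-∑ p ∈ J \ I, dualVec φ p) := by
  have h : ∀ q ∈ J, ray q (∑ p ∈ J \ I, dualVec φ p) = if q ∈ I then 0 else 1 := by
    intro q hq
    simp only [map_sum, ray_dualVec (hJ hq), Finset.sum_ite_eq', Finset.mem_sdiff, hq, true_and]
    split_ifs <;> simp_all
  refine nonnegOn_eq_loc hIJ (fun q hq => ?_) fun q hq hqI => ?_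
  · rw [h q (hIJ hq), if_pos hq]
  · rw [h q hq, if_neg hqI]
    exact zero_lt_one

theorem isLocOf_nonnegOn {φ : Fin n → Fin k} {I J : Finset (Fin (n + 1) × Fin k)} (hIJ : I ⊆ J)
    (hJ : J ⊆ path φ) : IsLocOf (nonnegOn I) (nonnegOn J) :=
  ⟨_, sum_mem fun p _ => dualVec_mem_nonnegOn hJ p, nonnegOn_eq_loc_sum_dualVec hIJ hJ⟩

/-- An element of `H` which separates the cones of `φ` and `ψ`. -/
def separator (φ ψ : Fin n → Fin k) : H n k :=
  ∑ p : Fin n, ∑ j ∈ Finset.range k,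
    if (φ p).val < j ∧ j ≤ (ψ p).val then -c (p.val + 1) j
    else if (ψ p).val < j ∧ j ≤ (φ p).val then c (p.val + 1) j else 0

theorem separator_swap (φ ψ : Fin n → Fin k) : separator ψ φ = -separator φ ψ := by
  simp only [separator, ← Finset.sum_neg_distrib]
  refine Finset.sum_congr rfl fun p _ => Finset.sum_congr rfl fun j _ => ?_
  split_ifs <;> first | omega | simp

theorem separator_term_mem (φ ψ : Fin n → Fin k) (p : Fin n) (j : ℕ) :
    (if (φ p).val < j ∧ j ≤ (ψ p).val then -c (p.val + 1) j
    else if (ψ p).val < j ∧ j ≤ (φ p).val then c (p.val + 1) j else 0) ∈ nonnegOn (path φ) := by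
  split_ifs with h1 h2
  · exact neg_c_mem_nonnegOn_path p h1.1
  · exact c_mem_nonnegOn_path p h2.2
  · exact zero_mem _

theorem separator_mem (φ ψ : Fin n → Fin k) : separator φ ψ ∈ nonnegOn (path φ) :=
  sum_mem fun p _ => sum_mem fun j _ => separator_term_mem φ ψ p j

theorem neg_separator_mem (φ ψ : Fin n → Fin k) : -separator φ ψ ∈ nonnegOn (path ψ) := by
  rw [← separator_swap]
  exact separator_mem ψ φ

/-- All terms of the separator are nonnegative on the path of φ. If they all vanish at q, no
comparison prescribed by ψ can fail there, so q lies on the path of ψ. -/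
theorem ray_separator_pos {φ ψ : Fin n → Fin k} {q : Fin (n + 1) × Fin k} (hq : q ∈ path φ)
    (hq' : q ∉ path ψ) : 0 < ray q (separator φ ψ) := by
  refine lt_of_le_of_ne (separator_mem φ ψ q hq) fun h0 => hq' ?_
  have hterm : ∀ (p : Fin n) (j : ℕ), j < k → ray q
      (if (φ p).val < j ∧ j ≤ (ψ p).val then -c (p.val + 1) j
      else if (ψ p).val < j ∧ j ≤ (φ p).val then c (p.val + 1) j else 0) = 0 := by
    intro p j hj
    rw [separator, map_sum, eq_comm, Finset.sum_eq_zero_iff_of_nonneg] at h0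
    · have h1 := h0 p (Finset.mem_univ p)
      rw [map_sum, Finset.sum_eq_zero_iff_of_nonneg] at h1
      · exact h1 j (Finset.mem_range.2 hj)
      · exact fun j _ => separator_term_mem φ ψ p j q hq
    · intro p _
      exact (sum_mem fun j _ => separator_term_mem φ ψ p j : _ ∈ nonnegOn (path φ)) q hq
  refine mem_path.2 fun p => ⟨fun h => ?_, fun h => ?_⟩
  · by_contra hlt
    have h1 := (mem_path.1 hq p).1 h
    rw [not_le, Fin.lt_def] at hlt
    rw [Fin.le_def] at h1
    -- Here φ p ≤ q.2 < ψ p, so the cut point q.2 + 1 contributes to the separator, and its value at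
    -- q is 1.
    have h2 := hterm p (q.2.val + 1) (by omega)
    rw [if_pos (by omega), c_eq, neg_sub, map_sub, ray_partialX, ray_partialV, if_pos (by omega),
      if_neg (by omega)] at h2
    exact one_ne_zero h2
  · by_contra hlt
    have h1 := (mem_path.1 hq p).2 h
    rw [not_le, Fin.lt_def] at hlt
    rw [Fin.le_def] at h1
    have h2 := hterm p q.2.val (by omega)
    rw [if_neg (by omega), if_pos (by omega), c_eq, map_sub, ray_partialX, ray_partialV,
      if_pos le_rfl, if_neg (by omega)] at h2
    exact one_ne_zero h2

theorem ray_separator_eq_zero {φ ψ : Fin n → Fin k} {q : Fin (n + 1) × Fin k} (hq : q ∈ path φ)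
    (hq' : q ∈ path ψ) : ray q (separator φ ψ) = 0 := by
  have := neg_separator_mem φ ψ q hq'
  rw [map_neg] at this
  exact le_antisymm (neg_nonneg.1 this) (separator_mem φ ψ q hq)

theorem nonnegOn_inter_eq_loc (φ ψ : Fin n → Fin k) : nonnegOn (path φ ∩ path ψ) =
    nonnegOn (path φ) ⊔ AddSubmonoid.multiples (-separator φ ψ) := by
  refine nonnegOn_eq_loc Finset.inter_subset_left (fun q hq => ?_) fun q hq hq' => ?_
  · exact ray_separator_eq_zero (Finset.mem_inter.1 hq).1 (Finset.mem_inter.1 hq).2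
  · exact ray_separator_pos hq fun h => hq' (Finset.mem_inter.2 ⟨hq, h⟩)

/-- The chart of the fan given by a set of vertices of a lattice path. -/
def subChart {φ : Fin n → Fin k} (hφ : Antitone φ) {I : Finset (Fin (n + 1) × Fin k)}
    (hI : I ⊆ path φ) : Chart (fan n k) :=
  ⟨nonnegOn I, rayCone I, mem_fan_iff.2 ⟨φ, hφ, I, hI, rfl⟩, by
    rw [dualMonoid_rayCone]
    exact IsLocOf.refl _⟩

/-- The chart of the fan given by a lattice path. -/
def pathChart {φ : Fin n → Fin k} (hφ : Antitone φ) : Chart (fan n k) :=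
  subChart hφ subset_rfl

theorem subChart_le {φ : Fin n → Fin k} (hφ : Antitone φ) {I : Finset (Fin (n + 1) × Fin k)}
    (hI : I ⊆ path φ) : subChart hφ hI ≤ pathChart hφ :=
  isLocOf_nonnegOn hI subset_rfl

theorem exists_le_pathChart (R : Chart (fan n k)) :
    ∃ (φ : Fin n → Fin k) (hφ : Antitone φ), R ≤ pathChart hφ := by
  obtain ⟨σ, hσ, h⟩ := R.exists_cone
  obtain ⟨φ, hφ, I, hI, rfl⟩ := mem_fan_iff.1 hσ
  rw [dualMonoid_rayCone] at h
  exact ⟨φ, hφ, h.trans (subChart_le hφ hI)⟩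

/-- An open toric piece of both charts inverts the separator, since its monoid contains the
separator and its negative. It is therefore a piece of the chart of the common face, localized at
the same character w. -/
theorem le_subChart_inter {φ ψ : Fin n → Fin k} (hφ : Antitone φ) (hψ : Antitone ψ)
    {R : Chart (fan n k)} (h : R ≤ pathChart hφ) (h' : R ≤ pathChart hψ) :
    R ≤ subChart hφ (Finset.inter_subset_left (s₂ := path ψ)) := by
  obtain ⟨w, hw, hR⟩ := h
  have hle : nonnegOn (path φ) ≤ R.monoid := IsLocOf.le ⟨w, hw, hR⟩
  have hτ : nonnegOn (path φ ∩ path ψ) ≤ R.monoid := by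
    rw [nonnegOn_inter_eq_loc, sup_le_iff, AddSubmonoid.multiples_le]
    exact ⟨hle, h'.le (neg_separator_mem φ ψ)⟩
  refine ⟨w, nonnegOn_anti Finset.inter_subset_left hw, le_antisymm ?_ (sup_le hτ ?_)⟩
  · rw [hR]
    exact sup_le_sup_right (nonnegOn_anti Finset.inter_subset_left) _
  · rw [hR]
    exact le_sup_right

end Charts

/-! ### Points and morphisms of glued toric schemes -/

section ToricSchemeLemmas

variable {M : Type} [AddCommGroup M] (C : Set (PointedCone ℝ (M →+ ℝ)))
variable (𝕜 : Type u) [CommRing 𝕜]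

instance (P : Chart C) : IsOpenImmersion (chartι C 𝕜 P) :=
  inferInstanceAs (IsOpenImmersion (colimit.ι (chartFunctor C 𝕜) P))

theorem SpecMap_inclHom_chartι {Q P : Chart C} (h : Q ≤ P) :
    Spec.map (CommRingCat.ofHom (inclHom 𝕜 h.le)) ≫ chartι C 𝕜 P = chartι C 𝕜 Q :=
  colimit.w (chartFunctor C 𝕜) (homOfLE h)

theorem exists_chartι_eq (y : toricScheme C 𝕜) : ∃ (P : Chart C) (z : _), chartι C 𝕜 P z = y :=
  Scheme.IsLocallyDirected.ι_jointly_surjective (chartFunctor C 𝕜) y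

theorem exists_of_chartι_eq {P Q : Chart C} {y : Spec (.of (AddMonoidAlgebra 𝕜 P.monoid))}
    {z : Spec (.of (AddMonoidAlgebra 𝕜 Q.monoid))} (h : chartι C 𝕜 P y = chartι C 𝕜 Q z) :
    ∃ (R : Chart C) (hP : R ≤ P) (hQ : R ≤ Q) (w : Spec (.of (AddMonoidAlgebra 𝕜 R.monoid))),
      Spec.map (CommRingCat.ofHom (inclHom 𝕜 hP.le)) w = y ∧
      Spec.map (CommRingCat.ofHom (inclHom 𝕜 hQ.le)) w = z := by
  obtain ⟨R, fP, fQ, w, h1, h2⟩ := (Scheme.IsLocallyDirected.ι_eq_ι_iff (chartFunctor C 𝕜)).1 h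
  exact ⟨R, leOfHom fP, leOfHom fQ, w, h1, h2⟩

variable {C} in
/-- The isomorphism between the toric schemes of two fans which agree. -/
theorem exists_iso_of_eq {n k : ℕ} {C D : Set (PointedCone ℝ (H n k →+ ℝ))} (h : C = D)
    (hC : XVNonneg C) (hD : XVNonneg D) : ∃ E : toricScheme C 𝕜 ≅ toricScheme D 𝕜,
      E.hom ≫ toHypersurface 𝕜 hD = toHypersurface 𝕜 hC ∧
      ∀ (P : Chart C) (Q : Chart D) (h : Q.monoid = P.monoid),
        chartι C 𝕜 P ≫ E.hom =
          Spec.map (CommRingCat.ofHom (inclHom 𝕜 h.le)) ≫ chartι D 𝕜 Q := by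
  subst h
  refine ⟨Iso.refl _, Category.id_comp _, fun P Q h => ?_⟩
  have hle : P ≤ Q := by
    change IsLocOf _ _
    rw [h]
    exact IsLocOf.refl _
  exact (Category.comp_id _).trans (SpecMap_inclHom_chartι C 𝕜 hle).symm

theorem chartι_toHypersurface {n k : ℕ} {C : Set (PointedCone ℝ (H n k →+ ℝ))} (hC : XVNonneg C)
    (P : Chart C) : chartι C 𝕜 P ≫ toHypersurface 𝕜 hC =
      Spec.map (CommRingCat.ofHom (chartHom 𝕜 P.monoid (P.nonneg hC))) :=
  colimit.ι_desc _ _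

end ToricSchemeLemmas

/-! ### A criterion for separatedness by affine covers -/

section Separated

/-- A morphism to an affine scheme is separated if the source is covered by affine open subschemes
with affine intersections, such that functions on the intersections are generated by functions on
the affine open subschemes. -/
theorem isSeparated_of_affine_cover {Y S : Scheme.{u}} [IsAffine S] (f : Y ⟶ S)
    (𝒰 : Y.OpenCover) [∀ i, IsAffine (𝒰.X i)]
    (h : ∀ i j, ∃ (Z : Scheme.{u}) (a : Z ⟶ 𝒰.X i) (b : Z ⟶ 𝒰.X j), IsAffine Z ∧
      IsPullback a b (𝒰.f i) (𝒰.f j) ∧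
      Subring.closure (Set.range a.appTop.hom ∪ Set.range b.appTop.hom) = ⊤) :
    IsSeparated f := by
  refine ⟨IsZariskiLocalAtTarget.of_openCover (Scheme.Pullback.openCoverOfLeftRight 𝒰 𝒰 f f) ?_⟩
  rintro ⟨i, j⟩
  obtain ⟨Z, a, b, hZ, hpb, hcl⟩ := h i j
  -- Over the product of two pieces of the cover, the diagonal restricts to the map from their
  -- intersection. Between affine schemes this is a closed immersion as soon as it is surjective on
  -- functions.
  have hdiag := pullback_map_diagonal_isPullback (𝒰.f i) (𝒰.f j) f
  have key : IsClosedImmersion (pullback.mapDesc (𝒰.f i) (𝒰.f j) f) := by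
    rw [← MorphismProperty.cancel_left_of_respectsIso (P := @IsClosedImmersion)
      hpb.isoPullback.hom]
    refine IsClosedImmersion.of_surjective_of_isAffine _ fun z => ?_
    set g := hpb.isoPullback.hom ≫ pullback.mapDesc (𝒰.f i) (𝒰.f j) f with hg
    have h1 : g ≫ pullback.fst (𝒰.f i ≫ f) (𝒰.f j ≫ f) = a := by
      have e : pullback.mapDesc (𝒰.f i) (𝒰.f j) f ≫ pullback.fst (𝒰.f i ≫ f) (𝒰.f j ≫ f) =
          pullback.fst (𝒰.f i) (𝒰.f j) := (pullback.lift_fst _ _ _).trans (Category.comp_id _)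
      rw [hg, Category.assoc, e, hpb.isoPullback_hom_fst]
    have h2 : g ≫ pullback.snd (𝒰.f i ≫ f) (𝒰.f j ≫ f) = b := by
      have e : pullback.mapDesc (𝒰.f i) (𝒰.f j) f ≫ pullback.snd (𝒰.f i ≫ f) (𝒰.f j ≫ f) =
          pullback.snd (𝒰.f i) (𝒰.f j) := (pullback.lift_snd _ _ _).trans (Category.comp_id _)
      rw [hg, Category.assoc, e, hpb.isoPullback_hom_snd]
    have hle : Subring.closure (Set.range a.appTop.hom ∪ Set.range b.appTop.hom) ≤
        g.appTop.hom.range := by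
      rw [Subring.closure_le]
      rintro _ (⟨y, rfl⟩ | ⟨y, rfl⟩)
      · rw [← h1, Scheme.Hom.comp_appTop]
        exact ⟨_, rfl⟩
      · rw [← h2, Scheme.Hom.comp_appTop]
        exact ⟨_, rfl⟩
    exact hle (hcl ▸ Subring.mem_top z)
  have h3 : IsClosedImmersion (pullback.snd (pullback.diagonal f)
      (pullback.map (𝒰.f i ≫ f) (𝒰.f j ≫ f) f f (𝒰.f i) (𝒰.f j) (𝟙 S) (by simp) (by simp))) := by
    rw [← MorphismProperty.cancel_left_of_respectsIso (P := @IsClosedImmersion)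
      hdiag.isoPullback.hom, hdiag.isoPullback_hom_snd]
    exact key
  exact h3

end Separated

/-! ### The affine cover by lattice paths, and separatedness of π -/

section Cover

theorem SpecMap_inclHom_apply {M : Type} [AddCommGroup M] (𝕜 : Type u) [CommRing 𝕜]
    {P Q R : AddSubmonoid M} (h : P ≤ Q) (h' : Q ≤ R)
    (w : Spec (.of (AddMonoidAlgebra 𝕜 R))) :
    Spec.map (CommRingCat.ofHom (inclHom 𝕜 h)) (Spec.map (CommRingCat.ofHom (inclHom 𝕜 h')) w) =
      Spec.map (CommRingCat.ofHom (inclHom 𝕜 (h.trans h'))) w := by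
  rw [← Scheme.Hom.comp_apply, ← Spec.map_comp, ← CommRingCat.ofHom_comp, inclHom_comp]

variable (n k : ℕ) (𝕜 : Type u) [CommRing 𝕜]

/-- The inclusion of the affine chart given by a set of vertices of a lattice path. -/
def subι {φ : Fin n → Fin k} (hφ : Antitone φ) {I : Finset (Fin (n + 1) × Fin k)}
    (hI : I ⊆ path φ) : Spec (.of (AddMonoidAlgebra 𝕜 (nonnegOn I))) ⟶ Y n k 𝕜 :=
  chartι (fan n k) 𝕜 (subChart hφ hI)

instance {φ : Fin n → Fin k} (hφ : Antitone φ) {I : Finset (Fin (n + 1) × Fin k)}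
    (hI : I ⊆ path φ) : IsOpenImmersion (subι n k 𝕜 hφ hI) :=
  inferInstanceAs (IsOpenImmersion (chartι (fan n k) 𝕜 (subChart hφ hI)))

theorem SpecMap_inclHom_subι {φ ψ : Fin n → Fin k} (hφ : Antitone φ) (hψ : Antitone ψ)
    {I J : Finset (Fin (n + 1) × Fin k)} (hIJ : I ⊆ J) (hI : I ⊆ path φ) (hJ : J ⊆ path ψ) :
    Spec.map (CommRingCat.ofHom (inclHom 𝕜 (nonnegOn_anti hIJ))) ≫ subι n k 𝕜 hψ hJ =
      subι n k 𝕜 hφ hI :=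
  SpecMap_inclHom_chartι (fan n k) 𝕜 (Q := subChart hφ hI) (P := subChart hψ hJ)
    (isLocOf_nonnegOn hIJ hJ)

instance isOpenImmersion_inclHom_nonnegOn_inter_right (φ ψ : Fin n → Fin k) :
    IsOpenImmersion (Spec.map (CommRingCat.ofHom (inclHom 𝕜
      (nonnegOn_anti (Finset.inter_subset_right (s₁ := path φ) (s₂ := path ψ)))))) :=
  isOpenImmersion_inclHom 𝕜 (isLocOf_nonnegOn Finset.inter_subset_right subset_rfl)

theorem subι_π {φ : Fin n → Fin k} (hφ : Antitone φ) {I : Finset (Fin (n + 1) × Fin k)}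
    (hI : I ⊆ path φ) : subι n k 𝕜 hφ hI ≫ π n k 𝕜 =
      Spec.map (CommRingCat.ofHom
        (chartHom 𝕜 (nonnegOn I) ⟨x_mem_nonnegOn I, v_mem_nonnegOn I⟩)) :=
  chartι_toHypersurface 𝕜 fan_nonneg (subChart hφ hI)

theorem exists_pathChart_eq (y : Y n k 𝕜) : ∃ (φ : {φ : Fin n → Fin k // Antitone φ})
    (z : Spec (.of (AddMonoidAlgebra 𝕜 (nonnegOn (path φ.1))))),
    subι n k 𝕜 φ.2 subset_rfl z = y := by
  obtain ⟨R, w, rfl⟩ := exists_chartι_eq (fan n k) 𝕜 y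
  obtain ⟨φ, hφ, h⟩ := exists_le_pathChart R
  refine ⟨⟨φ, hφ⟩, Spec.map (CommRingCat.ofHom (inclHom 𝕜 h.le)) w, ?_⟩
  rw [← SpecMap_inclHom_chartι (fan n k) 𝕜 h]
  rfl

/-- The cover of `𝒴_{n,k}` by the affine charts of the lattice paths. -/
def pathCover : (Y n k 𝕜).OpenCover :=
  Scheme.Cover.mkOfCovers {φ : Fin n → Fin k // Antitone φ}
    (fun φ => Spec (.of (AddMonoidAlgebra 𝕜 (nonnegOn (path φ.1)))))
    (fun φ => subι n k 𝕜 φ.2 subset_rfl) (exists_pathChart_eq n k 𝕜) (fun _ => inferInstance)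

instance (φ : (pathCover n k 𝕜).I₀) : IsAffine ((pathCover n k 𝕜).X φ) :=
  inferInstanceAs (IsAffine (Spec (.of (AddMonoidAlgebra 𝕜 (nonnegOn (path φ.1))))))

instance : Finite (pathCover n k 𝕜).I₀ :=
  inferInstanceAs (Finite {φ : Fin n → Fin k // Antitone φ})

instance : CompactSpace (Y n k 𝕜) := (pathCover n k 𝕜).compactSpace

variable {n k}

/-- Two charts could a priori overlap in several toric pieces. By `le_subChart_inter` all of them
lie in the chart of the common face, which is thus the whole intersection. -/
theorem isPullback_subChart_inter {φ ψ : Fin n → Fin k} (hφ : Antitone φ) (hψ : Antitone ψ) :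
    IsPullback
      (Spec.map (CommRingCat.ofHom
        (inclHom 𝕜 (nonnegOn_anti (Finset.inter_subset_left (s₁ := path φ) (s₂ := path ψ))))))
      (Spec.map (CommRingCat.ofHom
        (inclHom 𝕜 (nonnegOn_anti (Finset.inter_subset_right (s₁ := path φ) (s₂ := path ψ))))))
      (subι n k 𝕜 hφ subset_rfl) (subι n k 𝕜 hψ subset_rfl) := by
  have el := SpecMap_inclHom_subι n k 𝕜 hφ hφ (Finset.inter_subset_left (s₂ := path ψ))
    Finset.inter_subset_left subset_rfl
  have er := SpecMap_inclHom_subι n k 𝕜 hφ hψ (Finset.inter_subset_right (s₁ := path φ))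
    Finset.inter_subset_left subset_rfl
  refine IsOpenImmersion.isPullback _ _ _ _ (er.trans el.symm) ?_
  ext y
  constructor
  · rintro ⟨z, hz⟩
    obtain ⟨R, hP, hQ, w, h1, h2⟩ := exists_of_chartι_eq (fan n k) 𝕜 hz
    have h3 := le_subChart_inter hφ hψ hP hQ
    refine ⟨Spec.map (CommRingCat.ofHom (inclHom 𝕜 h3.le)) w, ?_⟩
    exact (SpecMap_inclHom_apply 𝕜 (nonnegOn_anti Finset.inter_subset_right) h3.le w).trans h2
  · rintro ⟨z, rfl⟩
    refine ⟨Spec.map (CommRingCat.ofHom (inclHom 𝕜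
      (nonnegOn_anti (Finset.inter_subset_left (s₂ := path ψ))))) z, ?_⟩
    exact congr($(el.trans er.symm) z)

/-- With u the separator, each character of the intersection is the sum of m + N u, regular on the
chart of φ for large N, and N(-u), regular on the chart of ψ. -/
theorem closure_range_inclHom_eq_top (φ ψ : Fin n → Fin k) :
    Subring.closure
      (Set.range (inclHom 𝕜 (nonnegOn_anti (Finset.inter_subset_left (s₁ := path φ)
        (s₂ := path ψ)))) ∪
      Set.range (inclHom 𝕜 (nonnegOn_anti (Finset.inter_subset_right (s₁ := path φ)
        (s₂ := path ψ))))) = ⊤ := by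
  refine eq_top_iff.2 fun z _ => ?_
  induction z using AddMonoidAlgebra.induction_linear with
  | zero => exact zero_mem _
  | add x y hx hy => exact add_mem (hx trivial) (hy trivial)
  | single m r =>
    obtain ⟨N, hN⟩ := mem_loc.1 ((nonnegOn_inter_eq_loc φ ψ).le m.2)
    have key : AddMonoidAlgebra.single m r =
        inclHom 𝕜 (nonnegOn_anti (Finset.inter_subset_left (s₁ := path φ) (s₂ := path ψ)))
          (AddMonoidAlgebra.single (⟨_, hN⟩ : nonnegOn (path φ)) r) *
        inclHom 𝕜 (nonnegOn_anti (Finset.inter_subset_right (s₁ := path φ) (s₂ := path ψ)))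
          (AddMonoidAlgebra.single (⟨_, (nonnegOn (path ψ)).nsmul_mem
            (neg_separator_mem φ ψ) N⟩ : nonnegOn (path ψ)) (1 : 𝕜)) := by
      rw [inclHom_single, inclHom_single, AddMonoidAlgebra.single_mul_single, mul_one]
      congr 1
      ext
      simp
    rw [key]
    exact mul_mem (Subring.subset_closure (Or.inl ⟨_, rfl⟩))
      (Subring.subset_closure (Or.inr ⟨_, rfl⟩))

theorem closure_range_SpecMap_appTop {R S T : CommRingCat.{u}} (f : R ⟶ T) (g : S ⟶ T)
    (h : Subring.closure (Set.range f.hom ∪ Set.range g.hom) = ⊤) :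
    Subring.closure (Set.range (Spec.map f).appTop.hom ∪
      Set.range (Spec.map g).appTop.hom) = ⊤ := by
  have key : ∀ {A : CommRingCat.{u}} (f : A ⟶ T) (r : A), (Scheme.ΓSpecIso T).inv.hom (f.hom r) =
      (Spec.map f).appTop.hom ((Scheme.ΓSpecIso A).inv.hom r) := fun f r =>
    congr($(Scheme.ΓSpecIso_inv_naturality f) r)
  refine eq_top_iff.2 fun z _ => ?_
  obtain ⟨t, rfl⟩ : ∃ t, (Scheme.ΓSpecIso T).inv.hom t = z :=
    ⟨(Scheme.ΓSpecIso T).hom.hom z, by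
      rw [← CommRingCat.comp_apply, Iso.hom_inv_id, CommRingCat.id_apply]⟩
  have ht : t ∈ Subring.closure (Set.range f.hom ∪ Set.range g.hom) := h ▸ Subring.mem_top t
  have h1 : (Scheme.ΓSpecIso T).inv.hom t ∈
      (Subring.closure (Set.range f.hom ∪ Set.range g.hom)).map (Scheme.ΓSpecIso T).inv.hom :=
    ⟨t, ht, rfl⟩
  rw [RingHom.map_closure] at h1
  refine Subring.closure_mono ?_ h1
  rintro _ ⟨_, ⟨r, rfl⟩ | ⟨r, rfl⟩, rfl⟩
  · exact Or.inl ⟨_, (key f r).symm⟩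
  · exact Or.inr ⟨_, (key g r).symm⟩

instance isAffine_hypersurface : IsAffine (hypersurface n k 𝕜) :=
  inferInstanceAs (IsAffine (Spec (.of (HypersurfaceRing n k 𝕜))))

instance isSeparated_π : IsSeparated (π n k 𝕜) :=
  isSeparated_of_affine_cover _ (pathCover n k 𝕜) fun φ ψ =>
    ⟨_, _, _, inferInstance, isPullback_subChart_inter 𝕜 φ.2 ψ.2,
      closure_range_SpecMap_appTop _ _ (closure_range_inclHom_eq_top 𝕜 φ.1 ψ.1)⟩

instance quasiCompact_π : QuasiCompact (π n k 𝕜) :=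
  (quasiCompact_iff_compactSpace _).2 inferInstance

end Cover

/-! ### Charts of lattice paths are affine spaces -/

section Smooth

variable {n k : ℕ} (𝕜 : Type u) [CommRing 𝕜]

/-- The monoid of the chart of a lattice path is free, with basis the dual vectors. -/
def nonnegOnPathEquiv {φ : Fin n → Fin k} (hφ : Antitone φ) : nonnegOn (path φ) ≃+
    (path φ →₀ ℕ) where
  toFun m := Finsupp.equivFunOnFinite.symm fun q => (ray q.1 m.1).toNat
  invFun e := ⟨∑ q : path φ, e q • dualVec φ q.1, sum_mem fun q _ =>
    nsmul_mem (dualVec_mem_nonnegOn subset_rfl q.1) _⟩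
  left_inv m := by
    ext
    refine Eq.trans ?_ (eq_sum_dualVec hφ m.1).symm
    rw [← Finset.sum_coe_sort]
    refine Finset.sum_congr rfl fun q _ => ?_
    have := Int.toNat_of_nonneg (m.2 q.1 q.2)
    rw [Finsupp.equivFunOnFinite_symm_apply_apply]
    nth_rw 2 [← this]
    rw [natCast_zsmul]
  right_inv e := by
    ext q
    have : ray q.1 (∑ p : path φ, e p • dualVec φ p.1) = e q := by
      simp only [map_sum, map_nsmul, ray_dualVec q.2, nsmul_eq_mul, mul_ite, mul_one, mul_zero]
      simp
    exact (congrArg Int.toNat this).trans (Int.toNat_natCast _)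
  map_add' a b := by
    ext q
    have h : (ray q.1 (a.1 + b.1)).toNat = (ray q.1 a.1).toNat + (ray q.1 b.1).toNat := by
      rw [map_add, Int.toNat_add (a.2 q.1 q.2) (b.2 q.1 q.2)]
    simpa using h

theorem nonnegOnPathEquiv_dualVec {φ : Fin n → Fin k} (hφ : Antitone φ) (q : path φ) :
    nonnegOnPathEquiv hφ ⟨dualVec φ q.1, dualVec_mem_nonnegOn subset_rfl q.1⟩ =
      Finsupp.single q 1 := by
  rw [← AddEquiv.eq_symm_apply]
  ext
  change _ = ∑ p : path φ, _
  simp [Finsupp.single_apply]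

/-- The coordinate ring of the chart of a lattice path is a polynomial ring. -/
def pathChartAlgEquiv {φ : Fin n → Fin k} (hφ : Antitone φ) :
    AddMonoidAlgebra 𝕜 (nonnegOn (path φ)) ≃ₐ[𝕜] MvPolynomial (path φ) 𝕜 :=
  AddMonoidAlgebra.domCongr 𝕜 𝕜 (nonnegOnPathEquiv hφ)

theorem pathChartAlgEquiv_single {φ : Fin n → Fin k} (hφ : Antitone φ) (q : path φ) :
    pathChartAlgEquiv 𝕜 hφ (AddMonoidAlgebra.single
      ⟨dualVec φ q.1, dualVec_mem_nonnegOn subset_rfl q.1⟩ 1) = MvPolynomial.X q := by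
  rw [MvPolynomial.X, MvPolynomial.monomial, ← nonnegOnPathEquiv_dualVec hφ]
  simp [pathChartAlgEquiv]

theorem chartHom_comp_algebraMap (P : AddSubmonoid (H n k))
    (hP : (∀ i, x i ∈ P) ∧ ∀ j, v j ∈ P) :
    (chartHom 𝕜 P hP).comp (algebraMap 𝕜 (HypersurfaceRing n k 𝕜)) =
      algebraMap 𝕜 (AddMonoidAlgebra 𝕜 P) := by
  ext r : 1
  change (MvPolynomial.aeval _).toRingHom (MvPolynomial.C r) = _
  simp

variable (n k)

theorem subι_π_hypersurfaceToBase {φ : Fin n → Fin k} (hφ : Antitone φ)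
    {I : Finset (Fin (n + 1) × Fin k)} (hI : I ⊆ path φ) :
    subι n k 𝕜 hφ hI ≫ π n k 𝕜 ≫ hypersurfaceToBase n k 𝕜 =
      Spec.map (CommRingCat.ofHom (algebraMap 𝕜 (AddMonoidAlgebra 𝕜 (nonnegOn I)))) := by
  rw [← Category.assoc, subι_π, ← chartHom_comp_algebraMap 𝕜 (nonnegOn I)
    ⟨x_mem_nonnegOn I, v_mem_nonnegOn I⟩]
  exact (Spec.map_comp _ _).symm

instance smooth_π : Smooth (π n k 𝕜 ≫ hypersurfaceToBase n k 𝕜) := by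
  have : IsZariskiLocalAtSource (@AlgebraicGeometry.Smooth.{u}) :=
    HasRingHomProperty.instIsZariskiLocalAtSource (Q := RingHom.Smooth)
  refine IsZariskiLocalAtSource.of_openCover (P := @AlgebraicGeometry.Smooth.{u})
    (pathCover n k 𝕜) fun φ => ?_
  change Smooth (subι n k 𝕜 φ.2 subset_rfl ≫ π n k 𝕜 ≫ hypersurfaceToBase n k 𝕜)
  rw [subι_π_hypersurfaceToBase, HasRingHomProperty.Spec_iff (P := @Smooth)]
  rw [CommRingCat.hom_ofHom, RingHom.smooth_algebraMap]
  have : Algebra.Smooth 𝕜 (MvPolynomial (path φ.1) 𝕜) := ⟨inferInstance, inferInstance⟩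
  exact Algebra.Smooth.of_equiv (A := MvPolynomial (path φ.1) 𝕜) (pathChartAlgEquiv 𝕜 φ.2).symm

instance locallyOfFiniteType_π : LocallyOfFiniteType (π n k 𝕜) :=
  locallyOfFiniteType_of_comp _ (hypersurfaceToBase n k 𝕜)

end Smooth

/-! ### Properness through the valuative criterion -/

section ValuativeCriterion

variable {n k : ℕ} {𝕜 : Type u} [CommRing 𝕜]

theorem exists_ringHom_algebraMap_comp {A R K : Type*} [CommRing A] [CommRing R] [Field K]
    [Algebra R K] [FaithfulSMul R K] (f : A →+* K) (hf : ∀ a, f a ∈ (algebraMap R K).range) :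
    ∃ g : A →+* R, (algebraMap R K).comp g = f := by
  have hb : Function.Bijective (algebraMap R K).rangeRestrict :=
    ⟨fun a b h => FaithfulSMul.algebraMap_injective R K (congrArg Subtype.val h),
      (algebraMap R K).rangeRestrict_surjective⟩
  refine ⟨(RingEquiv.ofBijective _ hb).symm.toRingHom.comp (f.codRestrict _ hf), ?_⟩
  ext a
  exact congrArg Subtype.val ((RingEquiv.ofBijective _ hb).apply_symm_apply ⟨f a, hf a⟩)

theorem single_eq_prod {φ : Fin n → Fin k} (hφ : Antitone φ) (m : nonnegOn (path φ)) :
    AddMonoidAlgebra.single m (1 : 𝕜) = ∏ q : path φ, AddMonoidAlgebra.single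
      (⟨dualVec φ q.1, dualVec_mem_nonnegOn subset_rfl q.1⟩ : nonnegOn (path φ)) (1 : 𝕜) ^
        (ray q.1 m.1).toNat := by
  simp only [AddMonoidAlgebra.single_pow, one_pow]
  rw [prod_single]
  congr 1
  nth_rw 1 [← (nonnegOnPathEquiv hφ).symm_apply_apply m]
  ext
  rw [AddSubmonoid.coe_finsetSum]
  rfl

/-- A homomorphism from the coordinate ring of the chart of a lattice path to a field extends to the
monoid algebra of a half space of `H` (or of all of `H`). -/
theorem exists_extension {K : Type*} [Field K] {φ : Fin n → Fin k} (hφ : Antitone φ)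
    (γ : AddMonoidAlgebra 𝕜 (nonnegOn (path φ)) →+* K) :
    ∃ (W : AddSubmonoid (H n k)) (hW : nonnegOn (path φ) ≤ W)
      (D : AddMonoidAlgebra 𝕜 W →+* K), D.comp (inclHom 𝕜 hW) = γ ∧
      ∀ m, (∃ h : m ∈ W, D (AddMonoidAlgebra.single ⟨m, h⟩ 1) = 0) ∨
        (∃ h : -m ∈ W, D (AddMonoidAlgebra.single ⟨-m, h⟩ 1) = 0) ∨
        ∃ (h : m ∈ W) (h' : -m ∈ W), D (AddMonoidAlgebra.single ⟨-m, h'⟩ 1) =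
          (D (AddMonoidAlgebra.single ⟨m, h⟩ 1))⁻¹ := by
  classical
  let g : H n k → K := fun m =>
    if h : m ∈ nonnegOn (path φ) then γ (AddMonoidAlgebra.single ⟨m, h⟩ 1) else 0
  -- The K-point need not lie in the torus. Z collects the coordinates that vanish there, and w is
  -- the total order of vanishing of a character along them.
  let Z := {q ∈ path φ | g (dualVec φ q) = 0}
  let F := {q ∈ path φ | g (dualVec φ q) ≠ 0}
  let w : H n k →+ ℤ := ∑ q ∈ Z, ray q
  let γ' : H n k → K := fun m => ∏ q ∈ F, g (dualVec φ q) ^ ray q m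
  have γ'_zero : γ' 0 = 1 := by simp [γ']
  have γ'_add : ∀ a b, γ' (a + b) = γ' a * γ' b := fun a b => by
    simp only [γ', ← Finset.prod_mul_distrib]
    refine Finset.prod_congr rfl fun q hq => ?_
    rw [map_add, zpow_add₀ (Finset.mem_filter.1 hq).2]
  let W : AddSubmonoid (H n k) :=
    { carrier := {m | 0 ≤ w m}
      zero_mem' := (map_zero w).ge
      add_mem' := fun {a b} ha hb => by
        have : 0 ≤ w a + w b := add_nonneg ha hb
        rwa [← map_add] at this }
  have hw : ∀ m, w m = ∑ q ∈ Z, ray q m := fun m => by simp [w]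
  have hW : nonnegOn (path φ) ≤ W := fun m hm => by
    change 0 ≤ w m
    rw [hw]
    exact Finset.sum_nonneg fun q hq => hm q (Finset.mem_filter.1 hq).1
  -- Characters with w = 0 take the value of the Laurent monomial in the nonvanishing coordinates,
  -- and those with w > 0 take the value 0. Multiplicativity holds because w is additive and
  -- nonnegative on W.
  let d : Multiplicative W →* K :=
    { toFun := fun m => if w m.toAdd.1 = 0 then γ' m.toAdd.1 else 0
      map_one' := by simp [γ'_zero]
      map_mul' := fun a b => by
        have ha : 0 ≤ w a.toAdd.1 := a.toAdd.2
        have hb : 0 ≤ w b.toAdd.1 := b.toAdd.2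
        have e : ((a * b).toAdd : W).1 = a.toAdd.1 + b.toAdd.1 := rfl
        rw [e, map_add, γ'_add]
        split_ifs <;> first | omega | rfl | simp }
  let _ : Algebra 𝕜 K := (γ.comp (algebraMap 𝕜 _)).toAlgebra
  let D : AddMonoidAlgebra 𝕜 W →ₐ[𝕜] K := AddMonoidAlgebra.lift 𝕜 K W d
  have hD : ∀ m (h : m ∈ W), D (AddMonoidAlgebra.single ⟨m, h⟩ 1) =
      if w m = 0 then γ' m else 0 := fun m h => by
    simp [D]
    rfl
  refine ⟨W, hW, D.toRingHom, ?_, fun m => ?_⟩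
  · refine AddMonoidAlgebra.ringHom_ext (fun r => ?_) fun m => ?_
    · rw [RingHom.comp_apply, inclHom_single]
      refine (AddMonoidAlgebra.lift_single _ _ _).trans ?_
      refine (congrArg (r • ·) (map_one d)).trans ?_
      rw [Algebra.smul_def, mul_one]
      rfl
    · rw [RingHom.comp_apply, inclHom_single]
      refine (hD m.1 (hW m.2)).trans ?_
      have hγ : γ (AddMonoidAlgebra.single m 1) =
          ∏ q ∈ path φ, g (dualVec φ q) ^ (ray q m.1).toNat := by
        conv_lhs => rw [single_eq_prod hφ m]
        rw [map_prod, ← Finset.prod_coe_sort (path φ)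
          (fun q => g (dualVec φ q) ^ (ray q m.1).toNat)]
        refine Finset.prod_congr rfl fun q _ => ?_
        rw [map_pow]
        simp only [g, dif_pos (dualVec_mem_nonnegOn subset_rfl q.1)]
      rw [hγ]
      have hm : ∀ q ∈ Z, 0 ≤ ray q m.1 := fun q hq => m.2 q (Finset.mem_filter.1 hq).1
      split_ifs with h
      · rw [hw, Finset.sum_eq_zero_iff_of_nonneg hm] at h
        have h1 : ∏ q ∈ Z, g (dualVec φ q) ^ (ray q m.1).toNat = 1 :=
          Finset.prod_eq_one fun q hq => by rw [h q hq, Int.toNat_zero, pow_zero]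
        rw [← Finset.prod_filter_mul_prod_filter_not (path φ) (fun q => g (dualVec φ q) = 0), h1,
          one_mul]
        refine Finset.prod_congr rfl fun q hq => ?_
        nth_rw 1 [← Int.toNat_of_nonneg (m.2 q (Finset.mem_filter.1 hq).1)]
        rw [zpow_natCast]
      · rw [hw, Finset.sum_eq_zero_iff_of_nonneg hm] at h
        push Not at h
        obtain ⟨q, hq, h⟩ := h
        have h1 := hm q hq
        refine (Finset.prod_eq_zero (Finset.mem_filter.1 hq).1 ?_).symm
        rw [(Finset.mem_filter.1 hq).2]
        exact zero_pow (by omega)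
  · rcases lt_trichotomy (w m) 0 with h | h | h
    · have h' : -m ∈ W := by
        change 0 ≤ w (-m)
        rw [map_neg]; omega
      refine Or.inr (Or.inl ⟨h', (hD _ h').trans (if_neg ?_)⟩)
      rw [map_neg]; omega
    · have h1 : w (-m) = 0 := by rw [map_neg, h, neg_zero]
      refine Or.inr (Or.inr ⟨h.ge, h1.ge, ?_⟩)
      refine (hD _ h1.ge).trans (Eq.trans ?_ (congrArg _ (hD _ h.ge)).symm)
      rw [if_pos h, if_pos h1]
      refine eq_inv_of_mul_eq_one_left ?_
      rw [← γ'_add, neg_add_cancel, γ'_zero]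
    · exact Or.inl ⟨h.le, (hD _ h.le).trans (if_neg h.ne')⟩

/-- The chart containing the generic point may be unsuitable for the R-point, so another path ψ is
chosen from the valuation. The homomorphism ε records that the two K-points agree on the
intersection of the two charts. -/
theorem exists_path_of_valuationRing (hk : 1 ≤ k) {R K : Type*} [CommRing R] [IsDomain R]
    [ValuationRing R] [Field K] [Algebra R K] [IsFractionRing R K] {φ : Fin n → Fin k}
    (hφ : Antitone φ) (γ : AddMonoidAlgebra 𝕜 (nonnegOn (path φ)) →+* K)
    (β : HypersurfaceRing n k 𝕜 →+* R)
    (h : γ.comp (chartHom 𝕜 (nonnegOn (path φ)) ⟨x_mem_nonnegOn _, v_mem_nonnegOn _⟩) =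
      (algebraMap R K).comp β) :
    ∃ (ψ : Fin n → Fin k) (_ : Antitone ψ) (δ : AddMonoidAlgebra 𝕜 (nonnegOn (path ψ)) →+* R)
      (ε : AddMonoidAlgebra 𝕜 (nonnegOn (path φ ∩ path ψ)) →+* K),
      δ.comp (chartHom 𝕜 (nonnegOn (path ψ)) ⟨x_mem_nonnegOn _, v_mem_nonnegOn _⟩) = β ∧
      ε.comp (inclHom 𝕜 (nonnegOn_anti Finset.inter_subset_left)) = γ ∧
      ε.comp (inclHom 𝕜 (nonnegOn_anti Finset.inter_subset_right)) = (algebraMap R K).comp δ := by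
  obtain ⟨W, hW, D, rfl, hD⟩ := exists_extension hφ γ
  have hxvW : (∀ i, x i ∈ W) ∧ ∀ j, v j ∈ W :=
    ⟨fun i => hW (x_mem_nonnegOn _ i), fun j => hW (v_mem_nonnegOn _ j)⟩
  rw [RingHom.comp_assoc, inclHom_comp_chartHom 𝕜 hW _ hxvW] at h
  have hint : ∀ a, D (chartHom 𝕜 W hxvW a) ∈ (algebraMap R K).range := fun a =>
    ⟨β a, (congr($h a)).symm⟩
  -- Q consists of the characters of W that are integral at the K-point. It is total: if m has value
  -- 0 at the point, or lies outside W, then m or -m qualifies with value 0; otherwise the values of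
  -- m and -m are inverse, and a valuation ring contains one of them.
  let Q : AddSubmonoid (H n k) :=
    { carrier := {m | ∃ hm : m ∈ W, D (AddMonoidAlgebra.single ⟨m, hm⟩ 1) ∈ (algebraMap R K).range}
      zero_mem' := ⟨zero_mem W, by
        change D 1 ∈ _
        rw [map_one]
        exact one_mem _⟩
      add_mem' := by
        rintro a b ⟨ha, ha'⟩ ⟨hb, hb'⟩
        refine ⟨add_mem ha hb, ?_⟩
        have := mul_mem ha' hb'
        rwa [← map_mul, AddMonoidAlgebra.single_mul_single, one_mul] at this }
  have hQW : Q ≤ W := fun m hm => hm.1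
  obtain ⟨ψ, hψ, hQ⟩ := exists_nonnegOn_path_le hk (Q := Q)
    (fun i => ⟨hxvW.1 i, by
      simpa [chartHom] using hint (Ideal.Quotient.mk _ (MvPolynomial.X (Sum.inl i)))⟩)
    (fun j => ⟨hxvW.2 j, by
      simpa [chartHom] using hint (Ideal.Quotient.mk _ (MvPolynomial.X (Sum.inr j)))⟩)
    (fun m => by
      rcases hD m with ⟨h, h0⟩ | ⟨h, h0⟩ | ⟨h, h', h0⟩
      · exact Or.inl ⟨h, h0 ▸ zero_mem _⟩
      · exact Or.inr ⟨h, h0 ▸ zero_mem _⟩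
      · rcases ValuationRing.isInteger_or_isInteger R (D (AddMonoidAlgebra.single ⟨m, h⟩ 1)) with
          hi | hi
        · exact Or.inl ⟨h, hi⟩
        · exact Or.inr ⟨h', h0 ▸ hi⟩)
  have hψW := hQ.trans hQW
  -- The intersection chart arises from that of φ by inverting the separator, whose negative is
  -- regular on the chart of ψ and hence lies in W.
  have hle : nonnegOn (path φ ∩ path ψ) ≤ W := by
    rw [nonnegOn_inter_eq_loc, sup_le_iff, AddSubmonoid.multiples_le]
    exact ⟨hW, hψW (neg_separator_mem φ ψ)⟩
  obtain ⟨δ, hδ⟩ := exists_ringHom_algebraMap_comp (R := R) (D.comp (inclHom 𝕜 hψW)) fun z => by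
    induction z using AddMonoidAlgebra.induction_linear with
    | zero => simp
    | add x y hx hy => rw [map_add]; exact add_mem hx hy
    | single m r =>
      -- Coefficients are integral because the constants of the hypersurface ring already map to R
      -- through β.
      have h1 := hint (algebraMap 𝕜 _ r)
      have h2 : chartHom 𝕜 W hxvW (algebraMap 𝕜 _ r) = AddMonoidAlgebra.single 0 r :=
        congr($(chartHom_comp_algebraMap 𝕜 W hxvW) r)
      rw [h2] at h1
      obtain ⟨h3, h4⟩ := hQ m.2
      have h5 := mul_mem h1 h4
      rw [← map_mul, AddMonoidAlgebra.single_mul_single, mul_one, zero_add] at h5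
      rwa [RingHom.comp_apply, inclHom_single]
  refine ⟨ψ, hψ, δ, D.comp (inclHom 𝕜 hle), ?_, ?_, ?_⟩
  · rw [← RingHom.cancel_left (FaithfulSMul.algebraMap_injective R K), ← RingHom.comp_assoc, hδ,
      RingHom.comp_assoc, inclHom_comp_chartHom 𝕜 hψW _ hxvW, h]
  · rw [RingHom.comp_assoc, inclHom_comp]
  · rw [RingHom.comp_assoc, inclHom_comp, hδ]

variable (𝕜) in
-- The spectrum of K is a single point, so the generic map factors through one chart, and the
-- question becomes one about ring homomorphisms.
theorem existence_π (hk : 1 ≤ k) : ValuativeCriterion.Existence (π n k 𝕜) := by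
  rintro ⟨R, K, i₁, i₂, ⟨w⟩⟩
  obtain ⟨φ, z, hz⟩ := exists_pathChart_eq n k 𝕜 (i₁ (IsLocalRing.closedPoint K))
  have hrange : Set.range i₁ ⊆ Set.range (subι n k 𝕜 φ.2 subset_rfl) := by
    rintro _ ⟨y, rfl⟩
    have : Subsingleton (Spec (.of K)) := inferInstanceAs (Subsingleton (PrimeSpectrum K))
    exact ⟨z, by rw [hz, Subsingleton.elim y (IsLocalRing.closedPoint K)]⟩
  obtain ⟨γ, rfl⟩ : ∃ γ : AddMonoidAlgebra 𝕜 (nonnegOn (path φ.1)) →+* K,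
      Spec.map (CommRingCat.ofHom γ) ≫ subι n k 𝕜 φ.2 subset_rfl = i₁ :=
    ⟨(Spec.preimage (IsOpenImmersion.lift _ i₁ hrange)).hom, by
      rw [CommRingCat.ofHom_hom, Spec.map_preimage, IsOpenImmersion.lift_fac]⟩
  obtain ⟨β, rfl⟩ : ∃ β : HypersurfaceRing n k 𝕜 →+* R, Spec.map (CommRingCat.ofHom β) = i₂ :=
    ⟨(Spec.preimage i₂).hom, by rw [CommRingCat.ofHom_hom]; exact Spec.map_preimage i₂⟩
  have h : γ.comp (chartHom 𝕜 (nonnegOn (path φ.1)) ⟨x_mem_nonnegOn _, v_mem_nonnegOn _⟩) =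
      (algebraMap R K).comp β := by
    rw [Category.assoc, subι_π] at w
    have w' := ((Spec.map_comp _ _).trans w).trans (Spec.map_comp _ _).symm
    exact congrArg CommRingCat.Hom.hom (Spec.map_injective w')
  obtain ⟨ψ, hψ, δ, ε, h1, h2, h3⟩ := exists_path_of_valuationRing hk φ.2 γ β h
  have l1 : Spec.map (CommRingCat.ofHom (algebraMap R K)) ≫ Spec.map (CommRingCat.ofHom δ) ≫
      subι n k 𝕜 hψ subset_rfl = Spec.map (CommRingCat.ofHom γ) ≫ subι n k 𝕜 φ.2 subset_rfl := by
    rw [← Category.assoc, ← Spec.map_comp, ← CommRingCat.ofHom_comp, ← h3, ← h2,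
      CommRingCat.ofHom_comp, CommRingCat.ofHom_comp, Spec.map_comp, Spec.map_comp, Category.assoc,
      Category.assoc, SpecMap_inclHom_subι n k 𝕜 φ.2 hψ Finset.inter_subset_right
        Finset.inter_subset_left subset_rfl,
      SpecMap_inclHom_subι n k 𝕜 φ.2 φ.2 Finset.inter_subset_left
        Finset.inter_subset_left subset_rfl]
  have l2 : (Spec.map (CommRingCat.ofHom δ) ≫ subι n k 𝕜 hψ subset_rfl) ≫ π n k 𝕜 =
      Spec.map (CommRingCat.ofHom β) := by
    rw [Category.assoc, subι_π, ← h1]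
    exact (Spec.map_comp _ _).symm
  exact ⟨⟨⟨Spec.map (CommRingCat.ofHom δ) ≫ subι n k 𝕜 hψ subset_rfl, l1, l2⟩⟩⟩

variable (𝕜) in
theorem isProper_π (hk : 1 ≤ k) : IsProper (π n k 𝕜) :=
  have := UniversallyClosed.of_valuativeCriterion _ (existence_π (n := n) 𝕜 hk)
  { }

end ValuativeCriterion

/-! ### The hypersurface as an affine toric scheme -/

section HypersurfaceRing

variable (n k : ℕ)

/-- The element of `H` attached to a monomial in the `X_i` and the `V_j`. -/
def ofExponents : (Fin (n + 1) → ℕ) × (Fin k → ℕ) →+ H n k where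
  toFun a := (∑ i, a.1 i • x i) + ∑ j, a.2 j • v j
  map_zero' := by simp
  map_add' a b := by
    simp only [Prod.fst_add, Prod.snd_add, Pi.add_apply, add_smul, Finset.sum_add_distrib]
    abel

theorem ofExponents_eq_mk (a : (Fin (n + 1) → ℕ) × (Fin k → ℕ)) :
    ofExponents n k a = QuotientAddGroup.mk (fun i => (a.1 i : ℤ), fun j => (a.2 j : ℤ)) := by
  simp only [ofExponents, AddMonoidHom.coe_mk, ZeroHom.coe_mk, x, v, ← QuotientAddGroup.mk_nsmul,
    ← QuotientAddGroup.mk_sum, ← QuotientAddGroup.mk_add]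
  congr 1
  ext i <;> simp [Prod.fst_sum, Prod.snd_sum, Finset.sum_apply, Pi.single_apply]

/-- The monoid of the affine hypersurface, generated by the `x_i` and the `v_j`. -/
def hypersurfaceMonoid : AddSubmonoid (H n k) := AddMonoidHom.mrange (ofExponents n k)

variable {n k}

theorem ofExponents_single_left (i : Fin (n + 1)) :
    ofExponents n k (Pi.single i 1, 0) = x i := by
  simp [ofExponents, Pi.single_apply]

theorem ofExponents_single_right (j : Fin k) : ofExponents n k (0, Pi.single j 1) = v j := by
  simp [ofExponents, Pi.single_apply]

theorem x_mem_hypersurfaceMonoid (i : Fin (n + 1)) : x i ∈ hypersurfaceMonoid n k :=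
  ⟨_, ofExponents_single_left i⟩

theorem v_mem_hypersurfaceMonoid (j : Fin k) : v j ∈ hypersurfaceMonoid n k :=
  ⟨_, ofExponents_single_right j⟩

theorem hypersurfaceMonoid_le {P : AddSubmonoid (H n k)} (hx : ∀ i, x i ∈ P)
    (hv : ∀ j, v j ∈ P) : hypersurfaceMonoid n k ≤ P := by
  rintro _ ⟨a, rfl⟩
  exact add_mem (sum_mem fun i _ => nsmul_mem (hx i) _) (sum_mem fun j _ => nsmul_mem (hv j) _)

variable (𝕜 : Type u) [CommRing 𝕜]

variable (n k) in
/-- The class of a monomial in the coordinate ring of the hypersurface. -/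
def monomialClass : Multiplicative ((Fin (n + 1) → ℕ) × (Fin k → ℕ)) →*
    HypersurfaceRing n k 𝕜 where
  toFun a := (∏ i, Ideal.Quotient.mk _ (MvPolynomial.X (Sum.inl i)) ^ a.toAdd.1 i) *
    ∏ j, Ideal.Quotient.mk _ (MvPolynomial.X (Sum.inr j)) ^ a.toAdd.2 j
  map_one' := by simp
  map_mul' a b := by
    simp only [toAdd_mul, Prod.fst_add, Prod.snd_add, Pi.add_apply, pow_add,
      Finset.prod_mul_distrib]
    ring

theorem prod_X_eq_prod_V :
    (∏ i : Fin (n + 1), Ideal.Quotient.mk _ (MvPolynomial.X (Sum.inl i)) :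
      HypersurfaceRing n k 𝕜) = ∏ j : Fin k, Ideal.Quotient.mk _ (MvPolynomial.X (Sum.inr j)) := by
  rw [← map_prod, ← map_prod, Ideal.Quotient.eq]
  exact Ideal.mem_span_singleton_self _

theorem monomialClass_eq_of_add {a b : (Fin (n + 1) → ℕ) × (Fin k → ℕ)} (s : ℕ)
    (h1 : ∀ i, a.1 i = b.1 i + s) (h2 : ∀ j, b.2 j = a.2 j + s) :
    monomialClass n k 𝕜 (.ofAdd a) = monomialClass n k 𝕜 (.ofAdd b) := by
  simp only [monomialClass, MonoidHom.coe_mk, OneHom.coe_mk, toAdd_ofAdd, h1, h2, pow_add,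
    Finset.prod_mul_distrib, Finset.prod_pow, prod_X_eq_prod_V]
  ring

/-- Monomials with equal class in H have exponents that differ by an integer multiple of (1, -1).
The relation ∏ X = ∏ V absorbs this difference, after choosing the direction in which the multiple
is nonnegative. -/
theorem monomialClass_congr {a b : (Fin (n + 1) → ℕ) × (Fin k → ℕ)}
    (h : ofExponents n k a = ofExponents n k b) :
    monomialClass n k 𝕜 (.ofAdd a) = monomialClass n k 𝕜 (.ofAdd b) := by
  rw [ofExponents_eq_mk, ofExponents_eq_mk, QuotientAddGroup.eq] at h
  obtain ⟨s, hs⟩ := h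
  have h1 : ∀ i, (b.1 i : ℤ) = a.1 i + s := fun i => by
    have := congrFun (congrArg Prod.fst hs) i
    simp at this
    omega
  have h2 : ∀ j, (a.2 j : ℤ) = b.2 j + s := fun j => by
    have := congrFun (congrArg Prod.snd hs) j
    simp at this
    omega
  rcases le_total 0 s with h | h
  · exact (monomialClass_eq_of_add 𝕜 s.toNat (fun i => by have := h1 i; omega)
      fun j => by have := h2 j; omega).symm
  · exact monomialClass_eq_of_add 𝕜 (-s).toNat (fun i => by have := h1 i; omega)
      fun j => by have := h2 j; omega

/-- The exponents of a monomial which is mapped to a given element of the monoid. -/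
def exponents (m : hypersurfaceMonoid n k) : (Fin (n + 1) → ℕ) × (Fin k → ℕ) :=
  (AddMonoidHom.mem_mrange.1 m.2).choose

theorem ofExponents_exponents (m : hypersurfaceMonoid n k) : ofExponents n k (exponents m) = m.1 :=
  (AddMonoidHom.mem_mrange.1 m.2).choose_spec

variable (n k) in
/-- The map from the monoid of the hypersurface to its coordinate ring. -/
def hypersurfaceMonoidHom : Multiplicative (hypersurfaceMonoid n k) →* HypersurfaceRing n k 𝕜 where
  toFun m := monomialClass n k 𝕜 (.ofAdd (exponents m.toAdd))
  map_one' := by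
    rw [← map_one (monomialClass n k 𝕜)]
    refine monomialClass_congr 𝕜 ?_
    rw [ofExponents_exponents]
    exact (map_zero _).symm
  map_mul' a b := by
    rw [← map_mul]
    refine monomialClass_congr 𝕜 ((ofExponents_exponents _).trans ?_)
    rw [map_add]
    exact (congrArg₂ (· + ·) (ofExponents_exponents _) (ofExponents_exponents _)).symm

theorem hypersurfaceMonoidHom_ofExponents (a : (Fin (n + 1) → ℕ) × (Fin k → ℕ)) :
    hypersurfaceMonoidHom n k 𝕜 (.ofAdd ⟨ofExponents n k a, a, rfl⟩) =
      monomialClass n k 𝕜 (.ofAdd a) :=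
  monomialClass_congr 𝕜 (ofExponents_exponents _)

theorem chartHom_X {P : AddSubmonoid (H n k)} (hP : (∀ i, x i ∈ P) ∧ ∀ j, v j ∈ P) (i) :
    chartHom 𝕜 P hP (Ideal.Quotient.mk _ (MvPolynomial.X (Sum.inl i))) =
      AddMonoidAlgebra.single ⟨x i, hP.1 i⟩ 1 := by
  simp [chartHom]

theorem chartHom_V {P : AddSubmonoid (H n k)} (hP : (∀ i, x i ∈ P) ∧ ∀ j, v j ∈ P) (j) :
    chartHom 𝕜 P hP (Ideal.Quotient.mk _ (MvPolynomial.X (Sum.inr j))) =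
      AddMonoidAlgebra.single ⟨v j, hP.2 j⟩ 1 := by
  simp [chartHom]

theorem chartHom_monomialClass {P : AddSubmonoid (H n k)} (hP : (∀ i, x i ∈ P) ∧ ∀ j, v j ∈ P)
    (a : (Fin (n + 1) → ℕ) × (Fin k → ℕ)) :
    chartHom 𝕜 P hP (monomialClass n k 𝕜 (.ofAdd a)) = AddMonoidAlgebra.single
      ⟨ofExponents n k a, hypersurfaceMonoid_le hP.1 hP.2 ⟨a, rfl⟩⟩ 1 := by
  simp only [monomialClass, MonoidHom.coe_mk, OneHom.coe_mk, toAdd_ofAdd, map_mul, map_prod,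
    map_pow, chartHom_X, chartHom_V, AddMonoidAlgebra.single_pow, one_pow, prod_single,
    AddMonoidAlgebra.single_mul_single, mul_one]
  congr 1
  ext
  simp [ofExponents]

/-- Sending a character to any monomial representing it is well defined by `monomialClass_congr`,
and gives a left inverse; surjectivity holds because monomials map onto the characters. This
identification lets openness and density be decided by localizing monoids. -/
theorem chartHom_hypersurfaceMonoid_bijective : Function.Bijective
    (chartHom 𝕜 (hypersurfaceMonoid n k) ⟨x_mem_hypersurfaceMonoid, v_mem_hypersurfaceMonoid⟩) := by
  let ρ : AddMonoidAlgebra 𝕜 (hypersurfaceMonoid n k) →ₐ[𝕜] HypersurfaceRing n k 𝕜 :=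
    AddMonoidAlgebra.lift 𝕜 _ _ (hypersurfaceMonoidHom n k 𝕜)
  have hρ : ∀ a r, ρ (AddMonoidAlgebra.single ⟨ofExponents n k a, a, rfl⟩ r) =
      r • monomialClass n k 𝕜 (.ofAdd a) := fun a r => by
    rw [← hypersurfaceMonoidHom_ofExponents]
    exact AddMonoidAlgebra.lift_single _ _ _
  constructor
  · have key : ρ.toRingHom.comp (chartHom 𝕜 (hypersurfaceMonoid n k)
        ⟨x_mem_hypersurfaceMonoid, v_mem_hypersurfaceMonoid⟩) = RingHom.id _ := by
      refine Ideal.Quotient.ringHom_ext (MvPolynomial.ringHom_ext (fun r => ?_) ?_)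
      · refine (congrArg ρ congr($(chartHom_comp_algebraMap 𝕜 (hypersurfaceMonoid n k)
          ⟨x_mem_hypersurfaceMonoid, v_mem_hypersurfaceMonoid⟩) r)).trans ?_
        exact ρ.commutes r
      · rintro (i | j)
        · refine (congrArg ρ (chartHom_X 𝕜 _ i)).trans ?_
          have e : (⟨x i, x_mem_hypersurfaceMonoid i⟩ : hypersurfaceMonoid n k) =
            ⟨_, (Pi.single i 1, 0), rfl⟩ := Subtype.ext (ofExponents_single_left i).symm
          rw [e, hρ, one_smul]
          simp [monomialClass, Pi.single_apply]
        · refine (congrArg ρ (chartHom_V 𝕜 _ j)).trans ?_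
          have e : (⟨v j, v_mem_hypersurfaceMonoid j⟩ : hypersurfaceMonoid n k) =
            ⟨_, (0, Pi.single j 1), rfl⟩ := Subtype.ext (ofExponents_single_right j).symm
          rw [e, hρ, one_smul]
          simp [monomialClass, Pi.single_apply]
    exact Function.LeftInverse.injective (g := ρ) fun a => congr($key a)
  · intro z
    induction z using AddMonoidAlgebra.induction_linear with
    | zero => exact ⟨0, map_zero _⟩
    | add x y hx hy =>
      obtain ⟨a, rfl⟩ := hx
      obtain ⟨b, rfl⟩ := hy
      exact ⟨a + b, map_add _ _ _⟩
    | single m r =>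
      obtain ⟨_, a, rfl⟩ := m
      refine ⟨algebraMap 𝕜 _ r * monomialClass n k 𝕜 (.ofAdd a), ?_⟩
      rw [map_mul, chartHom_monomialClass]
      have h1 := congr($(chartHom_comp_algebraMap 𝕜 (hypersurfaceMonoid n k)
        ⟨x_mem_hypersurfaceMonoid, v_mem_hypersurfaceMonoid⟩) r)
      rw [RingHom.comp_apply] at h1
      rw [h1, AddMonoidAlgebra.coe_algebraMap]
      simp [AddMonoidAlgebra.single_mul_single]

end HypersurfaceRing

/-! ### The torus and the ray charts as open subsets of the hypersurface -/

section Birational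

variable {n k : ℕ}

theorem inclHom_injective {M : Type} [AddCommGroup M] (𝕜 : Type u) [CommRing 𝕜]
    {P Q : AddSubmonoid M} (h : P ≤ Q) : Function.Injective (inclHom 𝕜 h) :=
  AddMonoidAlgebra.mapDomain_injective (AddSubmonoid.inclusion_injective h)

theorem sum_zsmul_shift {G ι κ : Type*} [AddCommGroup G] [Fintype ι] [Fintype κ] {a : ι → G}
    {b : κ → G} (h : ∑ i, a i = ∑ j, b j) (α e : ι → ℤ) (β f : κ → ℤ) (B N : ℤ) :
    ∑ i, (α i + B + N * e i) • a i + ∑ j, (β j - B + N * f j) • b j =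
      ∑ i, α i • a i + ∑ j, β j • b j + N • (∑ i, e i • a i + ∑ j, f j • b j) := by
  simp only [add_smul, sub_smul, mul_smul, Finset.sum_add_distrib, Finset.sum_sub_distrib,
    ← Finset.smul_sum, h, smul_add]
  abel

/-- Inverting all X_i and V_j except one of each, say X_a and V_b, solves the equation for X_a up to
a unit factor: what remains is the chart of the ray (a, b). So π is an open immersion along each ray
chart. -/
theorem isLocOf_hypersurfaceMonoid_singleton (q : Fin (n + 1) × Fin k) :
    IsLocOf (nonnegOn {q}) (hypersurfaceMonoid n k) := by
  classical
  set e : (Fin (n + 1) → ℕ) × (Fin k → ℕ) :=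
    (fun i => if i = q.1 then 0 else 1, fun j => if j = q.2 then 0 else 1) with he
  have hray : ∀ a, ray q (ofExponents n k a) = a.1 q.1 + a.2 q.2 := fun a => by
    simp [ofExponents, ray_x, ray_v]
  refine ⟨ofExponents n k e, ⟨e, rfl⟩, ?_⟩
  ext m
  rw [mem_loc]
  constructor
  · intro hm
    obtain ⟨α, β, rfl⟩ := exists_rep m
    have hm' := hm q (Finset.mem_singleton_self q)
    simp only [map_add, map_sum, map_zsmul, ray_x, ray_v, smul_eq_mul, mul_ite, mul_one, mul_zero,
      Finset.sum_ite_eq', Finset.mem_univ, if_true] at hm'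
    -- The relation of H allows shifting the exponents by β at q.2. Then the exponent of the
    -- uninverted V is 0, that of the uninverted X is the value of m on the ray, and N copies of e
    -- make all the others nonnegative.
    let N : ℕ := ∑ i, (α i + β q.2).natAbs + ∑ j, (β j - β q.2).natAbs
    have hN1 : ∀ i, (α i + β q.2).natAbs ≤ N := fun i =>
      (Finset.single_le_sum (f := fun i => (α i + β q.2).natAbs) (fun _ _ => Nat.zero_le _)
        (Finset.mem_univ i)).trans (Nat.le_add_right _ _)
    have hN2 : ∀ j, (β j - β q.2).natAbs ≤ N := fun j =>
      (Finset.single_le_sum (f := fun j => (β j - β q.2).natAbs) (fun _ _ => Nat.zero_le _)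
        (Finset.mem_univ j)).trans (Nat.le_add_left _ _)
    refine ⟨N, (fun i => (α i + β q.2 + N * e.1 i).toNat,
      fun j => (β j - β q.2 + N * e.2 j).toNat), ?_⟩
    have h1 : ∀ i, 0 ≤ α i + β q.2 + N * e.1 i := fun i => by
      have := hN1 i
      rcases eq_or_ne i q.1 with rfl | hi
      · simpa [he] using hm'
      · simp only [he, if_neg hi]
        push_cast
        omega
    have h2 : ∀ j, 0 ≤ β j - β q.2 + N * e.2 j := fun j => by
      have := hN2 j
      rcases eq_or_ne j q.2 with rfl | hj
      · simp [he]
      · simp only [he, if_neg hj]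
        push_cast
        omega
    simp only [ofExponents, AddMonoidHom.coe_mk, ZeroHom.coe_mk, ← natCast_zsmul,
      Int.toNat_of_nonneg (h1 _), Int.toNat_of_nonneg (h2 _)]
    exact sum_zsmul_shift sum_x_eq_sum_v _ _ _ _ _ _
  · rintro ⟨N, a, ha⟩ p hp
    rw [Finset.mem_singleton] at hp
    subst hp
    have h1 := congrArg (ray p) ha
    rw [map_add, map_nsmul, hray, hray] at h1
    simp [he] at h1
    omega

theorem mem_path_const (q : Fin (n + 1) × Fin k) : q ∈ path (fun _ : Fin n => q.2) :=
  mem_path.2 fun _ => ⟨fun _ => le_rfl, fun _ => le_rfl⟩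

theorem isLocOf_hypersurfaceMonoid_empty (hk : 1 ≤ k) :
    IsLocOf (nonnegOn (∅ : Finset (Fin (n + 1) × Fin k))) (hypersurfaceMonoid n k) :=
  (isLocOf_nonnegOn (Finset.empty_subset _)
    (Finset.singleton_subset_iff.2 (mem_path_const (0, ⟨0, hk⟩)))).trans
    (isLocOf_hypersurfaceMonoid_singleton _)

variable (𝕜 : Type u) [CommRing 𝕜]

theorem chartHom_injective {P : AddSubmonoid (H n k)} (hP : (∀ i, x i ∈ P) ∧ ∀ j, v j ∈ P) :
    Function.Injective (chartHom 𝕜 P hP) := by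
  rw [← inclHom_comp_chartHom 𝕜 (hypersurfaceMonoid_le hP.1 hP.2)
    ⟨x_mem_hypersurfaceMonoid, v_mem_hypersurfaceMonoid⟩ hP]
  exact (inclHom_injective 𝕜 _).comp (chartHom_hypersurfaceMonoid_bijective 𝕜).1

theorem isOpenImmersion_chartHom {P : AddSubmonoid (H n k)} (hP : (∀ i, x i ∈ P) ∧ ∀ j, v j ∈ P)
    (h : IsLocOf P (hypersurfaceMonoid n k)) :
    IsOpenImmersion (Spec.map (CommRingCat.ofHom (chartHom 𝕜 P hP))) := by
  have hN : (∀ i, x i ∈ hypersurfaceMonoid n k) ∧ ∀ j, v j ∈ hypersurfaceMonoid n k :=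
    ⟨x_mem_hypersurfaceMonoid, v_mem_hypersurfaceMonoid⟩
  have h1 := isOpenImmersion_inclHom 𝕜 h
  have h2 : IsIso (CommRingCat.ofHom (chartHom 𝕜 (hypersurfaceMonoid n k) hN)) :=
    (ConcreteCategory.isIso_iff_bijective _).2 (chartHom_hypersurfaceMonoid_bijective 𝕜)
  rw [← inclHom_comp_chartHom 𝕜 h.le hN hP, CommRingCat.ofHom_comp, Spec.map_comp]
  infer_instance

theorem denseRange_SpecMap {R S : CommRingCat.{u}} (f : R ⟶ S)
    (hf : Function.Injective f.hom) : DenseRange (Spec.map f) :=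
  PrimeSpectrum.denseRange_comap_iff_ker_le_nilRadical _ |>.2 (by
    rw [(RingHom.injective_iff_ker_eq_bot _).1 hf]
    exact bot_le)

/-- A point of the chart of a lattice path over the torus lies in the torus. -/
theorem preimage_range_chartHom_empty (hk : 1 ≤ k) {φ : Fin n → Fin k}
    {z : Spec (.of (AddMonoidAlgebra 𝕜 (nonnegOn (path φ))))}
    (hz : Spec.map (CommRingCat.ofHom (chartHom 𝕜 (nonnegOn (path φ))
      ⟨x_mem_nonnegOn _, v_mem_nonnegOn _⟩)) z ∈
      Set.range (Spec.map (CommRingCat.ofHom (chartHom 𝕜 (nonnegOn (∅ : Finset (Fin (n + 1) × Fin k)))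
        ⟨x_mem_nonnegOn _, v_mem_nonnegOn _⟩)))) :
    z ∈ Set.range (Spec.map (CommRingCat.ofHom
      (inclHom 𝕜 (nonnegOn_anti (Finset.empty_subset (path φ)))))) := by
  obtain ⟨t, ht, hloc⟩ := isLocOf_hypersurfaceMonoid_empty (n := n) hk
  have hN : (∀ i, x i ∈ hypersurfaceMonoid n k) ∧ ∀ j, v j ∈ hypersurfaceMonoid n k :=
    ⟨x_mem_hypersurfaceMonoid, v_mem_hypersurfaceMonoid⟩
  have hle : hypersurfaceMonoid n k ≤ nonnegOn (path φ) :=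
    hypersurfaceMonoid_le (x_mem_nonnegOn _) (v_mem_nonnegOn _)
  -- The character t that cuts the torus out of the hypersurface also cuts it out of the chart.
  -- Hence it suffices that χ^t does not vanish at z, which can be checked at the image of z.
  have htop : nonnegOn (∅ : Finset (Fin (n + 1) × Fin k)) = nonnegOn (path φ) ⊔ AddSubmonoid.multiples (-t) :=
    le_antisymm (hloc.le.trans (sup_le_sup_right hle _))
      (sup_le (nonnegOn_anti (Finset.empty_subset _))
        ((AddSubmonoid.multiples_le).2 fun q hq => absurd hq (Finset.notMem_empty q)))
  rw [range_inclHom 𝕜 (hle ht) htop]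
  obtain ⟨w, hw⟩ := hz
  obtain ⟨a, ha⟩ := (chartHom_hypersurfaceMonoid_bijective 𝕜).2
    (AddMonoidAlgebra.single (⟨t, ht⟩ : hypersurfaceMonoid n k) (1 : 𝕜))
  intro hmem
  have h1 : a ∈ (Spec.map (CommRingCat.ofHom (chartHom 𝕜 (nonnegOn (path φ))
      ⟨x_mem_nonnegOn _, v_mem_nonnegOn _⟩)) z).asIdeal := by
    change chartHom 𝕜 _ ⟨x_mem_nonnegOn _, v_mem_nonnegOn _⟩ a ∈ z.asIdeal
    rw [← inclHom_comp_chartHom 𝕜 hle hN, RingHom.comp_apply, ha, inclHom_single]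
    exact hmem
  rw [← hw] at h1
  have h2 : chartHom 𝕜 (nonnegOn (∅ : Finset (Fin (n + 1) × Fin k))) ⟨x_mem_nonnegOn _, v_mem_nonnegOn _⟩ a ∈ w.asIdeal := h1
  rw [← inclHom_comp_chartHom 𝕜 (hle.trans (nonnegOn_anti (Finset.empty_subset _))) hN,
    RingHom.comp_apply, ha, inclHom_single] at h2
  refine w.isPrime.ne_top ((Ideal.eq_top_iff_one _).2 ?_)
  have h3 := w.asIdeal.mul_mem_left (AddMonoidAlgebra.single (⟨-t, by
    rw [hloc]
    exact neg_mem_loc _ _⟩ : nonnegOn (∅ : Finset (Fin (n + 1) × Fin k))) (1 : 𝕜)) h2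
  rw [AddMonoidAlgebra.single_mul_single, one_mul] at h3
  convert h3
  rw [AddMonoidAlgebra.one_def]
  congr 1
  ext
  simp

variable (n) in
theorem birational_π (hk : 1 ≤ k) : ∃ V : (hypersurface n k 𝕜).Opens,
    Dense (V : Set (hypersurface n k 𝕜)) ∧
    Dense ((π n k 𝕜 ⁻¹ᵁ V : (Y n k 𝕜).Opens) : Set (Y n k 𝕜)) ∧ IsIso (π n k 𝕜 ∣_ V) := by
  let φ₀ : Fin n → Fin k := fun _ => ⟨0, hk⟩
  have hφ₀ : Antitone φ₀ := antitone_const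
  let j := subι n k 𝕜 hφ₀ (Finset.empty_subset (path φ₀)) ≫ π n k 𝕜
  have hj : j = Spec.map (CommRingCat.ofHom (chartHom 𝕜 (nonnegOn (∅ : Finset (Fin (n + 1) × Fin k)))
      ⟨x_mem_nonnegOn _, v_mem_nonnegOn _⟩)) := subι_π n k 𝕜 hφ₀ _
  have hopen : IsOpenImmersion j := by
    rw [hj]
    exact isOpenImmersion_chartHom 𝕜 _ (isLocOf_hypersurfaceMonoid_empty hk)
  have hpre : π n k 𝕜 ⁻¹ᵁ j.opensRange =
      (subι n k 𝕜 hφ₀ (Finset.empty_subset (path φ₀))).opensRange := by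
    ext y
    constructor
    · rintro ⟨w, hw⟩
      obtain ⟨ψ, z, rfl⟩ := exists_pathChart_eq n k 𝕜 y
      have hz : Spec.map (CommRingCat.ofHom (chartHom 𝕜 (nonnegOn (path ψ.1))
          ⟨x_mem_nonnegOn _, v_mem_nonnegOn _⟩)) z = j w :=
        (congr($(subι_π n k 𝕜 ψ.2 subset_rfl) z)).symm.trans hw.symm
      obtain ⟨t, rfl⟩ := preimage_range_chartHom_empty 𝕜 hk (z := z) (by
        rw [hz, hj]
        exact ⟨w, rfl⟩)
      exact ⟨t, congr($(SpecMap_inclHom_subι n k 𝕜 hφ₀ ψ.2 (Finset.empty_subset _)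
        (Finset.empty_subset _) subset_rfl) t).symm⟩
    · rintro ⟨w, rfl⟩
      exact ⟨w, rfl⟩
  refine ⟨j.opensRange, ?_, ?_, ?_⟩
  · have : DenseRange j := by
      rw [hj]
      exact denseRange_SpecMap _ (chartHom_injective 𝕜 ⟨x_mem_nonnegOn _, v_mem_nonnegOn _⟩)
    exact this
  · rw [hpre]
    intro y
    obtain ⟨ψ, z, rfl⟩ := exists_pathChart_eq n k 𝕜 y
    have h1 := denseRange_SpecMap (CommRingCat.ofHom (inclHom 𝕜 (nonnegOn_anti
      (Finset.empty_subset (path ψ.1))))) (inclHom_injective 𝕜 _) z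
    have h2 := image_closure_subset_closure_image (subι n k 𝕜 ψ.2 subset_rfl).continuous
      ⟨z, h1, rfl⟩
    refine closure_mono ?_ h2
    rintro _ ⟨_, ⟨t, rfl⟩, rfl⟩
    exact ⟨t, congr($(SpecMap_inclHom_subι n k 𝕜 hφ₀ ψ.2 (Finset.empty_subset _)
        (Finset.empty_subset _) subset_rfl) t).symm⟩
  · have hpb : IsPullback (𝟙 _) (subι n k 𝕜 hφ₀ (Finset.empty_subset (path φ₀))) j (π n k 𝕜) :=
      IsOpenImmersion.isPullback _ _ _ _ (Category.id_comp _).symm hpre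
    have h1 : IsIso (pullback.snd (π n k 𝕜) j) := by
      rw [← hpb.flip.isoPullback_inv_snd]
      infer_instance
    have := (MorphismProperty.arrow_mk_iso_iff (MorphismProperty.isomorphisms Scheme)
      (morphismRestrictOpensRange (π n k 𝕜) j)).2 h1
    exact this

end Birational

/-! ### Codimension of points where two coordinates vanish -/

section Codimension

/-- Removing a variable from a prime ideal of a polynomial ring. -/
theorem exists_prime_le_X_notMem {σ : Type*} {𝕜 : Type*} [CommRing 𝕜] {p : Ideal (MvPolynomial σ 𝕜)}
    [p.IsPrime] {s : σ} (hs : MvPolynomial.X s ∈ p) : ∃ q : Ideal (MvPolynomial σ 𝕜), q.IsPrime ∧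
      q ≤ p ∧ MvPolynomial.X s ∉ q ∧ ∀ t ≠ s, MvPolynomial.X t ∈ p → MvPolynomial.X t ∈ q := by
  classical
  -- The variable X_s is made free over the residue ring of p while the others keep their residues.
  -- The kernel is prime because the target is a domain, and setting the new variable to 0 recovers
  -- the quotient map, so the kernel lies in p.
  let f : MvPolynomial σ 𝕜 →ₐ[𝕜] Polynomial (MvPolynomial σ 𝕜 ⧸ p) :=
    MvPolynomial.aeval fun t =>
      if t = s then Polynomial.X else Polynomial.C (Ideal.Quotient.mk p (MvPolynomial.X t))
  refine ⟨RingHom.ker f, RingHom.ker_isPrime f, fun a ha => ?_, ?_, fun t ht htp => ?_⟩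
  · have key : (Polynomial.evalRingHom 0).comp f.toRingHom = Ideal.Quotient.mk p := by
      refine MvPolynomial.ringHom_ext (fun r => ?_) fun t => ?_
      · simp [f]
        rfl
      · rcases eq_or_ne t s with rfl | h
        · simpa [f] using (Ideal.Quotient.eq_zero_iff_mem.2 hs).symm
        · simp [f, h]
    rw [← Ideal.Quotient.eq_zero_iff_mem, ← key, RingHom.comp_apply]
    exact (congrArg _ (RingHom.mem_ker.1 ha)).trans (map_zero _)
  · simp [RingHom.mem_ker, f]
  · simp [RingHom.mem_ker, f, ht, Ideal.Quotient.eq_zero_iff_mem, htp]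

/-- Larger points are generizations, so coheight counts chains of primes below the given one, that
is, codimension. -/
theorem Spec_lt_iff {R : CommRingCat.{u}} {a b : Spec R} : a < b ↔ b.asIdeal < a.asIdeal := by
  have h : ∀ a b : Spec R, a ≤ b ↔ b.asIdeal ≤ a.asIdeal := fun a b =>
    Scheme.le_iff_specializes.trans (PrimeSpectrum.le_iff_specializes b a).symm
  rw [lt_iff_le_not_ge, lt_iff_le_not_ge, h, h]

/-- A point of an affine space at which two coordinates vanish has codimension at least two. -/
theorem two_le_coheight_of_X_mem {σ : Type} {𝕜 : Type u} [CommRing 𝕜]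
    (z : Spec (.of (MvPolynomial σ 𝕜))) {s t : σ} (hst : s ≠ t)
    (hs : MvPolynomial.X s ∈ z.asIdeal) (ht : MvPolynomial.X t ∈ z.asIdeal) :
    2 ≤ Order.coheight z := by
  have := z.isPrime
  obtain ⟨q, hq, hqp, hsq, htq⟩ := exists_prime_le_X_notMem hs
  obtain ⟨r, hr, hrq, htr, -⟩ := exists_prime_le_X_notMem (htq t hst.symm ht)
  have h1 : z < (⟨q, hq⟩ : PrimeSpectrum (MvPolynomial σ 𝕜)) :=
    Spec_lt_iff.2 (lt_of_le_of_ne hqp fun h => hsq (h.ge hs))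
  have h2 : (show Spec (.of (MvPolynomial σ 𝕜)) from ⟨q, hq⟩) <
      (show Spec (.of (MvPolynomial σ 𝕜)) from ⟨r, hr⟩) :=
    Spec_lt_iff.2 (lt_of_le_of_ne hrq fun h => htr (h.ge (htq t hst.symm ht)))
  calc (2 : ℕ∞) = 0 + 1 + 1 := by norm_num
    _ ≤ _ := add_le_add_left (add_le_add_left (zero_le) 1) 1
    _ ≤ _ := add_le_add_left (Order.coheight_add_one_le h2) 1
    _ ≤ _ := Order.coheight_add_one_le h1

theorem coheight_le_coheight_apply {X Y : Scheme.{u}} (f : X ⟶ Y) [IsOpenImmersion f] (x : X) :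
    Order.coheight x ≤ Order.coheight (f x) :=
  Order.coheight_le_coheight_apply_of_strictMono f (fun a b h => by
    rw [lt_iff_le_not_ge, Scheme.le_iff_specializes, Scheme.le_iff_specializes] at h ⊢
    rwa [f.isOpenEmbedding.isInducing.specializes_iff,
      f.isOpenEmbedding.isInducing.specializes_iff]) x

end Codimension

/-! ### The exceptional locus -/

section Small

variable {n k : ℕ} (𝕜 : Type u) [CommRing 𝕜]

theorem path_nonempty (hk : 1 ≤ k) {φ : Fin n → Fin k} (hφ : Antitone φ) : (path φ).Nonempty := by
  rw [Finset.nonempty_iff_ne_empty]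
  intro h
  have h1 := eq_sum_dualVec hφ (x 0)
  rw [h, Finset.sum_empty] at h1
  have h2 := ray_x ((0, ⟨0, hk⟩) : Fin (n + 1) × Fin k) 0
  rw [h1, map_zero, if_pos rfl] at h2
  exact zero_ne_one h2

theorem two_le_coheight_subι {φ : Fin n → Fin k} (hφ : Antitone φ)
    (z : Spec (.of (AddMonoidAlgebra 𝕜 (nonnegOn (path φ))))) {s t : path φ} (hst : s ≠ t)
    (hs : AddMonoidAlgebra.single (⟨dualVec φ s.1, dualVec_mem_nonnegOn subset_rfl s.1⟩ :
      nonnegOn (path φ)) (1 : 𝕜) ∈ z.asIdeal)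
    (ht : AddMonoidAlgebra.single (⟨dualVec φ t.1, dualVec_mem_nonnegOn subset_rfl t.1⟩ :
      nonnegOn (path φ)) (1 : 𝕜) ∈ z.asIdeal) :
    2 ≤ Order.coheight (subι n k 𝕜 hφ subset_rfl z) := by
  let e := (pathChartAlgEquiv 𝕜 hφ).toRingEquiv.toCommRingCatIso
  obtain ⟨w, rfl⟩ : ∃ w, Spec.map e.hom w = z :=
    ⟨Spec.map e.inv z, by
      rw [← Scheme.Hom.comp_apply, ← Spec.map_comp, Iso.hom_inv_id, Spec.map_id]
      rfl⟩
  have key : ∀ q : path φ, AddMonoidAlgebra.single (⟨dualVec φ q.1, dualVec_mem_nonnegOn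
      subset_rfl q.1⟩ : nonnegOn (path φ)) (1 : 𝕜) ∈ (Spec.map e.hom w).asIdeal →
      MvPolynomial.X q ∈ w.asIdeal := fun q hq => by
    rw [← pathChartAlgEquiv_single 𝕜 hφ q]
    exact hq
  refine (two_le_coheight_of_X_mem w hst (key s hs) (key t ht)).trans ?_
  rw [← Scheme.Hom.comp_apply]
  exact coheight_le_coheight_apply _ w

theorem mem_range_inclHom_of_notMem {φ : Fin n → Fin k} {I : Finset (Fin (n + 1) × Fin k)}
    (hI : I ⊆ path φ) (z : Spec (.of (AddMonoidAlgebra 𝕜 (nonnegOn (path φ)))))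
    (hz : ∀ q ∈ path φ, q ∉ I → AddMonoidAlgebra.single (⟨dualVec φ q, dualVec_mem_nonnegOn
      subset_rfl q⟩ : nonnegOn (path φ)) (1 : 𝕜) ∉ z.asIdeal) :
    z ∈ Set.range (Spec.map (CommRingCat.ofHom (inclHom 𝕜 (nonnegOn_anti hI)))) := by
  classical
  have hu : ∑ p ∈ path φ \ I, dualVec φ p ∈ nonnegOn (path φ) :=
    sum_mem fun p _ => dualVec_mem_nonnegOn subset_rfl p
  rw [range_inclHom 𝕜 hu (nonnegOn_eq_loc_sum_dualVec hI subset_rfl)]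
  have hprod : AddMonoidAlgebra.single (⟨_, hu⟩ : nonnegOn (path φ)) (1 : 𝕜) =
      ∏ p ∈ path φ \ I, AddMonoidAlgebra.single (⟨dualVec φ p, dualVec_mem_nonnegOn
        subset_rfl p⟩ : nonnegOn (path φ)) (1 : 𝕜) := by
    rw [← Finset.prod_coe_sort, prod_single]
    congr 1
    ext
    rw [AddSubmonoid.coe_finsetSum]
    exact (Finset.sum_coe_sort _ _).symm
  intro hmem
  rw [hprod] at hmem
  obtain ⟨p, hp, hpz⟩ := z.isPrime.prod_mem_iff.1 hmem
  exact hz p (Finset.mem_sdiff.1 hp).1 (Finset.mem_sdiff.1 hp).2 hpz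

/-- If at most one chart coordinate vanishes at a point, the point lies in the chart of a single
ray, where π is an open immersion. Otherwise two coordinates of an affine space vanish there. -/
theorem small_π (hk : 1 ≤ k) (y : Y n k 𝕜)
    (hy : ¬ ∃ U : (Y n k 𝕜).Opens, y ∈ U ∧ IsOpenImmersion (U.ι ≫ π n k 𝕜)) :
    2 ≤ Order.coheight y := by
  obtain ⟨φ, z, rfl⟩ := exists_pathChart_eq n k 𝕜 y
  by_cases h : ∃ q ∈ path φ.1, ∀ p ∈ path φ.1, p ∉ ({q} : Finset _) →
      AddMonoidAlgebra.single (⟨dualVec φ.1 p, dualVec_mem_nonnegOn subset_rfl p⟩ :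
        nonnegOn (path φ.1)) (1 : 𝕜) ∉ z.asIdeal
  · obtain ⟨q, hq, h⟩ := h
    have hI : {q} ⊆ path φ.1 := Finset.singleton_subset_iff.2 hq
    obtain ⟨w, rfl⟩ := mem_range_inclHom_of_notMem 𝕜 hI z h
    refine absurd ⟨(subι n k 𝕜 φ.2 hI).opensRange, ⟨w, ?_⟩, ?_⟩ hy
    · exact congr($(SpecMap_inclHom_subι n k 𝕜 φ.2 φ.2 hI hI subset_rfl) w).symm
    · rw [← Scheme.Hom.isoOpensRange_inv_comp, Category.assoc, subι_π]
      have := isOpenImmersion_chartHom 𝕜 ⟨x_mem_nonnegOn {q}, v_mem_nonnegOn {q}⟩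
        (isLocOf_hypersurfaceMonoid_singleton q)
      exact inferInstanceAs (IsOpenImmersion (_ ≫ Spec.map _))
  · push Not at h
    -- For every vertex there is now a different one whose coordinate vanishes. Starting from an
    -- arbitrary vertex, two applications yield two distinct vanishing coordinates.
    obtain ⟨q₀, hq₀⟩ := path_nonempty hk φ.2
    obtain ⟨q₁, hq₁, -, h₁⟩ := h q₀ hq₀
    obtain ⟨q₂, hq₂, hne, h₂⟩ := h q₁ hq₁
    exact two_le_coheight_subι 𝕜 φ.2 z (s := ⟨q₁, hq₁⟩) (t := ⟨q₂, hq₂⟩)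
      (fun e => hne (Finset.mem_singleton.2 (congrArg Subtype.val e).symm)) h₁ h₂

theorem isSmallResolution_π (hk : 1 ≤ k) :
    IsSmallResolution (π n k 𝕜) (hypersurfaceToBase n k 𝕜) where
  smooth := smooth_π n k 𝕜
  proper := isProper_π 𝕜 hk
  birational := birational_π n 𝕜 hk
  small := small_π 𝕜 hk

end Small

end SmallRes

end

theorem proposition2 (n k : ℕ) (hk : 1 ≤ k) (𝕜 : Type u) [CommRing 𝕜] :
    -- the staircase simplices form a triangulation of `Δ_n × Δ_{k-1}`
    (∃ K : Geometry.SimplicialComplex ℝ ((Fin (n + 1) → ℝ) × (Fin k → ℝ)),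
      K.faces = SmallRes.triangulation n k ∧ K.space = SmallRes.polytope n k) ∧
    -- the cones `σ_φ` are the cones over its maximal simplices, i.e. over the lattice paths
    (∃ e : {φ : Fin n → Fin k // Antitone φ} ≃
        {L : Finset (Fin (n + 1) × Fin k) //
          IsMaxChain (SmallRes.prodRel (· ≤ ·) (· ≥ ·)) (L : Set (Fin (n + 1) × Fin k))},
      ∀ φ, SmallRes.cone φ.1 =
          SmallRes.coneOver (SmallRes.vertex '' ((e φ).1 : Set (Fin (n + 1) × Fin k))) ∧
        ∀ p : Fin n, (p.castSucc, φ.1 p) ∈ (e φ).1 ∧ (p.succ, φ.1 p) ∈ (e φ).1) ∧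
    -- the fan of `𝒴_{n,k}` is a smooth fan, and it is the fan attached to the triangulation
    SmallRes.IsSmoothFan (SmallRes.fan n k) ∧
    SmallRes.fan n k = SmallRes.triangulationFan n k ∧
    -- `π` is the toric morphism attached to the triangulation
    (∃ E : SmallRes.Y n k 𝕜 ≅ SmallRes.triangulationScheme n k 𝕜,
      E.hom ≫ SmallRes.triangulationResolution n k 𝕜 = SmallRes.π n k 𝕜 ∧
      ∀ (P : SmallRes.Chart (SmallRes.fan n k)) (Q : SmallRes.Chart (SmallRes.triangulationFan n k))
        (h : Q.monoid = P.monoid),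
        SmallRes.chartι (SmallRes.fan n k) 𝕜 P ≫ E.hom =
          Spec.map (CommRingCat.ofHom (SmallRes.inclHom 𝕜 h.le)) ≫
            SmallRes.chartι (SmallRes.triangulationFan n k) 𝕜 Q) ∧
    -- and it is a small resolution
    SmallRes.IsSmallResolution (SmallRes.π n k 𝕜) (SmallRes.hypersurfaceToBase n k 𝕜) := by
  exact ⟨⟨SmallRes.triangulationComplex hk, rfl, SmallRes.triangulationComplex_space hk⟩,
    ⟨SmallRes.pathEquiv hk, fun φ =>
      ⟨(SmallRes.cone_eq_rayCone φ.2).trans (SmallRes.coneOver_vertex _).symm,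
        fun p => ⟨SmallRes.castSucc_mem_path φ.2 p, SmallRes.succ_mem_path φ.2 p⟩⟩⟩,
    SmallRes.isSmoothFan_fan, SmallRes.fan_eq_triangulationFan hk,
    SmallRes.exists_iso_of_eq 𝕜 (SmallRes.fan_eq_triangulationFan hk) SmallRes.fan_nonneg
      SmallRes.triangulationFan_nonneg,
    SmallRes.isSmallResolution_π 𝕜 hk⟩
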